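/- Let $n\ge 1$ and let $(M^{2n},\omega)$ be a smooth symplectic manifold (Hausdorff, second countable) with (possibly empty) smooth boundary $\partial M$. Let $\Omega^k$ be the space of real $k$-forms smooth up to the boundary, with $\Omega^{-1}=\Omega^{-2}=0$, and let $L\eta=\omega\wedge\eta$ and $\Lambda\eta=\tfrac12(\omega^{-1})^{ij}\iota_{\partial_i}\iota_{\partial_j}\eta$. Let $P^k=\{\beta\in\Omega^k:\Lambda\beta=0\}$ be the space of primitive $k$-forms and, for $k\le n$, let $\Pi:\Omega^k\to P^k$ be the projection along $L\,\Omega^{k-2}$ given by the Lefschetz decomposition. For $k\le n$ let $*_r:P^k\to\Omega^{2n-k}$ be $*_r\beta=\omega^{n-k}\wedge\beta$. On primitive forms put $\partial_+\beta=\Pi\, d\beta$ and $\partial_-\beta=\frac{1}{n-k+1}\Lambda\, d\beta$ for $\beta\in P^k$, $1\le k\le n$, with $\partial_-=0$ on $P^0$. For a local boundary defining function $\rho$ and a differential operator $Q$ with principal symbol $\sigma_Q$, normalized so that $\sigma_Q(d\rho)\eta|_{\partial M}=\frac1{m!}Q(\rho^m\eta)|_{\partial M}$ when $Q$ has order $m$,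 consider the boundary condition $\sigma_Q(d\rho)\eta|_{\partial M}=0$. It is called $D$ for $Q=d$, $D_+$ for $Q=\partial_+$, $D_-$ for $Q=\partial_-$ (order $m=1$), and $D_{+-}$ for $Q=\partial_+\partial_-$ (order $m=2$). A subscript denotes the subspace of forms satisfying the condition. Then the following sequences of vector spaces are well defined and exact: $$0\to\Omega^{k-2}_D\xrightarrow{\,L\,}\Omega^k_D\xrightarrow{\,\Pi\,}P^k_{D_+}\to0\qquad(0\le k<n),$$ $$0\to\Omega^{n-2}_D\xrightarrow{\,L\,}\Omega^n_D\xrightarrow{\,\Pi\,}P^n_{D_{+-}}\to0,$$ $$0\to P^n_{D_-}\xrightarrow{\,*_r\,}\Omega^n_D\xrightarrow{\,L\,}\Omega^{n+2}_D\to0,$$ $$0\to P^k_{D_-}\xrightarrow{\,*_r\,}\Omega^{2n-k}_D\xrightarrow{\,L\,}\Omega^{2n-k+2}_D\to0\qquad(0\le k<n).$$ Moreover, $L:\Omega^{k-2}_D\to\Omega^k_D$ is injective for $2\le k\le n+1$, and $L:\Omega^{2n-k}_D\to\Omega^{2n-k+2}_D$ is surjective for $2\le k\le n$. -/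

import Mathlib

open scoped Manifold ContDiff Topology

noncomputable section

namespace SymplecticBoundary

/-- The model vector space `ℝ²ⁿ`. Every tangent space of a `2n`-dimensional manifold with boundary
is (definitionally) a copy of it, through the preferred chart at the point. -/
abbrev Model (n : ℕ) : Type := EuclideanSpace ℝ (Fin (2 * n))

/-- Alternating `k`-forms on `ℝ²ⁿ`. -/
abbrev Alt (n k : ℕ) : Type := Model n [⋀^Fin k]→L[ℝ] ℝ

/-! ### Linear algebra of forms at a point -/

/-- The coordinate vector `∂/∂xⁱ`. -/
def basisVec {n : ℕ} (i : Fin (2 * n)) : Model n := EuclideanSpace.single i (1 : ℝ)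

/-- The coordinate covector `dxⁱ`. -/
def basisCovec {n : ℕ} (i : Fin (2 * n)) : Model n →L[ℝ] ℝ := EuclideanSpace.proj i

/-- Exterior product `α ∧ η` of a covector and a `k`-form:
`(α ∧ η)(v₀, …, v_k) = ∑ᵢ (-1)ⁱ α(vᵢ) η(v₀, …, v̂ᵢ, …, v_k)`. -/
def covWedge {n : ℕ} (k : ℕ) (α : Model n →L[ℝ] ℝ) : Alt n k →ₗ[ℝ] Alt n (k + 1) where
  toFun η := ContinuousAlternatingMap.alternatizeUncurryFin (α.smulRight η)
  map_add' η ξ := by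
    rw [← ContinuousAlternatingMap.alternatizeUncurryFin_add]
    congr 1
    ext1 v
    simp
  map_smul' c η := by
    rw [RingHom.id_apply, ← ContinuousAlternatingMap.alternatizeUncurryFin_smul]
    congr 1
    ext1 v
    exact smul_comm (α v) c η

/-- Interior product `ι_v η = η(v, ·, …, ·)`. -/
def interior {n : ℕ} (k : ℕ) (v : Model n) : Alt n (k + 1) →ₗ[ℝ] Alt n k where
  toFun η := η.curryLeft v
  map_add' _ _ := rfl
  map_smul' _ _ := rfl

/-- The matrix `ω_{ij} = ω(∂/∂xⁱ, ∂/∂xʲ)` of a `2`-form. -/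
def formMatrix {n : ℕ} (w : Alt n 2) : Matrix (Fin (2 * n)) (Fin (2 * n)) ℝ :=
  Matrix.of fun i j => w ![basisVec i, basisVec j]

/-- The Lefschetz operator `L η = ω ∧ η = ½ ∑ ω_{ij} dxⁱ ∧ dxʲ ∧ η` at a point. -/
def ptL {n : ℕ} (w : Alt n 2) (k : ℕ) : Alt n k →ₗ[ℝ] Alt n (k + 2) :=
  (2⁻¹ : ℝ) • ∑ i, ∑ j, formMatrix w i j •
    (covWedge (k + 1) (basisCovec i) ∘ₗ covWedge k (basisCovec j))

/-- The dual Lefschetz operator `Λ η = ½ ∑ (ω⁻¹)^{ij} ι_{∂/∂xⁱ} ι_{∂/∂xʲ} η` at a point. -/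
def ptLam {n : ℕ} (w : Alt n 2) (k : ℕ) : Alt n (k + 2) →ₗ[ℝ] Alt n k :=
  (2⁻¹ : ℝ) • ∑ i, ∑ j, (formMatrix w)⁻¹ i j •
    (interior k (basisVec i) ∘ₗ interior (k + 1) (basisVec j))

/-- Primitive `k`-forms at a point: those with `Λ β = 0` (no condition in degrees `0` and `1`,
where `Λ` vanishes for degree reasons). -/
def ptPrim {n : ℕ} (w : Alt n 2) : (k : ℕ) → Submodule ℝ (Alt n k)
  | 0 => ⊤
  | 1 => ⊤
  | k + 2 => LinearMap.ker (ptLam w k)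

/-- The image of `L` in degree `k`, that is `ω ∧ Λᵏ⁻²`, with the convention `Λ⁻² = Λ⁻¹ = 0`. -/
def ptImL {n : ℕ} (w : Alt n 2) : (k : ℕ) → Submodule ℝ (Alt n k)
  | 0 => ⊥
  | 1 => ⊥
  | k + 2 => LinearMap.range (ptL w k)

open scoped Classical in
/-- The projection `Π` onto primitive forms given by the Lefschetz decomposition
`η = β_k + ω ∧ β_{k-2} + ω² ∧ β_{k-4} + ⋯ ↦ β_k`: the linear projection onto the primitive forms
along the image of `L`. For nondegenerate `ω` these two subspaces are always complementary
(the value `0` otherwise is a placeholder that never occurs). -/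
def ptProj {n : ℕ} (w : Alt n 2) (k : ℕ) : Alt n k →ₗ[ℝ] Alt n k :=
  if h : IsCompl (ptPrim w k) (ptImL w k) then
    (ptPrim w k).projection (ptImL w k) h
  else 0

/-! ### Differential forms on a manifold with boundary -/

section Manifold

variable {n : ℕ} [NeZero n] {M : Type*} [TopologicalSpace M]
  [ChartedSpace (EuclideanHalfSpace (2 * n)) M]

variable (n M) in
/-- Differential `k`-forms on a `2n`-manifold with boundary `M`, as yet without any regularity:
a choice of an alternating `k`-form on each tangent space. -/
abbrev Form (k : ℕ) : Type _ :=
  (x : M) → (TangentSpace (𝓡∂ (2 * n)) x) [⋀^Fin k]→L[ℝ] ℝ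

/-- `η ∈ Ωᵏ`: the form `η` is a smooth (up to the boundary) section of the bundle of alternating
`k`-forms on the tangent bundle. -/
def IsSmooth [IsManifold (𝓡∂ (2 * n)) ∞ M] {k : ℕ} (η : Form n M k) : Prop :=
  ContMDiff (𝓡∂ (2 * n)) ((𝓡∂ (2 * n)).prod 𝓘(ℝ, Alt n k)) ∞
    (fun x => Bundle.TotalSpace.mk' (Alt n k)
      (E := fun x : M => (TangentSpace (𝓡∂ (2 * n)) x) [⋀^Fin k]→L[ℝ] (Bundle.Trivial M ℝ x))
      x (η x))

/-- The coordinate representation of a form in the preferred chart at `x₀`: its pullback to `ℝ²ⁿ`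
under the inverse of the chart. -/
def inChart {k : ℕ} (x₀ : M) (η : Form n M k) (y : Model n) : Alt n k :=
  (η ((extChartAt (𝓡∂ (2 * n)) x₀).symm y)).compContinuousLinearMap
    (mfderivWithin 𝓘(ℝ, Model n) (𝓡∂ (2 * n)) (extChartAt (𝓡∂ (2 * n)) x₀).symm
      (Set.range (𝓡∂ (2 * n))) y)

/-- The exterior derivative `d`, computed at `x` in the preferred chart at `x`. -/
def extD {k : ℕ} (η : Form n M k) : Form n M (k + 1) := fun x =>
  (extDerivWithin (inChart x η) (Set.range (𝓡∂ (2 * n)))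
      (extChartAt (𝓡∂ (2 * n)) x x)).compContinuousLinearMap
    (mfderiv (𝓡∂ (2 * n)) 𝓘(ℝ, Model n) (extChartAt (𝓡∂ (2 * n)) x) x)

/-- `om` (written `ω` in the comments) is a symplectic form: a smooth, closed, nondegenerate `2`-form. -/
structure IsSymplectic [IsManifold (𝓡∂ (2 * n)) ∞ M] (om : Form n M 2) : Prop where
  smooth : IsSmooth om
  closed : extD om = 0
  nondegenerate : ∀ (x : M) (v : TangentSpace (𝓡∂ (2 * n)) x),
    (∀ u : TangentSpace (𝓡∂ (2 * n)) x, om x ![v, u] = 0) → v = 0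

/-- Apply a family of linear maps between alternating forms pointwise. -/
def pointwise {k l : ℕ} (T : M → Alt n k →ₗ[ℝ] Alt n l) : Form n M k →ₗ[ℝ] Form n M l :=
  LinearMap.pi fun x => (T x) ∘ₗ LinearMap.proj (φ := fun _ : M => Alt n k) x

/-- The Lefschetz operator `L η = ω ∧ η`. -/
def lef (om : Form n M 2) (k : ℕ) : Form n M k →ₗ[ℝ] Form n M (k + 2) :=
  pointwise fun x => ptL (om x) k

/-- `Lʳ η = ωʳ ∧ η`. -/
def lefPow (om : Form n M 2) (k : ℕ) : (r : ℕ) → Form n M k →ₗ[ℝ] Form n M (k + 2 * r)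
  | 0 => LinearMap.id
  | r + 1 => lef om (k + 2 * r) ∘ₗ lefPow om k r

/-- The dual Lefschetz operator `Λ`. -/
def dualLef (om : Form n M 2) (k : ℕ) : Form n M (k + 2) →ₗ[ℝ] Form n M k :=
  pointwise fun x => ptLam (om x) k

/-- The projection `Π` of forms onto primitive forms. -/
def primProj (om : Form n M 2) (k : ℕ) : Form n M k →ₗ[ℝ] Form n M k :=
  pointwise fun x => ptProj (om x) k

/-- On primitive forms, `∂₊ = Π d`. -/
def dPlus (om : Form n M 2) {k : ℕ} (β : Form n M k) : Form n M (k + 1) :=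
  primProj om (k + 1) (extD β)

/-- On primitive forms, `∂₋ = H⁻¹ Λ d`, where `H` is multiplication by `n - k` on `k`-forms.
On `0`-forms `∂₋` is zero, and it is not represented. -/
def dMinus (om : Form n M 2) {k : ℕ} (β : Form n M (k + 1)) : Form n M k :=
  ((n : ℝ) - (k : ℝ))⁻¹ • dualLef om k (extD β)

/-! ### Boundary conditions -/

/-- `ρ` is a local boundary defining function near `x`: it is smooth on a neighbourhood of `x`,
and there it vanishes on the boundary, is positive in the interior, and has nonzero differential
along the boundary. -/
def IsBoundaryDefiningAt (ρ : M → ℝ) (x : M) : Prop :=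
  ∃ U ∈ 𝓝 x, ContMDiffOn (𝓡∂ (2 * n)) 𝓘(ℝ, ℝ) ∞ ρ U ∧
    (∀ y ∈ U, y ∈ (𝓡∂ (2 * n)).interior M → 0 < ρ y) ∧
    ∀ y ∈ U, y ∈ (𝓡∂ (2 * n)).boundary M →
      ρ y = 0 ∧ mfderiv (𝓡∂ (2 * n)) 𝓘(ℝ, ℝ) ρ y ≠ 0

/-- The principal symbol `σ_P(dρ) η` at `x` of a differential operator `P` of order `m`, that is
`(1 / m!) P((ρ - ρ(x))ᵐ η)` evaluated at `x`. -/
def symbol (m : ℕ) {k l : ℕ} (P : Form n M k → Form n M l) (ρ : M → ℝ) (η : Form n M k) (x : M) :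
    (TangentSpace (𝓡∂ (2 * n)) x) [⋀^Fin l]→L[ℝ] ℝ :=
  ((m.factorial : ℝ)⁻¹) • P (fun y => (ρ y - ρ x) ^ m • η y) x

/-- The Dirichlet-type boundary condition `σ_P(dρ) η |_{∂M} = 0` of an operator `P` of order `m`,
for every local boundary defining function `ρ`. -/
def SymbolVanishes (m : ℕ) {k l : ℕ} (P : Form n M k → Form n M l) (η : Form n M k) : Prop :=
  ∀ x ∈ (𝓡∂ (2 * n)).boundary M, ∀ ρ : M → ℝ, IsBoundaryDefiningAt (n := n) ρ x →
    symbol m P ρ η x = 0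

/-- The boundary condition `D`: `σ_d(dρ) η |_{∂M} = 0`. -/
def BdryD {k : ℕ} (η : Form n M k) : Prop := SymbolVanishes 1 extD η

/-- The boundary condition `D₊`: `σ_{∂₊}(dρ) β |_{∂M} = 0`, for primitive `β`. -/
def BdryDPlus (om : Form n M 2) {k : ℕ} (β : Form n M k) : Prop := SymbolVanishes 1 (dPlus om) β

/-- The boundary condition `D₋`: `σ_{∂₋}(dρ) β |_{∂M} = 0`, for primitive `β`
(no condition on functions, since `∂₋ = 0` there). -/
def BdryDMinus (om : Form n M 2) : {k : ℕ} → Form n M k → Prop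
  | 0, _ => True
  | _ + 1, β => SymbolVanishes 1 (dMinus om) β

/-- The boundary condition `D₊₋`: `σ_{∂₊∂₋}(dρ) β |_{∂M} = 0`, for primitive `β`; the operator
`∂₊∂₋` has order two (no condition on functions, since `∂₋ = 0` there). -/
def BdryDPlusMinus (om : Form n M 2) : {k : ℕ} → Form n M k → Prop
  | 0, _ => True
  | _ + 1, β => SymbolVanishes 2 (fun ξ => dPlus om (dMinus om ξ)) β

/-! ### Spaces of smooth forms with boundary conditions -/

variable [IsManifold (𝓡∂ (2 * n)) ∞ M]

variable (n M) in
/-- `Ωᵏ_D`: smooth `k`-forms satisfying the boundary condition `D`. -/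
def OmegaD (k : ℕ) : Set (Form n M k) := {η | IsSmooth η ∧ BdryD η}

/-- `Pᵏ`: smooth primitive `k`-forms. -/
def Prim (om : Form n M 2) (k : ℕ) : Set (Form n M k) :=
  {β | IsSmooth β ∧ ∀ x, β x ∈ ptPrim (om x) k}

/-- `Pᵏ_{D₊}`. -/
def PrimDPlus (om : Form n M 2) (k : ℕ) : Set (Form n M k) := {β | β ∈ Prim om k ∧ BdryDPlus om β}

/-- `Pᵏ_{D₋}`. -/
def PrimDMinus (om : Form n M 2) (k : ℕ) : Set (Form n M k) := {β | β ∈ Prim om k ∧ BdryDMinus om β}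

/-- `Pᵏ_{D₊₋}`. -/
def PrimDPlusMinus (om : Form n M 2) (k : ℕ) : Set (Form n M k) :=
  {β | β ∈ Prim om k ∧ BdryDPlusMinus om β}

end Manifold

/-! ### Forms of degree `k - 2`, with the convention `Ω⁻² = Ω⁻¹ = 0` -/

section LowDegree

universe u

variable (n : ℕ) [NeZero n] (M : Type u) [TopologicalSpace M]
  [ChartedSpace (EuclideanHalfSpace (2 * n)) M]

/-- Forms of degree `k - 2`; the zero space when `k < 2`. -/
def FormSubTwo : ℕ → Type u
  | 0 => PUnit
  | 1 => PUnit
  | k + 2 => Form n M k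

instance : (k : ℕ) → AddCommGroup (FormSubTwo n M k)
  | 0 => inferInstanceAs (AddCommGroup PUnit.{u + 1})
  | 1 => inferInstanceAs (AddCommGroup PUnit.{u + 1})
  | k + 2 => inferInstanceAs (AddCommGroup (Form n M k))

instance : (k : ℕ) → Module ℝ (FormSubTwo n M k)
  | 0 => (inferInstance : Module ℝ PUnit.{u + 1})
  | 1 => (inferInstance : Module ℝ PUnit.{u + 1})
  | k + 2 => (inferInstance : Module ℝ (Form n M k))

/-- `Ωᵏ⁻²_D`. -/
def OmegaDSubTwo [IsManifold (𝓡∂ (2 * n)) ∞ M] : (k : ℕ) → Set (FormSubTwo n M k)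
  | 0 => Set.univ
  | 1 => Set.univ
  | k + 2 => OmegaD n M k

variable {n M} in
/-- `L : Ωᵏ⁻² → Ωᵏ`. -/
def lefSubTwo (om : Form n M 2) : (k : ℕ) → FormSubTwo n M k →ₗ[ℝ] Form n M k
  | 0 => 0
  | 1 => 0
  | k + 2 => lef om k

end LowDegree

/-- For subsets `A`, `B`, `C` of real vector spaces and linear maps `f`, `g` between these spaces:
`A`, `B`, `C` are linear subspaces, `f` and `g` restrict to maps `A → B → C`, and
`0 → A → B → C → 0` is a short exact sequence. -/
def IsShortExact {V₁ V₂ V₃ : Type*} [AddCommGroup V₁] [Module ℝ V₁] [AddCommGroup V₂] [Module ℝ V₂]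
    [AddCommGroup V₃] [Module ℝ V₃] (A : Set V₁) (f : V₁ →ₗ[ℝ] V₂) (B : Set V₂) (g : V₂ →ₗ[ℝ] V₃)
    (C : Set V₃) : Prop :=
  ∃ (A' : Submodule ℝ V₁) (B' : Submodule ℝ V₂) (C' : Submodule ℝ V₃),
    (A' : Set V₁) = A ∧ (B' : Set V₂) = B ∧ (C' : Set V₃) = C ∧
    ∃ (hf : ∀ a ∈ A', f a ∈ B') (hg : ∀ b ∈ B', g b ∈ C'),
      Function.Injective (f.restrict hf) ∧
      Function.Exact (f.restrict hf) (g.restrict hg) ∧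
      Function.Surjective (g.restrict hg)

end SymplecticBoundary

end

/-!
The symbol of `d` in the direction of `dρ` is exterior multiplication by `dρ`, and at a boundary
point `dρ` is a nonzero multiple of `dx⁰` in a boundary chart. So all boundary conditions are
pointwise linear conditions along `∂M`: with `α = dx⁰`, the condition `D` is `α ∧ η = 0`, the
condition `D₊` is `Π(α ∧ β) = 0`, and `D₋` is `Λ(α ∧ β) = 0`. For the second order operator `∂₊∂₋`,
the Leibniz rule gives the product of the symbols, `Π(α ∧ Λ(α ∧ β)) = 0` (`bdryD_iff`,
`bdryDPlus_iff`, `bdryDMinus_iff`, `bdryDPlusMinus_iff`).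

The algebra is Lefschetz theory, deduced from `[Λ, L] = n - k` (`lamAll_mul_lefAll`) by inductions
on the degree that use no finiteness. It is carried out for abstract graded vector spaces
(`IsLefschetzPair`), and applies both to the forms at a point and to the smooth forms on an open
set. In particular `L` is injective below the middle degree, `LΛ` is bijective above it, forms of
degree at most `n` split as primitive forms plus the image of `L`, and the kernel of `L` in degree
`n + r` is `Lʳ` of the primitive forms of degree `n - r`, all within smooth forms. As `α ∧` commutes
with `L`, this gives the maps of the sequences and their exactness on the left and in the middle.

What remains is surjectivity of `Π` and of `L`. Both amount to finding a smooth form subject to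
affine conditions at each point, so a partition of unity reduces them to chart domains
(`exists_isSmooth_of_local`), where there are a covector field `α` extending the conormal direction
and a vector field `u` with `α(u) = 1`.

* For primitive `β`, put `μ = (n - k + 1)⁻¹ Λ(α ∧ β)`. Then `α ∧ β - Lμ` is primitive, and `D₊`
  (or `D₊₋` in the middle degree) says exactly that `α ∧ β = Lμ` and `α ∧ μ = 0`. Hence
  `β - L ι_u μ` satisfies `α ∧ (β - L ι_u μ) = Lμ - Lμ = 0`, and it is mapped to `β` by `Π`
  (`exists_covWedge_add_lef_eq_zero`).
* For `θ` of degree at least `n + 2`, write `θ = α ∧ ι_u θ + ι_u(α ∧ θ)`, and let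
  `R = Λ(LΛ)⁻¹` be the pointwise right inverse of `L`. Then `η = α ∧ R ι_u θ + R ι_u(α ∧ θ)`
  satisfies `Lη = θ`. If `θ` satisfies `D`, the second summand vanishes on the boundary, so that
  `α ∧ η = 0` there (`exists_isSmooth_lef_eq`).
-/

noncomputable section

namespace SymplecticBoundary

/-! ### Creation and annihilation operators -/

section PointAlgebra

variable {n : ℕ}

theorem covWedge_apply {k : ℕ} (α : Model n →L[ℝ] ℝ) (η : Alt n k) (v : Fin (k + 1) → Model n) :
    covWedge k α η v = ∑ i : Fin (k + 1), (-1 : ℝ) ^ (i : ℕ) * (α (v i) * η (i.removeNth v)) := by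
  change ContinuousAlternatingMap.alternatizeUncurryFin (α.smulRight η) v = _
  simp [ContinuousAlternatingMap.alternatizeUncurryFin_apply]

theorem interior_apply {k : ℕ} (u : Model n) (η : Alt n (k + 1)) (v : Fin k → Model n) :
    interior k u η v = η (Matrix.vecCons u v) := rfl

theorem covWedge_add_left {k : ℕ} (α β : Model n →L[ℝ] ℝ) (η : Alt n k) :
    covWedge k (α + β) η = covWedge k α η + covWedge k β η := by
  ext v; simp [covWedge_apply, ← Finset.sum_add_distrib]; congr; ext; ring

theorem covWedge_smul_left {k : ℕ} (c : ℝ) (α : Model n →L[ℝ] ℝ) (η : Alt n k) :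
    covWedge k (c • α) η = c • covWedge k α η := by
  ext v; simp [covWedge_apply, Finset.mul_sum]; congr; ext; ring

theorem interior_covWedge_zero (u : Model n) (α : Model n →L[ℝ] ℝ) (η : Alt n 0) :
    interior 0 u (covWedge 0 α η) = α u • η := by
  ext v
  simp [interior_apply, covWedge_apply]

theorem interior_covWedge {k : ℕ} (u : Model n) (α : Model n →L[ℝ] ℝ) (η : Alt n (k + 1)) :
    interior (k + 1) u (covWedge (k + 1) α η) = α u • η - covWedge k α (interior k u η) := by
  ext v
  simp only [interior_apply, covWedge_apply, ContinuousAlternatingMap.sub_apply,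
    ContinuousAlternatingMap.smul_apply, smul_eq_mul]
  rw [Fin.sum_univ_succ, sub_eq_add_neg, ← Finset.sum_neg_distrib]
  congr 1
  · simp [Matrix.vecCons]
  · refine Finset.sum_congr rfl fun i _ => ?_
    have : Fin.removeNth i.succ (Matrix.vecCons u v) = Matrix.vecCons u (Fin.removeNth i v) := by
      ext j : 1
      refine Fin.cases ?_ (fun j => ?_) j <;> simp [Fin.removeNth]
    rw [this]
    simp [pow_succ]

theorem interior_interior {k : ℕ} (u v : Model n) (η : Alt n (k + 2)) :
    interior k u (interior (k + 1) v η) = -interior k v (interior (k + 1) u η) := by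
  ext x
  simp only [interior_apply, ContinuousAlternatingMap.neg_apply]
  have h := η.toAlternatingMap.map_swap (Matrix.vecCons v (Matrix.vecCons u x))
    (i := 0) (j := 1) (by simp)
  have h2 : Matrix.vecCons v (Matrix.vecCons u x) ∘ Equiv.swap 0 1 =
      Matrix.vecCons u (Matrix.vecCons v x) := by
    ext j : 1
    refine Fin.cases ?_ (fun j => Fin.cases ?_ (fun j => ?_) j) j
    · simp
    · simp
    · simp only [Function.comp_apply]
      rw [Equiv.swap_apply_of_ne_of_ne]
      · simp
      · simp
      · simp [Fin.ext_iff]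
  rw [h2] at h
  rw [← neg_eq_iff_eq_neg]
  exact h.symm

theorem covWedge_covWedge_self {k : ℕ} (α : Model n →L[ℝ] ℝ) (η : Alt n k) :
    covWedge (k + 1) α (covWedge k α η) = 0 := by
  have h := ContinuousAlternatingMap.alternatizeUncurryFin_alternatizeUncurryFinCLM_comp_of_symmetric
    (f := α.smulRight (α.smulRight η)) (by intro x y; simp [smul_smul, mul_comm])
  rw [← h]
  change ContinuousAlternatingMap.alternatizeUncurryFin _ = _
  congr 1
  ext1 v
  simp only [ContinuousLinearMap.smulRight_apply, ContinuousLinearMap.comp_apply, map_smul]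
  rfl

theorem covWedge_covWedge {k : ℕ} (α β : Model n →L[ℝ] ℝ) (η : Alt n k) :
    covWedge (k + 1) α (covWedge k β η) = -covWedge (k + 1) β (covWedge k α η) := by
  have h := covWedge_covWedge_self (α + β) η
  simp only [covWedge_add_left, map_add, covWedge_covWedge_self, zero_add, add_zero] at h
  rw [eq_neg_iff_add_eq_zero]
  exact (add_comm _ _).trans h

theorem sum_basisCovec_smul (v : Model n) : ∑ i, basisCovec i v • (basisVec i : Model n) = v := by
  ext j
  simp [basisCovec, basisVec, Pi.single_apply]

theorem basisCovec_basisVec (i j : Fin (2 * n)) :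
    basisCovec i (basisVec j : Model n) = if i = j then 1 else 0 := by
  simp [basisCovec, basisVec, PiLp.single_apply]

theorem interior_sum_left {k : ℕ} {ι : Type*} (s : Finset ι) (f : ι → Model n)
    (η : Alt n (k + 1)) : interior k (∑ i ∈ s, f i) η = ∑ i ∈ s, interior k (f i) η := by
  change η.curryLeft _ = _
  rw [map_sum]; rfl

theorem interior_smul_left {k : ℕ} (c : ℝ) (u : Model n)
    (η : Alt n (k + 1)) : interior k (c • u) η = c • interior k u η := by
  change η.curryLeft _ = _
  rw [map_smul]; rfl

/-- Euler's formula: `∑ dxⁱ ∧ ι_{∂ᵢ} η = (deg η) η`. -/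
theorem sum_covWedge_interior {k : ℕ} (η : Alt n (k + 1)) :
    ∑ i, covWedge k (basisCovec i) (interior k (basisVec i) η) = ((k : ℝ) + 1) • η := by
  have h := ContinuousAlternatingMap.alternatizeUncurryFin_curryLeft η
  have h2 : (((k : ℝ) + 1) • η) = (k + 1) • η := by
    rw [← Nat.cast_smul_eq_nsmul ℝ]; push_cast; rfl
  rw [h2, ← h]
  change ∑ i, ContinuousAlternatingMap.alternatizeUncurryFinCLM ℝ _ _ _ =
    ContinuousAlternatingMap.alternatizeUncurryFinCLM ℝ _ _ _
  rw [← map_sum]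
  congr 1
  ext1 v
  conv_rhs => rw [← sum_basisCovec_smul v, map_sum]
  simp only [sum_apply, map_smul]
  rfl

/-! ### The `sl₂` relations on the full exterior algebra -/

variable (n) in
/-- Families of alternating forms, one in each degree. The operators below act on all degrees at
once, so that their composites can be manipulated in the ring `Module.End ℝ (AltFamily n)`. -/
def AltFamily : Type := (k : ℕ) → Alt n k

instance : AddCommGroup (AltFamily n) := inferInstanceAs (AddCommGroup ((k : ℕ) → Alt n k))

instance : Module ℝ (AltFamily n) := inferInstanceAs (Module ℝ ((k : ℕ) → Alt n k))

namespace AltFamily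

theorem ext {η ξ : AltFamily n} (h : ∀ k, η k = ξ k) : η = ξ := funext h

@[simp] theorem zero_apply (k : ℕ) : (0 : AltFamily n) k = 0 := rfl

@[simp] theorem add_apply (η ξ : AltFamily n) (k : ℕ) : (η + ξ) k = η k + ξ k := rfl

@[simp] theorem sub_apply (η ξ : AltFamily n) (k : ℕ) : (η - ξ) k = η k - ξ k := rfl

@[simp] theorem neg_apply (η : AltFamily n) (k : ℕ) : (-η) k = -η k := rfl

@[simp] theorem smul_apply (c : ℝ) (η : AltFamily n) (k : ℕ) : (c • η) k = c • η k := rfl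

@[simp] theorem sum_apply {ι : Type*} (s : Finset ι) (f : ι → AltFamily n) (k : ℕ) :
    (∑ i ∈ s, f i) k = ∑ i ∈ s, f i k :=
  Finset.sum_apply (M := fun k => Alt n k) k s f

end AltFamily

/-- Exterior multiplication by a covector, on all degrees at once. -/
def wedgeAll (α : Model n →L[ℝ] ℝ) : Module.End ℝ (AltFamily n) where
  toFun η
    | 0 => 0
    | k + 1 => covWedge k α (η k)
  map_add' η ξ := AltFamily.ext fun k => by
    cases k with
    | zero => exact (add_zero (0 : Alt n 0)).symm
    | succ k => exact map_add (covWedge k α) (η k) (ξ k)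
  map_smul' c η := AltFamily.ext fun k => by
    cases k with
    | zero => exact (smul_zero (A := Alt n 0) c).symm
    | succ k => exact map_smul (covWedge k α) c (η k)

@[simp] theorem wedgeAll_apply_zero (α : Model n →L[ℝ] ℝ) (η : AltFamily n) :
    wedgeAll α η 0 = 0 := rfl

@[simp] theorem wedgeAll_apply_succ (α : Model n →L[ℝ] ℝ) (η : AltFamily n) (k : ℕ) :
    wedgeAll α η (k + 1) = covWedge k α (η k) := rfl

/-- Contraction with a vector, on all degrees at once. -/
def interiorAll (u : Model n) : Module.End ℝ (AltFamily n) where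
  toFun η k := interior k u (η (k + 1))
  map_add' _ _ := AltFamily.ext fun k => map_add (interior k u) _ _
  map_smul' _ _ := AltFamily.ext fun k => map_smul (interior k u) _ _

@[simp] theorem interiorAll_apply (u : Model n) (η : AltFamily n) (k : ℕ) :
    interiorAll u η k = interior k u (η (k + 1)) := rfl

variable (n) in
/-- The operator multiplying `k`-forms by `k`. -/
def degreeAll : Module.End ℝ (AltFamily n) where
  toFun η k := (k : ℝ) • η k
  map_add' _ _ := AltFamily.ext fun _ => smul_add _ _ _
  map_smul' c η := AltFamily.ext fun k => smul_comm (k : ℝ) c (η k)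

@[simp] theorem degreeAll_apply (η : AltFamily n) (k : ℕ) :
    degreeAll n η k = (k : ℝ) • η k := rfl

theorem wedgeAll_mul_wedgeAll (α β : Model n →L[ℝ] ℝ) :
    wedgeAll α * wedgeAll β = -(wedgeAll β * wedgeAll α) := by
  ext1 η
  refine AltFamily.ext fun k => ?_
  match k with
  | 0 => simp
  | 1 => simp
  | k + 2 => exact covWedge_covWedge α β (η k)

theorem interiorAll_mul_interiorAll (u v : Model n) :
    interiorAll u * interiorAll v = -(interiorAll v * interiorAll u) := by
  ext1 η
  refine AltFamily.ext fun k => ?_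
  exact interior_interior u v (η (k + 2))

theorem interiorAll_mul_wedgeAll (u : Model n) (α : Model n →L[ℝ] ℝ) :
    interiorAll u * wedgeAll α = α u • 1 - wedgeAll α * interiorAll u := by
  ext1 η
  refine AltFamily.ext fun k => ?_
  match k with
  | 0 =>
    change interior 0 u (covWedge 0 α (η 0)) = α u • η 0 - 0
    rw [interior_covWedge_zero, sub_zero]
  | k + 1 => exact interior_covWedge u α (η (k + 1))

theorem sum_wedgeAll_mul_interiorAll :
    ∑ i, wedgeAll (basisCovec i) * interiorAll (basisVec i) = degreeAll n := by
  ext1 η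
  refine AltFamily.ext fun k => ?_
  rw [LinearMap.sum_apply, AltFamily.sum_apply]
  match k with
  | 0 => simp
  | k + 1 =>
    have := sum_covWedge_interior (η (k + 1))
    simpa using! this

/-- The Lefschetz operator on all degrees at once. -/
def lefAll (w : Alt n 2) : Module.End ℝ (AltFamily n) :=
  (2⁻¹ : ℝ) • ∑ i, ∑ j, formMatrix w i j • (wedgeAll (basisCovec i) * wedgeAll (basisCovec j))

/-- The dual Lefschetz operator on all degrees at once. -/
def lamAll (w : Alt n 2) : Module.End ℝ (AltFamily n) :=
  (2⁻¹ : ℝ) • ∑ i, ∑ j, (formMatrix w)⁻¹ i j •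
    (interiorAll (basisVec i) * interiorAll (basisVec j))

theorem lefAll_apply_zero (w : Alt n 2) (η : AltFamily n) : lefAll w η 0 = 0 := by
  simp [lefAll, LinearMap.sum_apply]

theorem lefAll_apply_one (w : Alt n 2) (η : AltFamily n) : lefAll w η 1 = 0 := by
  simp [lefAll, LinearMap.sum_apply]

theorem lefAll_apply_add_two (w : Alt n 2) (η : AltFamily n) (k : ℕ) :
    lefAll w η (k + 2) = ptL w k (η k) := by
  simp [lefAll, ptL, LinearMap.sum_apply]

theorem lamAll_apply (w : Alt n 2) (η : AltFamily n) (k : ℕ) :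
    lamAll w η k = ptLam w k (η (k + 2)) := by
  simp [lamAll, ptLam, LinearMap.sum_apply]

theorem formMatrix_swap (w : Alt n 2) (i j : Fin (2 * n)) :
    formMatrix w j i = -formMatrix w i j := by
  have h := w.toAlternatingMap.map_swap ![basisVec i, basisVec j] (i := 0) (j := 1) (by simp)
  have h2 : ![(basisVec i : Model n), basisVec j] ∘ Equiv.swap 0 1 = ![basisVec j, basisVec i] := by
    ext j : 1
    fin_cases j <;> simp
  rw [h2] at h
  exact h

theorem formMatrix_transpose (w : Alt n 2) : (formMatrix w).transpose = -formMatrix w := by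
  ext i j; exact formMatrix_swap w i j

theorem inv_formMatrix_swap (w : Alt n 2) (hw : IsUnit (formMatrix w).det) (i j : Fin (2 * n)) :
    (formMatrix w)⁻¹ j i = -(formMatrix w)⁻¹ i j := by
  have h : ((formMatrix w)⁻¹).transpose = -(formMatrix w)⁻¹ := by
    rw [Matrix.transpose_nonsing_inv, formMatrix_transpose]
    apply Matrix.inv_eq_right_inv
    rw [neg_mul_neg, Matrix.mul_nonsing_inv _ hw]
  exact congrFun (congrFun h i) j

/-- Contraction with the vector dual to `dxᵏ` with respect to the symplectic form. -/
def dualInteriorAll (w : Alt n 2) (k : Fin (2 * n)) : Module.End ℝ (AltFamily n) :=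
  ∑ i, (formMatrix w)⁻¹ i k • interiorAll (basisVec i)

/-- The commutator of `Λ` with exterior multiplication by `dxᵏ` is a contraction. -/
theorem lamAll_mul_wedgeAll (w : Alt n 2) (hw : IsUnit (formMatrix w).det) (k : Fin (2 * n)) :
    lamAll w * wedgeAll (basisCovec k) =
      wedgeAll (basisCovec k) * lamAll w + dualInteriorAll w k := by
  have key : ∀ i j : Fin (2 * n),
      interiorAll (basisVec i) * interiorAll (basisVec j) * wedgeAll (basisCovec k) =
        wedgeAll (basisCovec k) * (interiorAll (basisVec i) * interiorAll (basisVec j)) +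
        ((if k = j then (1 : ℝ) else 0) • interiorAll (basisVec i) -
          (if k = i then (1 : ℝ) else 0) • interiorAll (basisVec j) :
            Module.End ℝ (AltFamily n)) := by
    intro i j
    rw [mul_assoc, interiorAll_mul_wedgeAll, mul_sub, ← mul_assoc, interiorAll_mul_wedgeAll,
      basisCovec_basisVec, basisCovec_basisVec, mul_smul_comm, mul_one, sub_mul, smul_mul_assoc,
      one_mul, mul_assoc]
    abel
  simp only [lamAll, smul_mul_assoc, Finset.sum_mul, mul_smul_comm, Finset.mul_sum]
  simp only [key, smul_add, Finset.sum_add_distrib, smul_sub, Finset.sum_sub_distrib]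
  congr 1
  have h1 : ∑ i, ∑ j, (formMatrix w)⁻¹ i j •
      ((if k = j then (1 : ℝ) else 0) • interiorAll (basisVec i)) = dualInteriorAll w k := by
    simp [dualInteriorAll]
  have h2 : ∑ i, ∑ j, (formMatrix w)⁻¹ i j •
      ((if k = i then (1 : ℝ) else 0) • interiorAll (basisVec j)) = -dualInteriorAll w k := by
    rw [Finset.sum_comm]
    simp only [dualInteriorAll, ← Finset.sum_neg_distrib]
    refine Finset.sum_congr rfl fun j _ => ?_
    simp [inv_formMatrix_swap w hw j k]
  rw [h1, h2, smul_neg, sub_neg_eq_add, ← add_smul]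
  norm_num

theorem sum_smul_dualInteriorAll (w : Alt n 2) (hw : IsUnit (formMatrix w).det)
    (l : Fin (2 * n)) :
    ∑ k, formMatrix w k l • dualInteriorAll w k = interiorAll (basisVec l) := by
  simp only [dualInteriorAll, Finset.smul_sum, smul_smul]
  rw [Finset.sum_comm]
  simp only [← Finset.sum_smul]
  have : ∀ i, ∑ k, formMatrix w k l * (formMatrix w)⁻¹ i k = (1 : Matrix _ _ ℝ) i l := by
    intro i
    rw [← Matrix.nonsing_inv_mul _ hw, Matrix.mul_apply]
    exact Finset.sum_congr rfl fun k _ => mul_comm _ _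
  simp [this, Matrix.one_apply]

/-- The fundamental commutation relation `[Λ, L] = n - k` on `k`-forms. -/
theorem lamAll_mul_lefAll (w : Alt n 2) (hw : IsUnit (formMatrix w).det) :
    lamAll w * lefAll w = lefAll w * lamAll w + ((n : ℝ) • 1 - degreeAll n) := by
  have key : ∀ k l : Fin (2 * n),
      lamAll w * (wedgeAll (basisCovec k) * wedgeAll (basisCovec l)) =
        wedgeAll (basisCovec k) * wedgeAll (basisCovec l) * lamAll w +
        (dualInteriorAll w k * wedgeAll (basisCovec l) +
          wedgeAll (basisCovec k) * dualInteriorAll w l) := by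
    intro k l
    rw [← mul_assoc, lamAll_mul_wedgeAll w hw, add_mul, mul_assoc, lamAll_mul_wedgeAll w hw,
      mul_add, mul_assoc]
    abel
  have e1 : lamAll w * lefAll w = (2⁻¹ : ℝ) • ∑ i, ∑ j, formMatrix w i j •
      (lamAll w * (wedgeAll (basisCovec i) * wedgeAll (basisCovec j))) := by
    simp only [lefAll, mul_smul_comm, Finset.mul_sum]
  have e2 : lefAll w * lamAll w = (2⁻¹ : ℝ) • ∑ i, ∑ j, formMatrix w i j •
      (wedgeAll (basisCovec i) * wedgeAll (basisCovec j) * lamAll w) := by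
    simp only [lefAll, smul_mul_assoc, Finset.sum_mul]
  rw [e1, e2]
  simp only [key, smul_add, Finset.sum_add_distrib]
  congr 1
  have h1 : ∑ i, ∑ j, formMatrix w i j • (dualInteriorAll w i * wedgeAll (basisCovec j)) =
      ((2 * n : ℕ) : ℝ) • 1 - degreeAll n := by
    rw [Finset.sum_comm]
    simp only [← smul_mul_assoc, ← Finset.sum_mul, sum_smul_dualInteriorAll w hw,
      interiorAll_mul_wedgeAll, Finset.sum_sub_distrib, sum_wedgeAll_mul_interiorAll,
      basisCovec_basisVec]
    congr 1
    rw [Finset.sum_congr rfl fun i _ => (by simp : _ = (1 : Module.End ℝ (AltFamily n))),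
      Finset.sum_const, Finset.card_univ, Fintype.card_fin, Nat.cast_smul_eq_nsmul]
  have h2 : ∑ i, ∑ j, formMatrix w i j • (wedgeAll (basisCovec i) * dualInteriorAll w j) =
      -degreeAll n := by
    rw [← sum_wedgeAll_mul_interiorAll, ← Finset.sum_neg_distrib]
    refine Finset.sum_congr rfl fun i _ => ?_
    rw [← sum_smul_dualInteriorAll w hw i, Finset.mul_sum, ← Finset.sum_neg_distrib]
    refine Finset.sum_congr rfl fun j _ => ?_
    rw [formMatrix_swap w j i, neg_smul, mul_smul_comm]
  rw [h1, h2, ← smul_add]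
  have : ((2 * n : ℕ) : ℝ) • (1 : Module.End ℝ (AltFamily n)) - degreeAll n + -degreeAll n =
      (2 : ℝ) • ((n : ℝ) • 1 - degreeAll n) := by
    rw [smul_sub, smul_smul, two_smul ℝ (degreeAll n)]
    push_cast
    abel
  rw [this, smul_smul]
  norm_num

theorem wedgeAll_mul_lefAll (w : Alt n 2) (α : Model n →L[ℝ] ℝ) :
    wedgeAll α * lefAll w = lefAll w * wedgeAll α := by
  simp only [lefAll, mul_smul_comm, smul_mul_assoc, Finset.mul_sum, Finset.sum_mul]
  congr 1
  refine Finset.sum_congr rfl fun i _ => Finset.sum_congr rfl fun j _ => ?_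
  congr 1
  rw [← mul_assoc, wedgeAll_mul_wedgeAll α, neg_mul, mul_assoc, wedgeAll_mul_wedgeAll α, mul_neg,
    neg_neg, mul_assoc]

theorem lamAll_mul_dualInteriorAll (w : Alt n 2) (k : Fin (2 * n)) :
    lamAll w * dualInteriorAll w k = dualInteriorAll w k * lamAll w := by
  have key : ∀ u : Model n, lamAll w * interiorAll u = interiorAll u * lamAll w := by
    intro u
    symm
    simp only [lamAll, mul_smul_comm, smul_mul_assoc, Finset.mul_sum, Finset.sum_mul]
    congr 1
    refine Finset.sum_congr rfl fun i _ => Finset.sum_congr rfl fun j _ => ?_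
    congr 1
    rw [← mul_assoc, interiorAll_mul_interiorAll u, neg_mul, mul_assoc (interiorAll (basisVec i)),
      interiorAll_mul_interiorAll u, mul_neg, neg_neg, mul_assoc]
  simp only [dualInteriorAll, Finset.mul_sum, Finset.sum_mul, mul_smul_comm, smul_mul_assoc, key]

end PointAlgebra

/-! ### Naturality under linear isomorphisms -/

section Naturality

variable {n : ℕ}

/-- The pullback `A^* η` of a form under a linear map, as a linear map of `η`. -/
def pull (A : Model n →L[ℝ] Model n) (k : ℕ) : Alt n k →ₗ[ℝ] Alt n k where
  toFun η := η.compContinuousLinearMap A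
  map_add' _ _ := rfl
  map_smul' _ _ := rfl

theorem pull_apply (A : Model n →L[ℝ] Model n) {k : ℕ} (η : Alt n k) (v : Fin k → Model n) :
    pull A k η v = η (A ∘ v) := rfl

theorem pull_id {k : ℕ} (η : Alt n k) : pull (ContinuousLinearMap.id ℝ (Model n)) k η = η := rfl

theorem pull_covWedge (A : Model n →L[ℝ] Model n) {k : ℕ} (α : Model n →L[ℝ] ℝ) (η : Alt n k) :
    pull A (k + 1) (covWedge k α η) = covWedge k (α.comp A) (pull A k η) := by
  ext v
  rw [pull_apply, covWedge_apply, covWedge_apply]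
  rfl

theorem interior_pull (A : Model n →L[ℝ] Model n) {k : ℕ} (u : Model n) (η : Alt n (k + 1)) :
    interior k u (pull A (k + 1) η) = pull A k (interior k (A u) η) := by
  ext v
  rw [interior_apply, pull_apply, pull_apply, interior_apply]
  congr 1
  ext j : 1
  refine Fin.cases ?_ (fun j => ?_) j <;> simp

theorem covWedge_sum_left {k : ℕ} {ι : Type*} (s : Finset ι) (f : ι → Model n →L[ℝ] ℝ)
    (η : Alt n k) : covWedge k (∑ i ∈ s, f i) η = ∑ i ∈ s, covWedge k (f i) η := by
  classical
  induction s using Finset.induction_on with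
  | empty =>
    rw [Finset.sum_empty, Finset.sum_empty]
    ext v; simp [covWedge_apply]
  | insert a s ha ih => rw [Finset.sum_insert ha, Finset.sum_insert ha, covWedge_add_left, ih]

theorem formMatrix_eq_interior (w : Alt n 2) (i j : Fin (2 * n)) :
    formMatrix w i j = interior 0 (basisVec j) (interior 1 (basisVec i) w) ![] := rfl

/-- The matrix of a linear endomorphism of the model space. -/
def modelMatrix (A : Model n →L[ℝ] Model n) : Matrix (Fin (2 * n)) (Fin (2 * n)) ℝ :=
  Matrix.of fun i k => basisCovec i (A (basisVec k))

theorem map_basisVec (A : Model n →L[ℝ] Model n) (k : Fin (2 * n)) :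
    A (basisVec k) = ∑ i, modelMatrix A i k • (basisVec i : Model n) :=
  (sum_basisCovec_smul _).symm

theorem basisCovec_comp (A : Model n →L[ℝ] Model n) (i : Fin (2 * n)) :
    (basisCovec i).comp A = ∑ k, modelMatrix A i k • (basisCovec k : Model n →L[ℝ] ℝ) := by
  ext1 v
  conv_lhs => rw [← sum_basisCovec_smul v]
  simp [modelMatrix, sum_apply, mul_comm]

theorem modelMatrix_comp (A B : Model n →L[ℝ] Model n) :
    modelMatrix (A.comp B) = modelMatrix A * modelMatrix B := by
  ext i k
  rw [Matrix.mul_apply]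
  change basisCovec i (A (B (basisVec k))) = _
  rw [map_basisVec B, map_sum, map_sum]
  refine Finset.sum_congr rfl fun j _ => ?_
  rw [map_smul, map_smul, smul_eq_mul, mul_comm]
  rfl

theorem modelMatrix_id : modelMatrix (ContinuousLinearMap.id ℝ (Model n)) = 1 := by
  ext i k
  change basisCovec i (basisVec k : Model n) = _
  rw [basisCovec_basisVec, Matrix.one_apply]

theorem isUnit_det_modelMatrix (A : Model n ≃L[ℝ] Model n) :
    IsUnit (modelMatrix (A : Model n →L[ℝ] Model n)).det := by
  apply Matrix.isUnit_det_of_right_inverse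
    (B := modelMatrix (A.symm : Model n →L[ℝ] Model n))
  rw [← modelMatrix_comp, ← modelMatrix_id]
  congr 1
  ext1 v
  simp

theorem formMatrix_pull (A : Model n →L[ℝ] Model n) (w : Alt n 2) :
    formMatrix (pull A 2 w) = (modelMatrix A).transpose * formMatrix w * modelMatrix A := by
  ext k l
  rw [formMatrix_eq_interior, interior_pull, interior_pull, map_basisVec A l, map_basisVec A k]
  simp only [interior_sum_left, interior_smul_left, map_sum, map_smul, Matrix.mul_apply,
    Matrix.transpose_apply, Finset.sum_mul]
  simp only [ContinuousAlternatingMap.sum_apply, ContinuousAlternatingMap.smul_apply, smul_eq_mul,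
    Finset.mul_sum, pull_apply]
  rw [Finset.sum_comm]
  refine Finset.sum_congr rfl fun j _ => Finset.sum_congr rfl fun i _ => ?_
  rw [formMatrix_eq_interior]
  rw [show A ∘ (![] : Fin 0 → Model n) = ![] from Subsingleton.elim _ _]
  ring

/-- A change of basis in a bilinear expression acts on the coefficient matrix by congruence. -/
theorem sum_smul_congruence {ι V : Type*} [Fintype ι] [AddCommGroup V] [Module ℝ V]
    (W a : Matrix ι ι ℝ) (B : ι → ι → V) :
    ∑ i, ∑ j, W i j • ∑ q, a j q • ∑ p, a i p • B p q =
      ∑ p, ∑ q, (a.transpose * W * a) p q • B p q := by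
  simp only [Matrix.mul_apply, Matrix.transpose_apply, Finset.sum_mul, Finset.sum_smul,
    Finset.smul_sum, smul_smul]
  calc _ = ∑ i, ∑ j, ∑ p, ∑ q, (a i p * W i j * a j q) • B p q := by
        refine Finset.sum_congr rfl fun i _ => Finset.sum_congr rfl fun j _ => ?_
        rw [Finset.sum_comm]
        refine Finset.sum_congr rfl fun p _ => Finset.sum_congr rfl fun q _ => ?_
        congr 1
        ring
    _ = ∑ i, ∑ p, ∑ q, ∑ j, (a i p * W i j * a j q) • B p q := by
        refine Finset.sum_congr rfl fun i _ => ?_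
        rw [Finset.sum_comm]
        exact Finset.sum_congr rfl fun p _ => Finset.sum_comm
    _ = ∑ p, ∑ q, ∑ i, ∑ j, (a i p * W i j * a j q) • B p q := by
        rw [Finset.sum_comm]
        exact Finset.sum_congr rfl fun p _ => Finset.sum_comm
    _ = _ := Finset.sum_congr rfl fun p _ => Finset.sum_congr rfl fun q _ => Finset.sum_comm

/-- `L` does not depend on the coordinates. -/
theorem pull_ptL (A : Model n →L[ℝ] Model n) (w : Alt n 2) {k : ℕ} (η : Alt n k) :
    pull A (k + 2) (ptL w k η) = ptL (pull A 2 w) k (pull A k η) := by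
  simp only [ptL, LinearMap.smul_apply, LinearMap.sum_apply, LinearMap.comp_apply, map_smul,
    map_sum, pull_covWedge, basisCovec_comp, covWedge_sum_left, covWedge_smul_left]
  congr 1
  rw [formMatrix_pull, ← sum_smul_congruence]

/-- `Λ` does not depend on the coordinates. -/
theorem pull_ptLam (A : Model n ≃L[ℝ] Model n) (w : Alt n 2) {k : ℕ} (η : Alt n (k + 2)) :
    pull (A : Model n →L[ℝ] Model n) k (ptLam w k η) =
      ptLam (pull (A : Model n →L[ℝ] Model n) 2 w) k
        (pull (A : Model n →L[ℝ] Model n) (k + 2) η) := by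
  set a := modelMatrix (A : Model n →L[ℝ] Model n) with ha
  have hu : IsUnit a.det := isUnit_det_modelMatrix A
  have hW : (formMatrix w)⁻¹ =
      a * (formMatrix (pull (A : Model n →L[ℝ] Model n) 2 w))⁻¹ * a.transpose := by
    rw [formMatrix_pull, ← ha, Matrix.mul_inv_rev, Matrix.mul_inv_rev, ← mul_assoc, ← mul_assoc,
      Matrix.mul_nonsing_inv _ hu, one_mul, mul_assoc, Matrix.nonsing_inv_mul, mul_one]
    rwa [Matrix.det_transpose]
  simp only [ptLam, LinearMap.smul_apply, LinearMap.sum_apply, LinearMap.comp_apply, map_smul,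
    map_sum, interior_pull, map_basisVec, interior_sum_left, interior_smul_left]
  congr 1
  have h := sum_smul_congruence (formMatrix (pull (A : Model n →L[ℝ] Model n) 2 w))⁻¹ a.transpose
    (fun p q => pull (A : Model n →L[ℝ] Model n) k
      (interior k (basisVec p) (interior (k + 1) (basisVec q) η)))
  rw [Matrix.transpose_transpose, ← hW] at h
  exact h.symm

/-- Nondegeneracy of a `2`-form in terms of its matrix. -/
theorem isUnit_det_formMatrix {w : Alt n 2}
    (hw : ∀ v : Model n, (∀ u : Model n, w ![v, u] = 0) → v = 0) :
    IsUnit (formMatrix w).det := by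
  rw [isUnit_iff_ne_zero]
  intro h
  obtain ⟨v, hv, hv2⟩ := Matrix.exists_vecMul_eq_zero_iff.2 h
  apply hv
  have h0 : ∑ i, v i • (basisVec i : Model n) = 0 := by
    apply hw
    intro u
    change interior 0 u (interior 1 _ w) ![] = 0
    rw [← sum_basisCovec_smul u]
    simp only [interior_sum_left, interior_smul_left, map_sum, map_smul,
      ContinuousAlternatingMap.sum_apply, ContinuousAlternatingMap.smul_apply, smul_eq_mul]
    simp only [Finset.mul_sum]
    rw [Finset.sum_comm]
    refine Finset.sum_eq_zero fun j _ => ?_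
    rw [Finset.sum_congr rfl fun i _ => mul_left_comm _ _ _, ← Finset.mul_sum]
    rw [show ∑ i, v i * interior 0 (basisVec j) (interior 1 (basisVec i) w) ![] = 0 from
      congrFun hv2 j, mul_zero]
  funext j
  have := congrArg (basisCovec j) h0
  simpa [basisCovec_basisVec] using this

end Naturality

/-! ### Lefschetz theory of a graded vector space -/

/-- Operators `L` and `Λ` of degrees `2` and `-2` on a graded real vector space `V`, subject to the
`sl₂` relation `[Λ, L] = n - k` on `V k`, where `V` vanishes in degrees above `2n`. No finiteness is
assumed, so that this applies to the forms at a point as well as to spaces of smooth forms. -/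
structure IsLefschetzPair (n : ℕ) {V : ℕ → Type*} [∀ k, AddCommGroup (V k)]
    [∀ k, Module ℝ (V k)] (L : ∀ k, V k →ₗ[ℝ] V (k + 2)) (Lam : ∀ k, V (k + 2) →ₗ[ℝ] V k) :
    Prop where
  comm_zero : ∀ x, Lam 0 (L 0 x) = (n : ℝ) • x
  comm_one : ∀ x, Lam 1 (L 1 x) = ((n : ℝ) - 1) • x
  comm : ∀ k x, Lam (k + 2) (L (k + 2) x) = L k (Lam k x) + ((n : ℝ) - (k + 2)) • x
  vanish : ∀ k, 2 * n < k → ∀ x : V k, x = 0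

section Graded

variable {V : ℕ → Type*} [∀ k, AddCommGroup (V k)] [∀ k, Module ℝ (V k)]

/-- The iterate `Lʳ`. -/
def iterL (L : ∀ k, V k →ₗ[ℝ] V (k + 2)) (k : ℕ) : (r : ℕ) → V k →ₗ[ℝ] V (k + 2 * r)
  | 0 => LinearMap.id
  | r + 1 => L (k + 2 * r) ∘ₗ iterL L k r

/-- The iterate `Λʳ`. -/
def iterLam (Lam : ∀ k, V (k + 2) →ₗ[ℝ] V k) (k : ℕ) : (r : ℕ) → V (k + 2 * r) →ₗ[ℝ] V k
  | 0 => LinearMap.id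
  | r + 1 => iterLam Lam k r ∘ₗ Lam (k + 2 * r)

/-- The kernel of `Λ` in degree `k`; everything in degrees `0` and `1`. -/
def gradedPrim (Lam : ∀ k, V (k + 2) →ₗ[ℝ] V k) : (k : ℕ) → Submodule ℝ (V k)
  | 0 => ⊤
  | 1 => ⊤
  | k + 2 => LinearMap.ker (Lam k)

/-- The image of `L` in degree `k`; zero in degrees `0` and `1`. -/
def gradedIm (L : ∀ k, V k →ₗ[ℝ] V (k + 2)) : (k : ℕ) → Submodule ℝ (V k)
  | 0 => ⊥
  | 1 => ⊥
  | k + 2 => LinearMap.range (L k)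

variable {n : ℕ} {L : ∀ k, V k →ₗ[ℝ] V (k + 2)} {Lam : ∀ k, V (k + 2) →ₗ[ℝ] V k}

namespace IsLefschetzPair

variable (h : IsLefschetzPair n L Lam)
include h

/-- On primitive elements `ΛL` is multiplication by `n - k`. -/
theorem lam_L_of_mem_prim {k : ℕ} {x : V k} (hx : x ∈ gradedPrim Lam k) :
    Lam k (L k x) = ((n : ℝ) - k) • x := by
  match k, x, hx with
  | 0, x, _ => simpa using h.comm_zero x
  | 1, x, _ => simpa using h.comm_one x
  | k + 2, x, hx =>
    have h0 : Lam k x = 0 := hx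
    rw [h.comm, h0, map_zero, zero_add]
    push_cast
    rfl

/-- Below the middle degree `ΛL + c` is bijective for every `c ≥ 0`. The induction on the degree
splits `V k` as `ker Λ ⊕ L V (k - 2)`: the first summand is an eigenspace with positive eigenvalue,
and on the second the operator is conjugate to `ΛL + c'` in degree `k - 2`, with a larger `c'`. -/
theorem bijective_lam_L_add : ∀ (k : ℕ), k < n → ∀ c : ℝ, 0 ≤ c →
    Function.Bijective (Lam k ∘ₗ L k + c • (LinearMap.id : V k →ₗ[ℝ] V k)) := by
  have scalar : ∀ (k : ℕ) (a : ℝ), a ≠ 0 → ∀ T : V k →ₗ[ℝ] V k, (∀ x, T x = a • x) →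
      Function.Bijective T := by
    intro k a ha T hT
    refine ⟨fun x y hxy => ?_, fun y => ⟨a⁻¹ • y, ?_⟩⟩
    · rw [hT, hT] at hxy
      exact smul_right_injective _ ha hxy
    · rw [hT, smul_smul, mul_inv_cancel₀ ha, one_smul]
  intro k
  induction k using Nat.strong_induction_on with
  | _ k ih =>
    intro hk c hc
    match k, ih, hk with
    | 0, _, hk =>
      refine scalar 0 (n + c) (by have : (0 : ℝ) < n := by exact_mod_cast hk
                                  positivity) _ fun x => ?_
      simp [h.comm_zero, add_smul]
    | 1, _, hk =>
      refine scalar 1 (n - 1 + c) (by have : (1 : ℝ) < n := by exact_mod_cast hk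
                                      linarith) _ fun x => ?_
      simp [h.comm_one, add_smul]
    | k + 2, ih, hk =>
      have hkn : ((k : ℝ) + 2) < n := by exact_mod_cast hk
      have ih0 := ih k (by omega) (by omega) 0 le_rfl
      rw [zero_smul, add_zero] at ih0
      have ih1 := ih k (by omega) (by omega) (n - (k + 2) + c) (by linarith)
      have key : ∀ y, (Lam (k + 2) ∘ₗ L (k + 2) + c • LinearMap.id :
          V (k + 2) →ₗ[ℝ] V (k + 2)) (L k y) =
          L k ((Lam k ∘ₗ L k + ((n : ℝ) - (k + 2) + c) • LinearMap.id : V k →ₗ[ℝ] V k) y) := by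
        intro y
        simp only [LinearMap.add_apply, LinearMap.comp_apply, LinearMap.smul_apply,
          LinearMap.id_apply, h.comm, map_add, map_smul, add_smul]
        abel
      have keyp : ∀ x, Lam k x = 0 → (Lam (k + 2) ∘ₗ L (k + 2) + c • LinearMap.id :
          V (k + 2) →ₗ[ℝ] V (k + 2)) x =
          ((n : ℝ) - (k + 2) + c) • x := by
        intro x hx
        simp [h.comm, hx, add_smul]
      have hpos : (n : ℝ) - (k + 2) + c ≠ 0 := by linarith
      have dec : ∀ x, ∃ y, Lam k (x - L k y) = 0 := by
        intro x
        obtain ⟨y, hy⟩ := ih0.2 (Lam k x)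
        refine ⟨y, ?_⟩
        rw [map_sub, sub_eq_zero]
        exact hy.symm
      constructor
      · rw [← LinearMap.ker_eq_bot, LinearMap.ker_eq_bot']
        intro x hx
        obtain ⟨y, hy⟩ := dec x
        rw [← sub_add_cancel x (L k y), map_add, key, keyp _ hy] at hx
        -- apply `Λ` to isolate the component in the image of `L`
        have h1 := congrArg (Lam k) hx
        rw [map_add, map_smul, hy, smul_zero, zero_add, map_zero] at h1
        have h2 := ih0.1 (h1.trans (map_zero (Lam k ∘ₗ L k)).symm)
        have h3 := ih1.1 (h2.trans (map_zero _).symm)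
        rw [h3, map_zero, map_zero, map_zero, add_zero, sub_zero, smul_eq_zero] at hx
        exact hx.resolve_left hpos
      · intro z
        obtain ⟨y, hy⟩ := dec z
        obtain ⟨y', hy'⟩ := ih1.2 y
        refine ⟨((n : ℝ) - (k + 2) + c)⁻¹ • (z - L k y) + L k y', ?_⟩
        rw [map_add, key, hy', map_smul, keyp _ hy, smul_smul, inv_mul_cancel₀ hpos, one_smul,
          sub_add_cancel]

theorem bijective_lam_L {k : ℕ} (hk : k < n) : Function.Bijective (Lam k ∘ₗ L k) := by
  simpa using h.bijective_lam_L_add k hk 0 le_rfl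

theorem injective_L {k : ℕ} (hk : k < n) : Function.Injective (L k) :=
  Function.Injective.of_comp (h.bijective_lam_L hk).1

/-- Above the middle degree `LΛ + c` is bijective for every `c ≥ 0`; this is dual to
`bijective_lam_L_add`, with a descending induction that starts where `V` vanishes. -/
theorem bijective_L_lam_add (k : ℕ) (hk : n < k + 2) (c : ℝ) (hc : 0 ≤ c) :
    Function.Bijective (L k ∘ₗ Lam k + c • (LinearMap.id : V (k + 2) →ₗ[ℝ] V (k + 2))) := by
  obtain ⟨m, hm⟩ : ∃ m, 2 * n < k + m := ⟨2 * n + 1, by omega⟩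
  induction m using Nat.strong_induction_on generalizing k c with
  | _ m ih =>
    by_cases hbig : 2 * n < k + 2
    · exact ⟨fun x y _ => by rw [h.vanish _ hbig x, h.vanish _ hbig y],
        fun y => ⟨0, by rw [h.vanish _ hbig y, map_zero]⟩⟩
    have ih0 := ih (m - 2) (by omega) (k + 2) (by omega) 0 le_rfl (by omega)
    rw [zero_smul, add_zero] at ih0
    have hkn : (n : ℝ) < k + 2 := by exact_mod_cast hk
    have ih1 := ih (m - 2) (by omega) (k + 2) (by omega) (k + 2 - n + c) (by linarith) (by omega)
    have swap : ∀ x : V (k + 2), L k (Lam k x) =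
        Lam (k + 2) (L (k + 2) x) + ((k : ℝ) + 2 - n) • x := by
      intro x
      rw [h.comm, add_assoc, ← add_smul]
      simp
    have key : ∀ y, (L k ∘ₗ Lam k + c • LinearMap.id :
        V (k + 2) →ₗ[ℝ] V (k + 2)) (Lam (k + 2) y) =
        Lam (k + 2) ((L (k + 2) ∘ₗ Lam (k + 2) + ((k : ℝ) + 2 - n + c) • LinearMap.id :
          V (k + 4) →ₗ[ℝ] V (k + 4)) y) := by
      intro y
      simp only [LinearMap.add_apply, LinearMap.comp_apply, LinearMap.smul_apply,
        LinearMap.id_apply, swap, map_add, map_smul, add_smul]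
      abel
    have keyp : ∀ x, L (k + 2) x = 0 → (L k ∘ₗ Lam k + c • LinearMap.id :
        V (k + 2) →ₗ[ℝ] V (k + 2)) x =
        ((k : ℝ) + 2 - n + c) • x := by
      intro x hx
      simp only [LinearMap.add_apply, LinearMap.comp_apply, LinearMap.smul_apply,
        LinearMap.id_apply, swap, hx, map_zero, zero_add, add_smul]
    have hpos : (k : ℝ) + 2 - n + c ≠ 0 := by linarith
    have dec : ∀ x, ∃ y, L (k + 2) (x - Lam (k + 2) y) = 0 := by
      intro x
      obtain ⟨y, hy⟩ := ih0.2 (L (k + 2) x)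
      refine ⟨y, ?_⟩
      rw [map_sub, sub_eq_zero]
      exact hy.symm
    constructor
    · rw [← LinearMap.ker_eq_bot, LinearMap.ker_eq_bot']
      intro x hx
      obtain ⟨y, hy⟩ := dec x
      rw [← sub_add_cancel x (Lam (k + 2) y), map_add, key, keyp _ hy] at hx
      have h1 := congrArg (L (k + 2)) hx
      rw [map_add, map_smul, hy, smul_zero, zero_add, map_zero] at h1
      have h2 := ih0.1 (h1.trans (map_zero (L (k + 2) ∘ₗ Lam (k + 2))).symm)
      have h3 := ih1.1 (h2.trans (map_zero _).symm)
      rw [h3, map_zero, map_zero, map_zero, add_zero, sub_zero, smul_eq_zero] at hx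
      exact hx.resolve_left hpos
    · intro z
      obtain ⟨y, hy⟩ := dec z
      obtain ⟨y', hy'⟩ := ih1.2 y
      refine ⟨((k : ℝ) + 2 - n + c)⁻¹ • (z - Lam (k + 2) y) + Lam (k + 2) y', ?_⟩
      rw [map_add, key, hy', map_smul, keyp _ hy, smul_smul, inv_mul_cancel₀ hpos, one_smul,
        sub_add_cancel]

theorem bijective_L_lam {k : ℕ} (hk : n < k + 2) : Function.Bijective (L k ∘ₗ Lam k) := by
  simpa using h.bijective_L_lam_add k hk 0 le_rfl

theorem injective_lam {k : ℕ} (hk : n < k + 2) : Function.Injective (Lam k) :=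
  Function.Injective.of_comp (h.bijective_L_lam hk).1

/-- The Lefschetz decomposition up to the middle degree. -/
theorem isCompl_prim_im {k : ℕ} (hk : k ≤ n) : IsCompl (gradedPrim Lam k) (gradedIm L k) := by
  match k, hk with
  | 0, _ => exact isCompl_top_bot
  | 1, _ => exact isCompl_top_bot
  | k + 2, hk =>
    have hb := h.bijective_lam_L (k := k) (by omega)
    constructor
    · rw [Submodule.disjoint_def]
      rintro _ hx ⟨y, rfl⟩
      have : y = 0 := hb.1 (LinearMap.mem_ker.1 hx |>.trans (map_zero (Lam k ∘ₗ L k)).symm)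
      rw [this, map_zero]
    · rw [codisjoint_iff, eq_top_iff]
      intro x _
      obtain ⟨y, hy⟩ := hb.2 (Lam k x)
      rw [← sub_add_cancel x (L k y)]
      refine Submodule.add_mem_sup ?_ ⟨y, rfl⟩
      rw [gradedPrim, LinearMap.mem_ker, map_sub, sub_eq_zero]
      exact hy.symm

theorem lam_iterL_succ {k : ℕ} {x : V k} (hx : x ∈ gradedPrim Lam k) (r : ℕ) :
    Lam (k + 2 * r) (iterL L k (r + 1) x) =
      (((r : ℝ) + 1) * ((n : ℝ) - k - r)) • iterL L k r x := by
  induction r with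
  | zero => simpa [iterL] using h.lam_L_of_mem_prim hx
  | succ r ih =>
    change Lam (k + 2 * r + 2) (L (k + 2 * r + 2) (iterL L k (r + 1) x)) = _
    rw [h.comm, ih]
    rw [map_smul]
    change (_ : ℝ) • iterL L k (r + 1) x + _ = _
    rw [← add_smul]
    congr 1
    push_cast
    ring

/-- `Lʳ` is injective on primitive elements of degree at most `n - r`. -/
theorem iterL_eq_zero {k r : ℕ} (hkr : k + r ≤ n) {x : V k} (hx : x ∈ gradedPrim Lam k)
    (h0 : iterL L k r x = 0) : x = 0 := by
  induction r with
  | zero => exact h0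
  | succ r ih =>
    apply ih (by omega)
    have h1 := h.lam_iterL_succ hx r
    rw [h0, map_zero, eq_comm, smul_eq_zero] at h1
    refine h1.resolve_left (mul_ne_zero (by positivity) ?_)
    have : (k : ℝ) + (r + 1) ≤ n := by exact_mod_cast hkr
    intro h2
    linarith

/-- `Lʳ⁺¹` vanishes on primitive elements of degree `n - r`. -/
theorem iterL_succ_eq_zero {k r : ℕ} (hkr : k + r = n) {x : V k} (hx : x ∈ gradedPrim Lam k) :
    iterL L k (r + 1) x = 0 := by
  apply h.injective_lam (k := k + 2 * r) (by omega)
  rw [h.lam_iterL_succ hx r, map_zero]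
  have : (n : ℝ) - k - r = 0 := by rw [← hkr]; push_cast; ring
  rw [this, mul_zero, zero_smul]

/-- In the middle degree the kernel of `L` is contained in that of `Λ`. -/
theorem lam_eq_zero_of_L_eq_zero {x : V n} (hx : L n x = 0) : x ∈ gradedPrim Lam n := by
  generalize hm : n = m at x hx
  match m, hm, x, hx with
  | 0, _, _, _ => trivial
  | 1, _, _, _ => trivial
  | k + 2, hm, x, hx =>
    apply h.injective_L (k := k) (by omega)
    have h1 := h.comm k x
    have : (n : ℝ) - (k + 2) = 0 := by rw [hm]; push_cast; ring
    rw [hx, map_zero, this, zero_smul, add_zero] at h1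
    rw [← h1, map_zero]

/-- On an eigenvector of `LΛ` with the eigenvalue that `Lʳ⁺¹` of a primitive element would have,
`Lʳ⁺¹` is up to a nonzero factor inverse to `Λʳ⁺¹`, and `Λʳ⁺¹` takes primitive values. The extra
parameter `s` accounts for the change of eigenvalue in the induction, where `Λ` is applied once. -/
theorem iterL_iterLam_aux (r : ℕ) : ∀ (k s : ℕ), k + (r + 1) + s = n → ∀ x : V (k + 2 * (r + 1)),
    L (k + 2 * r) (Lam (k + 2 * r) x) = (((s : ℝ) + 1) * (r + 1)) • x →
    iterLam Lam k (r + 1) x ∈ gradedPrim Lam k ∧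
      ∃ c : ℝ, c ≠ 0 ∧ iterL L k (r + 1) (iterLam Lam k (r + 1) x) = c • x := by
  induction r with
  | zero =>
    intro k s hks x hx
    refine ⟨?_, (s : ℝ) + 1, by positivity, by simpa using! hx⟩
    change Lam k x ∈ _
    match k, hks, x, hx with
    | 0, _, _, _ => trivial
    | 1, _, _, _ => trivial
    | j + 2, hks, x, hx =>
      have hx' : L (j + 2) (Lam (j + 2) x) = (((s : ℝ) + 1) * (0 + 1)) • x := by
        simpa using! hx
      apply h.injective_L (k := j) (by omega)
      have h1 := h.comm j (Lam (j + 2) x)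
      rw [hx', map_smul] at h1
      have : ((s : ℝ) + 1) * (0 + 1) = (n : ℝ) - (j + 2) := by
        rw [← hks]; push_cast; ring
      rw [this, right_eq_add] at h1
      rw [h1, map_zero]
  | succ r ih =>
    intro k s hks x hx
    have h1 := h.comm (k + 2 * r) (Lam (k + 2 * r + 2) x)
    have hx' : L (k + 2 * r + 2) (Lam (k + 2 * r + 2) x) =
        (((s : ℝ) + 1) * ((r : ℝ) + 1 + 1)) • x := by simpa using! hx
    rw [hx', map_smul] at h1
    have h2 := ih k (s + 1) (by omega) (Lam (k + 2 * r + 2) x) (by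
      rw [← sub_eq_iff_eq_add, ← sub_smul] at h1
      rw [← h1]
      congr 1
      rw [← hks]; push_cast; ring)
    refine ⟨h2.1, ?_⟩
    obtain ⟨c, hc, hc2⟩ := h2.2
    refine ⟨c * (((s : ℝ) + 1) * ((r : ℝ) + 1 + 1)), by positivity, ?_⟩
    change L (k + 2 * r + 2) (iterL L k (r + 1) (iterLam Lam k (r + 1) (Lam (k + 2 * r + 2) x))) = _
    rw [hc2]
    change L (k + 2 * r + 2) (c • Lam (k + 2 * r + 2) x) = _
    rw [map_smul, hx', smul_smul]

/-- An element of degree `n + r` killed by `L` is `Lʳ` of a primitive element of degree `n - r`. -/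
theorem exists_iterL_eq {k r : ℕ} (hkr : k + r = n) {x : V (k + 2 * r)}
    (hx : L (k + 2 * r) x = 0) : ∃ y ∈ gradedPrim Lam k, iterL L k r y = x := by
  cases r with
  | zero =>
    subst hkr
    exact ⟨x, h.lam_eq_zero_of_L_eq_zero hx, rfl⟩
  | succ r =>
    have h1 := h.comm (k + 2 * r) x
    change Lam _ (L (k + 2 * (r + 1)) x) = _ at h1
    rw [hx, map_zero, eq_comm, ← eq_neg_iff_add_eq_zero, ← neg_smul] at h1
    obtain ⟨hp, c, hc, hc2⟩ := h.iterL_iterLam_aux r k 0 (by omega) x (by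
      refine h1.trans ?_
      congr 1
      rw [← hkr]; push_cast; ring)
    refine ⟨c⁻¹ • iterLam Lam k (r + 1) x, Submodule.smul_mem _ _ hp, ?_⟩
    rw [map_smul, hc2, smul_smul, inv_mul_cancel₀ hc, one_smul]

end IsLefschetzPair

end Graded

/-! ### Lefschetz theory and boundary symbols at a point -/

section PointLefschetz

variable {n : ℕ} {w : Alt n 2}

theorem alt_eq_zero_of_lt {k : ℕ} (hk : 2 * n < k) (η : Alt n k) : η = 0 := by
  ext v
  refine η.toAlternatingMap.map_linearDependent v fun hv => ?_
  have := hv.fintype_card_le_finrank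
  simp at this
  omega

theorem isLefschetzPair_pt (hw : IsUnit (formMatrix w).det) :
    IsLefschetzPair n (ptL w) (ptLam w) := by
  have key : ∀ (η : AltFamily n) (k : ℕ),
      ptLam w k (ptL w k (η k)) = lefAll w (lamAll w η) k + ((n : ℝ) • η k - (k : ℝ) • η k) := by
    intro η k
    have := congrArg (fun T : Module.End ℝ (AltFamily n) => T η k) (lamAll_mul_lefAll w hw)
    simpa [lamAll_apply, lefAll_apply_add_two] using! this
  refine ⟨fun x => ?_, fun x => ?_, fun k x => ?_, fun k hk x => alt_eq_zero_of_lt hk x⟩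
  · obtain ⟨η, rfl⟩ : ∃ η : AltFamily n, η 0 = x := ⟨Pi.single 0 x, Pi.single_eq_same _ _⟩
    rw [key, lefAll_apply_zero]
    simp
  · obtain ⟨η, rfl⟩ : ∃ η : AltFamily n, η 1 = x := ⟨Pi.single 1 x, Pi.single_eq_same _ _⟩
    rw [key, lefAll_apply_one]
    simp [sub_smul]
  · obtain ⟨η, rfl⟩ : ∃ η : AltFamily n, η (k + 2) = x :=
      ⟨Pi.single (k + 2) x, Pi.single_eq_same _ _⟩
    rw [key, lefAll_apply_add_two, lamAll_apply, sub_smul]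
    push_cast
    rfl

theorem gradedPrim_ptLam (w : Alt n 2) : ∀ k, gradedPrim (ptLam w) k = ptPrim w k
  | 0 => rfl
  | 1 => rfl
  | _ + 2 => rfl

theorem gradedIm_ptL (w : Alt n 2) : ∀ k, gradedIm (ptL w) k = ptImL w k
  | 0 => rfl
  | 1 => rfl
  | _ + 2 => rfl

section Projection

variable (hw : IsUnit (formMatrix w).det)
include hw

theorem isCompl_ptPrim_ptImL {k : ℕ} (hk : k ≤ n) : IsCompl (ptPrim w k) (ptImL w k) := by
  rw [← gradedPrim_ptLam, ← gradedIm_ptL]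
  exact (isLefschetzPair_pt hw).isCompl_prim_im hk

theorem ptProj_mem {k : ℕ} (hk : k ≤ n) (η : Alt n k) : ptProj w k η ∈ ptPrim w k := by
  rw [ptProj, dif_pos (isCompl_ptPrim_ptImL hw hk)]
  exact Submodule.projection_apply_mem _ _

theorem ptProj_of_mem_ptPrim {k : ℕ} (hk : k ≤ n) {η : Alt n k} (hη : η ∈ ptPrim w k) :
    ptProj w k η = η := by
  rw [ptProj, dif_pos (isCompl_ptPrim_ptImL hw hk)]
  exact (Submodule.projection_eq_self_iff _ _).2 hη

theorem ptProj_eq_zero_iff {k : ℕ} (hk : k ≤ n) {η : Alt n k} :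
    ptProj w k η = 0 ↔ η ∈ ptImL w k := by
  rw [ptProj, dif_pos (isCompl_ptPrim_ptImL hw hk)]
  exact Submodule.projection_apply_eq_zero_iff _

theorem ptProj_ptL {k : ℕ} (hk : k + 2 ≤ n) (η : Alt n k) : ptProj w (k + 2) (ptL w k η) = 0 :=
  (ptProj_eq_zero_iff hw hk).2 ⟨η, rfl⟩

theorem sub_ptProj_mem {k : ℕ} (hk : k ≤ n) (η : Alt n k) : η - ptProj w k η ∈ ptImL w k := by
  rw [← ptProj_eq_zero_iff hw hk, map_sub, ptProj_of_mem_ptPrim hw hk (ptProj_mem hw hk η),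
    sub_self]

end Projection

theorem covWedge_ptL {k : ℕ} (α : Model n →L[ℝ] ℝ) (η : Alt n k) :
    covWedge (k + 2) α (ptL w k η) = ptL w (k + 1) (covWedge k α η) := by
  obtain ⟨ξ, rfl⟩ : ∃ ξ : AltFamily n, ξ k = η := ⟨Pi.single k η, Pi.single_eq_same _ _⟩
  have := congrArg (fun T : Module.End ℝ (AltFamily n) => T ξ (k + 3)) (wedgeAll_mul_lefAll w α)
  have e : ∀ ζ : AltFamily n, lefAll w ζ (k + 3) = ptL w (k + 1) (ζ (k + 1)) :=
    fun ζ => lefAll_apply_add_two w ζ (k + 1)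
  simpa [e, lefAll_apply_add_two] using! this

theorem lefAll_pow_apply (ξ : AltFamily n) (k r : ℕ) :
    (lefAll w ^ r) ξ (k + 2 * r) = iterL (ptL w) k r (ξ k) := by
  induction r with
  | zero => rfl
  | succ r ih =>
    rw [pow_succ']
    refine (lefAll_apply_add_two w _ (k + 2 * r)).trans ?_
    rw [ih]
    rfl

/-- Exterior multiplication commutes with `Lʳ`. This is stated for the vanishing of the two forms,
as their degrees `k + 2r + 1` and `k + 1 + 2r` are not definitionally equal. -/
theorem covWedge_iterL_eq_zero_iff {k r : ℕ} (α : Model n →L[ℝ] ℝ) (η : Alt n k) :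
    covWedge (k + 2 * r) α (iterL (ptL w) k r η) = 0 ↔
      iterL (ptL w) (k + 1) r (covWedge k α η) = 0 := by
  obtain ⟨ξ, rfl⟩ : ∃ ξ : AltFamily n, ξ k = η := ⟨Pi.single k η, Pi.single_eq_same _ _⟩
  have hcomm : wedgeAll α * lefAll w ^ r = lefAll w ^ r * wedgeAll α :=
    (show Commute (wedgeAll α) (lefAll w) from wedgeAll_mul_lefAll w α).pow_right r
  have e1 : covWedge (k + 2 * r) α (iterL (ptL w) k r (ξ k)) =
      (wedgeAll α * lefAll w ^ r) ξ (k + 2 * r + 1) := by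
    rw [← lefAll_pow_apply]; rfl
  have e2 : iterL (ptL w) (k + 1) r (covWedge k α (ξ k)) =
      (lefAll w ^ r * wedgeAll α) ξ (k + 1 + 2 * r) :=
    (lefAll_pow_apply (wedgeAll α ξ) (k + 1) r).symm
  rw [e1, e2, hcomm, show k + 2 * r + 1 = k + 1 + 2 * r by omega]

theorem iterL_ptL_eq_zero_iff {k r : ℕ} (η : Alt n k) :
    iterL (ptL w) (k + 2) r (ptL w k η) = 0 ↔ iterL (ptL w) k (r + 1) η = 0 := by
  obtain ⟨ξ, rfl⟩ : ∃ ξ : AltFamily n, ξ k = η := ⟨Pi.single k η, Pi.single_eq_same _ _⟩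
  have e1 : iterL (ptL w) (k + 2) r (ptL w k (ξ k)) = (lefAll w ^ (r + 1)) ξ (k + 2 + 2 * r) := by
    rw [pow_succ]
    refine Eq.trans ?_ (lefAll_pow_apply (lefAll w ξ) (k + 2) r).symm
    rw [lefAll_apply_add_two]
  rw [e1, ← lefAll_pow_apply, show k + 2 + 2 * r = k + 2 * (r + 1) by omega]

variable (hw : IsUnit (formMatrix w).det)
include hw

/-- If `β` is primitive, then so is `Λ(dxⁱ ∧ β)`: the commutator of `Λ` and exterior multiplication
by `dxⁱ` is a contraction, which commutes with `Λ`. -/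
theorem ptLam_covWedge_mem_ptPrim (i : Fin (2 * n)) {j : ℕ} {β : Alt n (j + 1)}
    (hβ : β ∈ ptPrim w (j + 1)) :
    ptLam w j (covWedge (j + 1) (basisCovec i) β) ∈ ptPrim w j := by
  match j, β, hβ with
  | 0, _, _ => trivial
  | 1, _, _ => trivial
  | j + 2, β, hβ =>
    change ptLam w j (ptLam w (j + 2) _) = 0
    have hβ' : ptLam w (j + 1) β = 0 := hβ
    set ξ : AltFamily n := Pi.single (j + 3) β with hξ
    have h3 : ξ (j + 3) = β := Pi.single_eq_same _ _
    have hlam : lamAll w ξ = 0 := by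
      refine AltFamily.ext fun k => ?_
      rw [lamAll_apply]
      by_cases hk : k = j + 1
      · subst hk
        rw [h3, hβ']; rfl
      · rw [show ξ (k + 2) = 0 from Pi.single_eq_of_ne (by omega) _, map_zero]; rfl
    have h1 : (lamAll w * (lamAll w * wedgeAll (basisCovec i))) ξ = 0 := by
      rw [lamAll_mul_wedgeAll w hw, mul_add, lamAll_mul_dualInteriorAll, ← mul_assoc,
        LinearMap.add_apply, Module.End.mul_apply, Module.End.mul_apply, hlam, map_zero, map_zero,
        zero_add, Module.End.mul_apply, hlam, map_zero]
    have h2 := congrArg (fun ζ : AltFamily n => ζ j) h1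
    simp only [Module.End.mul_apply, lamAll_apply] at h2
    rw [← h3]
    exact h2

/-- `dxⁱ ∧ β` for primitive `β` is the sum of a primitive form and `L` of
`μ = (n - j)⁻¹ Λ(dxⁱ ∧ β)`. -/
theorem ptLam_covWedge_sub (i : Fin (2 * n)) {j : ℕ} (hj : j < n) {β : Alt n (j + 1)}
    (hβ : β ∈ ptPrim w (j + 1)) :
    ptLam w j (covWedge (j + 1) (basisCovec i) β -
      ptL w j (((n : ℝ) - j)⁻¹ • ptLam w j (covWedge (j + 1) (basisCovec i) β))) = 0 := by
  have hp := ptLam_covWedge_mem_ptPrim hw i hβ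
  rw [← gradedPrim_ptLam] at hp
  have hj' : (n : ℝ) - j ≠ 0 := by
    have : (j : ℝ) < n := by exact_mod_cast hj
    linarith
  rw [map_sub, map_smul, map_smul, (isLefschetzPair_pt hw).lam_L_of_mem_prim hp, smul_smul,
    inv_mul_cancel₀ hj', one_smul, sub_self]

/-- The algebraic content of the condition `D₊` on a primitive form below the middle degree. -/
theorem covWedge_eq_of_ptProj_eq_zero (i : Fin (2 * n)) {j : ℕ} (hj : j + 1 < n)
    {β : Alt n (j + 1)} (hβ : β ∈ ptPrim w (j + 1))
    (h : ptProj w (j + 2) (covWedge (j + 1) (basisCovec i) β) = 0) {μ : Alt n j}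
    (hμ : μ = ((n : ℝ) - j)⁻¹ • ptLam w j (covWedge (j + 1) (basisCovec i) β)) :
    covWedge (j + 1) (basisCovec i) β = ptL w j μ ∧ covWedge j (basisCovec i) μ = 0 := by
  have h1 : covWedge (j + 1) (basisCovec i) β - ptL w j μ = 0 := by
    rw [← ptProj_of_mem_ptPrim hw (k := j + 2) (by omega)
      (η := covWedge (j + 1) (basisCovec i) β - ptL w j μ)
      (by rw [hμ]; exact ptLam_covWedge_sub hw i (by omega) hβ), map_sub, h,
      ptProj_ptL hw (by omega), sub_zero]
  rw [sub_eq_zero] at h1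
  refine ⟨h1, (isLefschetzPair_pt hw).injective_L (k := j + 1) hj ?_⟩
  rw [← covWedge_ptL, ← h1, covWedge_covWedge_self, map_zero]

/-- In the middle degree `dxⁱ ∧ β` automatically lies in the image of `L`. -/
theorem covWedge_eq_ptL_of_middle (i : Fin (2 * n)) {j : ℕ} (hj : j + 1 = n)
    {β : Alt n (j + 1)} (hβ : β ∈ ptPrim w (j + 1)) {μ : Alt n j}
    (hμ : μ = ((n : ℝ) - j)⁻¹ • ptLam w j (covWedge (j + 1) (basisCovec i) β)) :
    covWedge (j + 1) (basisCovec i) β = ptL w j μ := by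
  rw [← sub_eq_zero]
  apply (isLefschetzPair_pt hw).injective_lam (k := j) (by omega)
  rw [hμ, ptLam_covWedge_sub hw i (by omega) hβ, map_zero]

/-- The algebraic content of the condition `D₊₋` on a primitive form of middle degree. -/
theorem covWedge_eq_of_ptProj_covWedge_eq_zero (i : Fin (2 * n)) {j : ℕ} (hj : j + 1 = n)
    {β : Alt n (j + 1)} (hβ : β ∈ ptPrim w (j + 1)) {μ : Alt n j}
    (hμ : μ = ((n : ℝ) - j)⁻¹ • ptLam w j (covWedge (j + 1) (basisCovec i) β))
    (h : ptProj w (j + 1) (covWedge j (basisCovec i) μ) = 0) :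
    covWedge (j + 1) (basisCovec i) β = ptL w j μ ∧ covWedge j (basisCovec i) μ = 0 := by
  have h1 := covWedge_eq_ptL_of_middle hw i hj hβ hμ
  refine ⟨h1, ?_⟩
  have hL : ptL w (j + 1) (covWedge j (basisCovec i) μ) = 0 := by
    rw [← covWedge_ptL, ← h1, covWedge_covWedge_self]
  subst hj
  have hp := (isLefschetzPair_pt hw).lam_eq_zero_of_L_eq_zero hL
  rw [gradedPrim_ptLam] at hp
  rw [← h, ptProj_of_mem_ptPrim hw le_rfl hp]

omit hw in
theorem covWedge_interior_of_covWedge_eq_zero {α : Model n →L[ℝ] ℝ} {u : Model n} (hu : α u = 1)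
    {j : ℕ} {μ : Alt n (j + 1)} (h : covWedge (j + 1) α μ = 0) :
    covWedge j α (interior j u μ) = μ := by
  have h1 := interior_covWedge u α μ
  rw [h, map_zero, hu, one_smul, eq_comm, sub_eq_zero] at h1
  exact h1.symm

omit hw in
theorem eq_zero_of_covWedge_eq_zero (i : Fin (2 * n)) {μ : Alt n 0}
    (h : covWedge 0 (basisCovec i) μ = 0) : μ = 0 := by
  have h1 := interior_covWedge_zero (basisVec i) (basisCovec i) μ
  rw [h, map_zero, basisCovec_basisVec, if_pos rfl, one_smul] at h1
  exact h1.symm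

omit hw in
/-- If `α ∧ β` is `ω ∧ μ` with `α ∧ μ = 0`, and `α(u) = 1`, then subtracting `ω ∧ ι_u μ` from `β`
makes it divisible by `α`. -/
theorem covWedge_add_ptL_eq_zero {α : Model n →L[ℝ] ℝ} {u : Model n} (hu : α u = 1)
    {j : ℕ} {β : Alt n (j + 2)} {μ : Alt n (j + 1)}
    (h1 : covWedge (j + 2) α β = ptL w (j + 1) μ) (h2 : covWedge (j + 1) α μ = 0) :
    covWedge (j + 2) α (β + ptL w j (-interior j u μ)) = 0 := by
  rw [map_add, covWedge_ptL, map_neg, covWedge_interior_of_covWedge_eq_zero hu h2, map_neg, h1]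
  exact add_neg_cancel _

/-- `Π` maps forms satisfying `D` to forms satisfying `D₊`. -/
theorem ptProj_covWedge_ptProj {k : ℕ} (hk : k < n) (α : Model n →L[ℝ] ℝ) (η : Alt n k)
    (h : covWedge k α η = 0) : ptProj w (k + 1) (covWedge k α (ptProj w k η)) = 0 := by
  have h1 := sub_ptProj_mem hw hk.le η
  match k, η, hk, h, h1 with
  | 0, η, _, h, h1 =>
    rw [← sub_eq_zero.1 ((Submodule.mem_bot ℝ).1 h1), h, map_zero]
  | 1, η, _, h, h1 =>
    rw [← sub_eq_zero.1 ((Submodule.mem_bot ℝ).1 h1), h, map_zero]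
  | k + 2, η, hk, h, ⟨γ, hγ⟩ =>
    have h2 : ptProj w (k + 2) η = η - ptL w k γ := by rw [hγ, sub_sub_cancel]
    rw [h2, map_sub, h, covWedge_ptL, zero_sub, map_neg, neg_eq_zero]
    exact ptProj_ptL hw (k := k + 1) (by omega) _

/-- In the middle degree `Π` maps forms satisfying `D` to forms satisfying `D₊₋`. -/
theorem covWedge_ptLam_covWedge_ptProj (i : Fin (2 * n)) {j : ℕ} (hj : j + 1 = n)
    (η : Alt n (j + 1)) (h : covWedge (j + 1) (basisCovec i) η = 0) :
    covWedge j (basisCovec i) (((n : ℝ) - j)⁻¹ •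
      ptLam w j (covWedge (j + 1) (basisCovec i) (ptProj w (j + 1) η))) = 0 := by
  have h1 := sub_ptProj_mem hw hj.le η
  have hm := covWedge_eq_ptL_of_middle hw i hj (ptProj_mem hw hj.le η) rfl
  set μ := ((n : ℝ) - j)⁻¹ •
      ptLam w j (covWedge (j + 1) (basisCovec i) (ptProj w (j + 1) η)) with hμ
  clear_value μ
  match j, η, hj, h, h1, μ, hμ, hm with
  | 0, η, _, h, h1, μ, hμ, hm =>
    rw [← sub_eq_zero.1 ((Submodule.mem_bot ℝ).1 h1), h, map_zero, smul_zero] at hμ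
    rw [hμ, map_zero]
  | j + 1, η, hj, h, ⟨γ, hγ⟩, μ, hμ, hm =>
    have h2 : ptProj w (j + 2) η = η - ptL w j γ := by rw [hγ, sub_sub_cancel]
    rw [h2, map_sub, h, covWedge_ptL, zero_sub, ← map_neg] at hm
    have := (isLefschetzPair_pt hw).injective_L (k := j + 1) (by omega) hm
    rw [← this, map_neg, covWedge_covWedge_self, neg_zero]

/-- For primitive `β` of degree `n - r`, the condition `D` on `Lʳ β` is the condition `D₋` on
`β`. -/
theorem covWedge_iterL_eq_zero_iff_ptLam (i : Fin (2 * n)) {j r : ℕ} (hj : j + 1 + r = n)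
    {β : Alt n (j + 1)} (hβ : β ∈ ptPrim w (j + 1)) :
    covWedge (j + 1 + 2 * r) (basisCovec i) (iterL (ptL w) (j + 1) r β) = 0 ↔
      ptLam w j (covWedge (j + 1) (basisCovec i) β) = 0 := by
  have hP := isLefschetzPair_pt hw
  rw [covWedge_iterL_eq_zero_iff]
  cases r with
  | zero =>
    constructor
    · intro h
      have h' : covWedge (j + 1) (basisCovec i) β = 0 := h
      rw [h', map_zero]
    · intro h
      exact hP.injective_lam (k := j) (by omega) (h.trans (map_zero _).symm)
  | succ r =>
    have hz : ∀ ξ : Alt n (j + 2), ptLam w j ξ = 0 → iterL (ptL w) (j + 1 + 1) (r + 1) ξ = 0 :=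
      fun ξ hξ => hP.iterL_succ_eq_zero (k := j + 2) (by omega) hξ
    refine ⟨fun h => ?_, hz _⟩
    have h1 := hz _ (ptLam_covWedge_sub hw i (by omega) hβ)
    rw [map_sub, h, zero_sub, neg_eq_zero] at h1
    have h2 := (iterL_ptL_eq_zero_iff _).1 h1
    have hp := ptLam_covWedge_mem_ptPrim hw i hβ
    rw [← gradedPrim_ptLam] at hp
    have h3 := hP.iterL_eq_zero (by omega) (Submodule.smul_mem _ _ hp) h2
    rw [smul_eq_zero, inv_eq_zero] at h3
    refine h3.resolve_left ?_
    have : (j : ℝ) < n := by exact_mod_cast (by omega : j < n)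
    linarith

end PointLefschetz

/-! ### Smooth dependence on coefficients -/

section AltEval

variable {n : ℕ}

/-- The coefficients of a form: its values on tuples of coordinate vectors. -/
def altCoeff (k : ℕ) : Alt n k →ₗ[ℝ] ((Fin k → Fin (2 * n)) → ℝ) where
  toFun η I := η fun p => basisVec (I p)
  map_add' _ _ := rfl
  map_smul' _ _ := rfl

theorem alt_apply_eq_sum {k : ℕ} (η : Alt n k) (v : Fin k → Model n) :
    η v = ∑ I : Fin k → Fin (2 * n), (∏ p, basisCovec (I p) (v p)) * altCoeff k η I := by
  have h : v = fun p => ∑ i, basisCovec i (v p) • (basisVec i : Model n) :=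
    funext fun p => (sum_basisCovec_smul (v p)).symm
  conv_lhs => rw [h]
  refine (η.toMultilinearMap.map_sum
    (fun p i => basisCovec i (v p) • (basisVec i : Model n))).trans ?_
  refine Finset.sum_congr rfl fun I _ => ?_
  exact η.toMultilinearMap.map_smul_univ _ _

theorem altCoeff_injective (k : ℕ) : Function.Injective (altCoeff (n := n) k) := by
  intro η ξ h
  ext v
  rw [alt_apply_eq_sum, alt_apply_eq_sum, h]

instance (k : ℕ) : FiniteDimensional ℝ (Alt n k) :=
  Module.Finite.of_injective (altCoeff k) (altCoeff_injective k)

theorem altCoeff_pull (A : Model n →L[ℝ] Model n) {k : ℕ} (η : Alt n k)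
    (I : Fin k → Fin (2 * n)) :
    altCoeff k (pull A k η) I =
      ∑ J : Fin k → Fin (2 * n), (∏ p, modelMatrix A (J p) (I p)) * altCoeff k η J :=
  alt_apply_eq_sum η _

variable {E H X : Type*} [NormedAddCommGroup E] [NormedSpace ℝ E] [TopologicalSpace H]
  {J : ModelWithCorners ℝ E H} [TopologicalSpace X] [ChartedSpace H X] {x : X}

theorem ContMDiffAt.linearMap_comp {F G : Type*} [NormedAddCommGroup F] [NormedSpace ℝ F]
    [FiniteDimensional ℝ F] [NormedAddCommGroup G] [NormedSpace ℝ G] (T : F →ₗ[ℝ] G)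
    {f : X → F} (hf : ContMDiffAt J 𝓘(ℝ, F) ∞ f x) :
    ContMDiffAt J 𝓘(ℝ, G) ∞ (fun y => T (f y)) x :=
  T.toContinuousLinearMap.contMDiff.contMDiffAt.comp x hf

theorem contMDiffAt_altCoeff {k : ℕ} {f : X → Alt n k}
    (hf : ContMDiffAt J 𝓘(ℝ, Alt n k) ∞ f x) (I : Fin k → Fin (2 * n)) :
    ContMDiffAt J 𝓘(ℝ, ℝ) ∞ (fun y => altCoeff k (f y) I) x :=
  ContMDiffAt.linearMap_comp (LinearMap.proj I ∘ₗ altCoeff k) hf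

theorem contMDiffAt_of_altCoeff {k : ℕ} {f : X → Alt n k}
    (hf : ∀ I, ContMDiffAt J 𝓘(ℝ, ℝ) ∞ (fun y => altCoeff k (f y) I) x) :
    ContMDiffAt J 𝓘(ℝ, Alt n k) ∞ f x := by
  obtain ⟨P, hP⟩ := (altCoeff (n := n) k).exists_leftInverse_of_injective
    (LinearMap.ker_eq_bot.2 (altCoeff_injective k))
  have h1 : ContMDiffAt J 𝓘(ℝ, (Fin k → Fin (2 * n)) → ℝ) ∞ (fun y => altCoeff k (f y)) x :=
    contMDiffAt_pi_space.2 hf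
  have h2 := ContMDiffAt.linearMap_comp P h1
  refine h2.congr_of_eventuallyEq (Filter.Eventually.of_forall fun y => ?_)
  exact (LinearMap.congr_fun hP (f y)).symm

theorem contMDiffAt_pull {k : ℕ} {A : X → Model n →L[ℝ] Model n} {f : X → Alt n k}
    (hA : ContMDiffAt J 𝓘(ℝ, Model n →L[ℝ] Model n) ∞ A x)
    (hf : ContMDiffAt J 𝓘(ℝ, Alt n k) ∞ f x) :
    ContMDiffAt J 𝓘(ℝ, Alt n k) ∞ (fun y => pull (A y) k (f y)) x := by
  have hent : ∀ i j, ContMDiffAt J 𝓘(ℝ, ℝ) ∞ (fun y => modelMatrix (A y) i j) x := by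
    intro i j
    exact ContMDiffAt.linearMap_comp ((basisCovec i).toLinearMap ∘ₗ
      (ContinuousLinearMap.apply ℝ (Model n) (basisVec j : Model n)).toLinearMap) hA
  refine contMDiffAt_of_altCoeff fun I => ?_
  simp only [altCoeff_pull]
  refine contMDiffAt_finsetSum fun K _ => ?_
  exact (contMDiffAt_finsetProd fun p _ => hent _ _).mul (contMDiffAt_altCoeff hf K)

theorem contMDiffAt_formMatrix {w : X → Alt n 2} (hw : ContMDiffAt J 𝓘(ℝ, Alt n 2) ∞ w x)
    (i j : Fin (2 * n)) : ContMDiffAt J 𝓘(ℝ, ℝ) ∞ (fun y => formMatrix (w y) i j) x := by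
  have := contMDiffAt_altCoeff hw ![i, j]
  refine this.congr_of_eventuallyEq (Filter.Eventually.of_forall fun y => ?_)
  change w y _ = w y _
  congr 1
  ext p : 1
  fin_cases p <;> rfl

theorem contMDiffAt_det {ι : Type*} [Fintype ι] [DecidableEq ι] {W : X → Matrix ι ι ℝ}
    (hW : ∀ i j, ContMDiffAt J 𝓘(ℝ, ℝ) ∞ (fun y => W y i j) x) :
    ContMDiffAt J 𝓘(ℝ, ℝ) ∞ (fun y => (W y).det) x := by
  simp only [Matrix.det_apply']
  refine contMDiffAt_finsetSum fun σ _ => ?_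
  exact contMDiffAt_const.mul (contMDiffAt_finsetProd fun p _ => hW _ _)

theorem contMDiffAt_inv {ι : Type*} [Fintype ι] [DecidableEq ι] {W : X → Matrix ι ι ℝ}
    (hW : ∀ i j, ContMDiffAt J 𝓘(ℝ, ℝ) ∞ (fun y => W y i j) x) (hx : IsUnit (W x).det)
    (i j : ι) : ContMDiffAt J 𝓘(ℝ, ℝ) ∞ (fun y => (W y)⁻¹ i j) x := by
  simp only [Matrix.inv_def, Matrix.smul_apply, smul_eq_mul, Ring.inverse_eq_inv',
    Matrix.adjugate_apply]
  refine ContMDiffAt.mul ((contMDiffAt_det hW).inv₀ hx.ne_zero) (contMDiffAt_det fun p q => ?_)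
  by_cases hp : p = j
  · subst hp
    simpa using contMDiffAt_const
  · simpa [Matrix.updateRow_ne hp] using hW p q

theorem contMDiffAt_ptL {k : ℕ} {w : X → Alt n 2} {f : X → Alt n k}
    (hw : ContMDiffAt J 𝓘(ℝ, Alt n 2) ∞ w x) (hf : ContMDiffAt J 𝓘(ℝ, Alt n k) ∞ f x) :
    ContMDiffAt J 𝓘(ℝ, Alt n (k + 2)) ∞ (fun y => ptL (w y) k (f y)) x := by
  have h : ContMDiffAt J 𝓘(ℝ, Alt n (k + 2)) ∞ (fun y => ∑ i, ∑ j, formMatrix (w y) i j •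
      (covWedge (k + 1) (basisCovec i) ∘ₗ covWedge k (basisCovec j)) (f y)) x := by
    refine contMDiffAt_finsetSum fun i _ => contMDiffAt_finsetSum fun j _ => ?_
    exact (contMDiffAt_formMatrix hw i j).smul (ContMDiffAt.linearMap_comp _ hf)
  refine (ContMDiffAt.linearMap_comp
    ((2⁻¹ : ℝ) • (LinearMap.id : Alt n (k + 2) →ₗ[ℝ] Alt n (k + 2))) h).congr_of_eventuallyEq
    (Filter.Eventually.of_forall fun y => ?_)
  simp only [ptL, LinearMap.smul_apply, LinearMap.sum_apply, LinearMap.id_apply]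

theorem contMDiffAt_ptLam {k : ℕ} {w : X → Alt n 2} {f : X → Alt n (k + 2)}
    (hw : ContMDiffAt J 𝓘(ℝ, Alt n 2) ∞ w x) (hx : IsUnit (formMatrix (w x)).det)
    (hf : ContMDiffAt J 𝓘(ℝ, Alt n (k + 2)) ∞ f x) :
    ContMDiffAt J 𝓘(ℝ, Alt n k) ∞ (fun y => ptLam (w y) k (f y)) x := by
  have h : ContMDiffAt J 𝓘(ℝ, Alt n k) ∞ (fun y => ∑ i, ∑ j, (formMatrix (w y))⁻¹ i j •
      (interior k (basisVec i) ∘ₗ interior (k + 1) (basisVec j)) (f y)) x := by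
    refine contMDiffAt_finsetSum fun i _ => contMDiffAt_finsetSum fun j _ => ?_
    exact (contMDiffAt_inv (contMDiffAt_formMatrix hw) hx i j).smul
      (ContMDiffAt.linearMap_comp _ hf)
  refine (ContMDiffAt.linearMap_comp
    ((2⁻¹ : ℝ) • (LinearMap.id : Alt n k →ₗ[ℝ] Alt n k)) h).congr_of_eventuallyEq
    (Filter.Eventually.of_forall fun y => ?_)
  simp only [ptLam, LinearMap.smul_apply, LinearMap.sum_apply, LinearMap.id_apply]

end AltEval

/-! ### Forms in local coordinates -/

section LocalCoordinates

open Bundle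

variable {n : ℕ} [NeZero n] {M : Type*} [TopologicalSpace M]
  [ChartedSpace (EuclideanHalfSpace (2 * n)) M] [IsManifold (𝓡∂ (2 * n)) ∞ M]

/-- The coordinate frame of the preferred chart at `x₀`, at the point `x`: the linear isomorphism
from the model space to the tangent space at `x` (junk outside of the chart domain). -/
def frameAt (x₀ x : M) : Model n →L[ℝ] Model n :=
  (trivializationAt (Model n) (TangentSpace (𝓡∂ (2 * n))) x₀).symmL ℝ x

/-- The inverse of `frameAt`. -/
def coframeAt (x₀ x : M) : Model n →L[ℝ] Model n :=
  (trivializationAt (Model n) (TangentSpace (𝓡∂ (2 * n))) x₀).continuousLinearMapAt ℝ x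

/-- The coefficients of a form in the preferred chart at `x₀`, as a function on the manifold. -/
def coordRep (x₀ : M) {k : ℕ} (η : Form n M k) (x : M) : Alt n k := pull (frameAt x₀ x) k (η x)

/-- Smoothness of a form at a point. -/
def IsSmoothAt {k : ℕ} (η : Form n M k) (x : M) : Prop :=
  ContMDiffAt (𝓡∂ (2 * n)) ((𝓡∂ (2 * n)).prod 𝓘(ℝ, Alt n k)) ∞
    (fun x => Bundle.TotalSpace.mk' (Alt n k)
      (E := fun x : M => (TangentSpace (𝓡∂ (2 * n)) x) [⋀^Fin k]→L[ℝ] (Bundle.Trivial M ℝ x))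
      x (η x)) x

theorem coframeAt_frameAt {x₀ x : M} (hx : x ∈ (chartAt (EuclideanHalfSpace (2 * n)) x₀).source)
    (v : Model n) : coframeAt x₀ x (frameAt x₀ x v) = v :=
  (trivializationAt (Model n) (TangentSpace (𝓡∂ (2 * n))) x₀).continuousLinearMapAt_symmL hx v

theorem frameAt_coframeAt {x₀ x : M} (hx : x ∈ (chartAt (EuclideanHalfSpace (2 * n)) x₀).source)
    (v : Model n) : frameAt x₀ x (coframeAt x₀ x v) = v :=
  (trivializationAt (Model n) (TangentSpace (𝓡∂ (2 * n))) x₀).symmL_continuousLinearMapAt hx v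

/-- `frameAt` as a linear equivalence. -/
def frameEquiv {x₀ x : M} (hx : x ∈ (chartAt (EuclideanHalfSpace (2 * n)) x₀).source) :
    Model n ≃L[ℝ] Model n :=
  ContinuousLinearEquiv.equivOfInverse (frameAt x₀ x) (coframeAt x₀ x)
    (coframeAt_frameAt hx) (frameAt_coframeAt hx)

/-- The tangent space at `x` is the model space by way of the chart at `x`. -/
theorem frameAt_self (x : M) : frameAt x x = ContinuousLinearMap.id ℝ (Model n) := by
  have h := TangentBundle.symmL_trivializationAt (𝕜 := ℝ) (I := 𝓡∂ (2 * n))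
    (mem_chart_source (EuclideanHalfSpace (2 * n)) x)
  rw [mfderivWithin_range_extChartAt_symm] at h
  exact h

theorem coordRep_self {k : ℕ} (η : Form n M k) (x : M) : coordRep x η x = η x := by
  rw [coordRep, frameAt_self]
  exact pull_id (n := n) (η x)

/-- The change of frames between two charts. -/
theorem contMDiffAt_coframeAt_comp_frameAt {x₀ x₁ x : M}
    (h₀ : x ∈ (chartAt (EuclideanHalfSpace (2 * n)) x₀).source)
    (h₁ : x ∈ (chartAt (EuclideanHalfSpace (2 * n)) x₁).source) :
    ContMDiffAt (𝓡∂ (2 * n)) 𝓘(ℝ, Model n →L[ℝ] Model n) ∞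
      (fun y => (coframeAt (n := n) x₁ y).comp (frameAt (n := n) x₀ y)) x := by
  have h := contMDiffAt_coordChangeL (IB := 𝓡∂ (2 * n)) (n := ∞)
    (E := TangentSpace (M := M) (𝓡∂ (2 * n)))
    (e := trivializationAt (Model n) (TangentSpace (M := M) (𝓡∂ (2 * n))) x₀)
    (e' := trivializationAt (Model n) (TangentSpace (M := M) (𝓡∂ (2 * n))) x₁) (x := x) h₀ h₁
  refine h.congr_of_eventuallyEq ?_
  filter_upwards [(chartAt (EuclideanHalfSpace (2 * n)) x₀).open_source.mem_nhds h₀,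
    (chartAt (EuclideanHalfSpace (2 * n)) x₁).open_source.mem_nhds h₁] with y hy₀ hy₁
  ext1 v
  change (trivializationAt (Model n) (TangentSpace (𝓡∂ (2 * n))) x₁).continuousLinearMapAt ℝ y
    ((trivializationAt (Model n) (TangentSpace (𝓡∂ (2 * n))) x₀).symmL ℝ y v) = _
  change _ = (Bundle.Trivialization.coordChangeL ℝ _ _ y) v
  rw [Bundle.Trivialization.coordChangeL_apply _ _ ⟨hy₀, hy₁⟩]
  rw [Bundle.Trivialization.symmL_apply _ hy₀]
  exact Bundle.Trivialization.continuousLinearMapAt_apply_of_mem ℝ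
    (trivializationAt (Model n) (TangentSpace (M := M) (𝓡∂ (2 * n))) x₁) hy₁ _

theorem coordRep_change {x₀ x₁ x : M}
    (h₁ : x ∈ (chartAt (EuclideanHalfSpace (2 * n)) x₁).source) {k : ℕ} (η : Form n M k) :
    coordRep x₀ η x =
      pull ((coframeAt (n := n) x₁ x).comp (frameAt (n := n) x₀ x)) k (coordRep x₁ η x) := by
  ext v
  change η x _ = η x (fun p => frameAt x₁ x (coframeAt x₁ x (frameAt x₀ x (v p))))
  simp_rw [frameAt_coframeAt h₁]
  rfl

theorem isSmoothAt_iff_self {k : ℕ} {η : Form n M k} {x : M} :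
    IsSmoothAt η x ↔ ContMDiffAt (𝓡∂ (2 * n)) 𝓘(ℝ, Alt n k) ∞ (coordRep x η) x := by
  rw [IsSmoothAt, Bundle.contMDiffAt_section]
  refine Filter.EventuallyEq.contMDiffAt_iff (Filter.Eventually.of_forall fun y => ?_)
  change ContinuousAlternatingMap.inCoordinates (E₁ := TangentSpace (M := M) (𝓡∂ (2 * n)))
    (E₂ := Bundle.Trivial M ℝ) (Model n) ℝ x y x y (η y) = _
  ext v
  simp [ContinuousAlternatingMap.inCoordinates]
  rfl

theorem contMDiffAt_coordRep_change {x₀ x₁ x : M}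
    (h₀ : x ∈ (chartAt (EuclideanHalfSpace (2 * n)) x₀).source)
    (h₁ : x ∈ (chartAt (EuclideanHalfSpace (2 * n)) x₁).source) {k : ℕ} {η : Form n M k}
    (h : ContMDiffAt (𝓡∂ (2 * n)) 𝓘(ℝ, Alt n k) ∞ (coordRep x₁ η) x) :
    ContMDiffAt (𝓡∂ (2 * n)) 𝓘(ℝ, Alt n k) ∞ (coordRep x₀ η) x := by
  refine (contMDiffAt_pull (contMDiffAt_coframeAt_comp_frameAt h₀ h₁) h).congr_of_eventuallyEq ?_
  filter_upwards [(chartAt (EuclideanHalfSpace (2 * n)) x₁).open_source.mem_nhds h₁] with y hy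
  exact coordRep_change hy η

/-- Smoothness of a form can be read off in any chart. -/
theorem isSmoothAt_iff {k : ℕ} {η : Form n M k} {x₀ x : M}
    (hx : x ∈ (chartAt (EuclideanHalfSpace (2 * n)) x₀).source) :
    IsSmoothAt η x ↔ ContMDiffAt (𝓡∂ (2 * n)) 𝓘(ℝ, Alt n k) ∞ (coordRep x₀ η) x := by
  rw [isSmoothAt_iff_self]
  exact ⟨contMDiffAt_coordRep_change hx (mem_chart_source _ x),
    contMDiffAt_coordRep_change (mem_chart_source _ x) hx⟩

/-- The forms that are smooth at every point of `U`. They are defined on all of `M`, with arbitrary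
values outside of `U`. -/
def smoothForms (U : Set M) (k : ℕ) : Submodule ℝ (Form n M k) where
  carrier := {η | ∀ x ∈ U, IsSmoothAt η x}
  add_mem' {η ξ} hη hξ x hx := by
    rw [isSmoothAt_iff_self]
    have := (isSmoothAt_iff_self.1 (hη x hx)).add (isSmoothAt_iff_self.1 (hξ x hx))
    exact this.congr_of_eventuallyEq (Filter.Eventually.of_forall fun y => map_add _ _ _)
  zero_mem' x _ := by
    rw [isSmoothAt_iff_self]
    exact contMDiffAt_const.congr_of_eventuallyEq (Filter.Eventually.of_forall fun y => map_zero _)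
  smul_mem' c η hη x hx := by
    rw [isSmoothAt_iff_self]
    have := ContMDiffAt.linearMap_comp (c • LinearMap.id : Alt n k →ₗ[ℝ] Alt n k)
      (isSmoothAt_iff_self.1 (hη x hx))
    exact this.congr_of_eventuallyEq
      (Filter.Eventually.of_forall fun y => map_smul (pull (frameAt x y) k) c (η y))

theorem coordRep_lef {om : Form n M 2} (x₀ x : M) {k : ℕ} (η : Form n M k) :
    coordRep x₀ (lef om k η) x = ptL (coordRep x₀ om x) k (coordRep x₀ η x) :=
  pull_ptL _ _ _

theorem coordRep_dualLef {om : Form n M 2} {x₀ x : M}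
    (hx : x ∈ (chartAt (EuclideanHalfSpace (2 * n)) x₀).source) {k : ℕ} (η : Form n M (k + 2)) :
    coordRep x₀ (dualLef om k η) x = ptLam (coordRep x₀ om x) k (coordRep x₀ η x) :=
  pull_ptLam (frameEquiv hx) _ _

variable {om : Form n M 2} (hom : IsSymplectic om)
include hom

theorem IsSymplectic.isUnit_det (x : M) : IsUnit (formMatrix (n := n) (om x)).det :=
  isUnit_det_formMatrix (hom.nondegenerate x)

theorem IsSmoothAt.lef {x : M} {k : ℕ} {η : Form n M k} (hη : IsSmoothAt η x) :
    IsSmoothAt (lef om k η) x := by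
  rw [isSmoothAt_iff_self] at hη ⊢
  refine (contMDiffAt_ptL (isSmoothAt_iff_self.1 (hom.smooth x)) hη).congr_of_eventuallyEq
    (Filter.Eventually.of_forall fun y => ?_)
  exact coordRep_lef x y η

theorem IsSmoothAt.dualLef {x : M} {k : ℕ} {η : Form n M (k + 2)} (hη : IsSmoothAt η x) :
    IsSmoothAt (dualLef om k η) x := by
  rw [isSmoothAt_iff_self] at hη ⊢
  refine (contMDiffAt_ptLam (isSmoothAt_iff_self.1 (hom.smooth x)) ?_ hη).congr_of_eventuallyEq ?_
  · rw [coordRep_self]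
    exact hom.isUnit_det x
  · filter_upwards [(chartAt (EuclideanHalfSpace (2 * n)) x).open_source.mem_nhds
      (mem_chart_source _ x)] with y hy
    exact coordRep_dualLef hy η

/-- Smooth forms with the operators `L` and `Λ` are a Lefschetz pair. Hence the decompositions and
inverses provided by Lefschetz theory stay within smooth forms. -/
theorem isLefschetzPair_smoothForms (U : Set M) :
    IsLefschetzPair n (V := fun k => smoothForms (n := n) U k)
      (fun k => (lef om k).restrict (p := smoothForms U k) (q := smoothForms U (k + 2))
        fun _ hη x hx => (hη x hx).lef hom)
      (fun k => (dualLef om k).restrict (p := smoothForms U (k + 2)) (q := smoothForms U k)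
        fun _ hη x hx => (hη x hx).dualLef hom) where
  comm_zero η := Subtype.ext <| funext fun x =>
    (isLefschetzPair_pt (hom.isUnit_det x)).comm_zero (η.1 x)
  comm_one η := Subtype.ext <| funext fun x =>
    (isLefschetzPair_pt (hom.isUnit_det x)).comm_one (η.1 x)
  comm k η := Subtype.ext <| funext fun x =>
    (isLefschetzPair_pt (hom.isUnit_det x)).comm k (η.1 x)
  vanish _ hk η := Subtype.ext <| funext fun x => alt_eq_zero_of_lt hk (η.1 x)

end LocalCoordinates

/-! ### The exterior derivative in local coordinates -/

section ExteriorDerivative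

variable {n : ℕ} [NeZero n] {M : Type*} [TopologicalSpace M]
  [ChartedSpace (EuclideanHalfSpace (2 * n)) M] [IsManifold (𝓡∂ (2 * n)) ∞ M]

theorem frameAt_eq_tangentCoordChange {x₀ x : M}
    (hx : x ∈ (chartAt (EuclideanHalfSpace (2 * n)) x₀).source) :
    frameAt x₀ x = tangentCoordChange (𝓡∂ (2 * n)) x₀ x x :=
  TangentBundle.symmL_trivializationAt_eq_core hx

omit [IsManifold (𝓡∂ (2 * n)) ∞ M] in
theorem mem_extChartAt_source_of {x₀ x : M}
    (hx : x ∈ (chartAt (EuclideanHalfSpace (2 * n)) x₀).source) :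
    x ∈ (extChartAt (𝓡∂ (2 * n)) x₀).source := by
  rwa [extChartAt_source]

theorem inChart_eq_coordRep (x₀ : M) {k : ℕ} (η : Form n M k) {z : Model n}
    (hz : z ∈ (extChartAt (𝓡∂ (2 * n)) x₀).target) :
    inChart x₀ η z = coordRep x₀ η ((extChartAt (𝓡∂ (2 * n)) x₀).symm z) := by
  have hs := (extChartAt (𝓡∂ (2 * n)) x₀).map_target hz
  rw [extChartAt_source] at hs
  have h := TangentBundle.symmL_trivializationAt (𝕜 := ℝ) (I := 𝓡∂ (2 * n)) hs
  rw [(extChartAt (𝓡∂ (2 * n)) x₀).right_inv hz] at h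
  unfold inChart
  rw [← h]
  rfl

theorem inChart_apply_extChartAt {x₀ x : M} {k : ℕ} (η : Form n M k)
    (hx : x ∈ (chartAt (EuclideanHalfSpace (2 * n)) x₀).source) :
    inChart x₀ η (extChartAt (𝓡∂ (2 * n)) x₀ x) = coordRep x₀ η x := by
  rw [inChart_eq_coordRep x₀ η
    ((extChartAt (𝓡∂ (2 * n)) x₀).map_source (mem_extChartAt_source_of hx)),
    (extChartAt (𝓡∂ (2 * n)) x₀).left_inv (mem_extChartAt_source_of hx)]

omit [IsManifold (𝓡∂ (2 * n)) ∞ M] in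
theorem extChartAt_target_mem {x₀ x : M}
    (hx : x ∈ (chartAt (EuclideanHalfSpace (2 * n)) x₀).source) :
    (extChartAt (𝓡∂ (2 * n)) x₀).target ∈
      𝓝[Set.range (𝓡∂ (2 * n))] (extChartAt (𝓡∂ (2 * n)) x₀ x) :=
  extChartAt_target_mem_nhdsWithin_of_mem
    ((extChartAt (𝓡∂ (2 * n)) x₀).map_source (mem_extChartAt_source_of hx))

/-- A smooth function in local coordinates. -/
theorem contDiffWithinAt_comp_symm {F : Type*} [NormedAddCommGroup F] [NormedSpace ℝ F]
    {x₀ x : M} (hx : x ∈ (chartAt (EuclideanHalfSpace (2 * n)) x₀).source) {f : M → F}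
    (hf : ContMDiffAt (𝓡∂ (2 * n)) 𝓘(ℝ, F) ∞ f x) :
    ContDiffWithinAt ℝ ∞ (f ∘ (extChartAt (𝓡∂ (2 * n)) x₀).symm) (Set.range (𝓡∂ (2 * n)))
      (extChartAt (𝓡∂ (2 * n)) x₀ x) :=
  contMDiffWithinAt_iff_contDiffWithinAt.1 ((contMDiffAt_iff_source_of_mem_source hx).1 hf)

theorem IsSmoothAt.contDiffWithinAt_inChart {x₀ x : M}
    (hx : x ∈ (chartAt (EuclideanHalfSpace (2 * n)) x₀).source) {k : ℕ} {η : Form n M k}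
    (hη : IsSmoothAt η x) :
    ContDiffWithinAt ℝ ∞ (inChart x₀ η) (Set.range (𝓡∂ (2 * n)))
      (extChartAt (𝓡∂ (2 * n)) x₀ x) := by
  refine (contDiffWithinAt_comp_symm hx ((isSmoothAt_iff hx).1 hη)).congr_of_eventuallyEq ?_ ?_
  · filter_upwards [extChartAt_target_mem hx] with z hz
    exact inChart_eq_coordRep x₀ η hz
  · exact inChart_eq_coordRep x₀ η
      ((extChartAt (𝓡∂ (2 * n)) x₀).map_source (mem_extChartAt_source_of hx))

theorem coordRep_tangentCoordChange {x₀ x₁ x : M}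
    (h₀ : x ∈ (chartAt (EuclideanHalfSpace (2 * n)) x₀).source)
    (h₁ : x ∈ (chartAt (EuclideanHalfSpace (2 * n)) x₁).source) {k : ℕ} (η : Form n M k) :
    coordRep x₀ η x = pull (tangentCoordChange (𝓡∂ (2 * n)) x₀ x₁ x) k (coordRep x₁ η x) := by
  ext v
  change η x (fun p => frameAt x₀ x (v p)) =
    η x (fun p => frameAt x₁ x (tangentCoordChange (𝓡∂ (2 * n)) x₀ x₁ x (v p)))
  congr 1
  funext p
  rw [frameAt_eq_tangentCoordChange h₀, frameAt_eq_tangentCoordChange h₁]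
  exact (tangentCoordChange_comp ⟨⟨mem_extChartAt_source_of h₀, mem_extChartAt_source_of h₁⟩,
    mem_extChartAt_source x⟩).symm

theorem extD_apply {k : ℕ} (η : Form n M k) (x : M) :
    extD η x = extDerivWithin (inChart x η) (Set.range (𝓡∂ (2 * n)))
      (extChartAt (𝓡∂ (2 * n)) x x) := by
  unfold extD
  have h : mfderiv (𝓡∂ (2 * n)) 𝓘(ℝ, Model n) (extChartAt (𝓡∂ (2 * n)) x) x =
    ContinuousLinearMap.id ℝ (Model n) := mfderiv_extChartAt_self (I := 𝓡∂ (2 * n))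
  exact (congrArg (fun A : Model n →L[ℝ] Model n => pull A (k + 1) (extDerivWithin (inChart x η)
    (Set.range (𝓡∂ (2 * n))) (extChartAt (𝓡∂ (2 * n)) x x))) h).trans (pull_id (n := n) _)

theorem range_subset_closure_interior :
    Set.range (𝓡∂ (2 * n)) ⊆ closure (_root_.interior (Set.range (𝓡∂ (2 * n)))) :=
  (𝓡∂ (2 * n)).range_subset_closure_interior

/-- The exterior derivative can be computed in any chart, since it commutes with pullback by the
transition maps. -/
theorem coordRep_extD {x₀ x : M} (hx : x ∈ (chartAt (EuclideanHalfSpace (2 * n)) x₀).source)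
    {k : ℕ} {η : Form n M k} (hη : IsSmoothAt η x) :
    coordRep x₀ (extD η) x = extDerivWithin (inChart x₀ η) (Set.range (𝓡∂ (2 * n)))
      (extChartAt (𝓡∂ (2 * n)) x₀ x) := by
  have hself := mem_chart_source (EuclideanHalfSpace (2 * n)) x
  set φ₀ := extChartAt (𝓡∂ (2 * n)) x₀ with hφ₀
  set φ := extChartAt (𝓡∂ (2 * n)) x with hφ
  set S := Set.range (𝓡∂ (2 * n)) with hS
  have hleft : φ₀.symm (φ₀ x) = x := φ₀.left_inv (mem_extChartAt_source_of hx)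
  have hmem : φ₀ x ∈ S := ⟨_, rfl⟩
  have hτ : ContDiffWithinAt ℝ ∞ (φ ∘ φ₀.symm) S (φ₀ x) :=
    contDiffWithinAt_comp_symm hx contMDiffAt_extChartAt
  -- Near `x` the representatives in the two charts differ by pullback along the transition map.
  have hev : inChart x₀ η =ᶠ[𝓝[S] (φ₀ x)] fun z =>
      (inChart x η ((φ ∘ φ₀.symm) z)).compContinuousLinearMap
        (fderivWithin ℝ (φ ∘ φ₀.symm) S z) := by
    have h1 : φ₀.symm ⁻¹' (chartAt (EuclideanHalfSpace (2 * n)) x).source ∈ 𝓝[S] (φ₀ x) := by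
      refine mem_nhdsWithin_of_mem_nhds
        ((continuousAt_extChartAt_symm' (mem_extChartAt_source_of hx)).preimage_mem_nhds ?_)
      rw [hleft]
      exact (chartAt (EuclideanHalfSpace (2 * n)) x).open_source.mem_nhds hself
    filter_upwards [extChartAt_target_mem hx, h1] with z hz hz'
    have hz0 : φ₀.symm z ∈ (chartAt (EuclideanHalfSpace (2 * n)) x₀).source := by
      have := φ₀.map_target hz
      rwa [hφ₀, extChartAt_source] at this
    rw [inChart_eq_coordRep x₀ η hz, coordRep_tangentCoordChange hz0 hz' η, tangentCoordChange_def,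
      ← hφ₀, ← hφ, φ₀.right_inv hz]
    change _ = pull _ k (inChart x η (φ (φ₀.symm z)))
    rw [inChart_apply_extChartAt η hz']
  rw [hev.extDerivWithin_eq_of_mem hmem]
  have hd : DifferentiableWithinAt ℝ (inChart x η) S ((φ ∘ φ₀.symm) (φ₀ x)) := by
    rw [Function.comp_apply, hleft]
    exact (hη.contDiffWithinAt_inChart hself).differentiableWithinAt (by simp)
  rw [extDerivWithin_pullback (r := ∞) hd hτ (by
      rw [minSmoothness_of_isRCLikeNormedField]
      exact WithTop.coe_le_coe.2 (le_top (a := (2 : ℕ∞))))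
    (𝓡∂ (2 * n)).uniqueDiffOn (range_subset_closure_interior hmem) hmem
    (fun z _ => ⟨_, rfl⟩), Function.comp_apply, hleft]
  have h3 : fderivWithin ℝ (φ ∘ φ₀.symm) S (φ₀ x) = frameAt x₀ x := by
    rw [frameAt_eq_tangentCoordChange hx, tangentCoordChange_def]
  rw [h3]
  exact congrArg (pull (frameAt x₀ x) (k + 1)) (extD_apply η x)

end ExteriorDerivative

section ExteriorDerivative

variable {n : ℕ} [NeZero n] {M : Type*} [TopologicalSpace M]
  [ChartedSpace (EuclideanHalfSpace (2 * n)) M] [IsManifold (𝓡∂ (2 * n)) ∞ M]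

theorem IsSmoothAt.add {k : ℕ} {η ξ : Form n M k} {x : M} (hη : IsSmoothAt η x)
    (hξ : IsSmoothAt ξ x) : IsSmoothAt (η + ξ) x :=
  (smoothForms {x} k).add_mem (x := η) (y := ξ) (fun _ h => h ▸ hη) (fun _ h => h ▸ hξ) x rfl

theorem IsSmoothAt.const_smul {k : ℕ} {η : Form n M k} {x : M} (c : ℝ) (hη : IsSmoothAt η x) :
    IsSmoothAt (c • η) x :=
  (smoothForms {x} k).smul_mem (x := η) c (fun _ h => h ▸ hη) x rfl

theorem IsSmoothAt.smul {k : ℕ} {η : Form n M k} {x : M} {f : M → ℝ}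
    (hf : ContMDiffAt (𝓡∂ (2 * n)) 𝓘(ℝ, ℝ) ∞ f x) (hη : IsSmoothAt η x) :
    IsSmoothAt (fun y => f y • η y) x := by
  rw [isSmoothAt_iff_self] at hη ⊢
  refine (hf.smul hη).congr_of_eventuallyEq (Filter.Eventually.of_forall fun y => ?_)
  exact map_smul (pull (frameAt x y) k) (f y) (η y)

theorem extD_congr {k : ℕ} {η ξ : Form n M k} {x : M} (h : ∀ᶠ y in 𝓝 x, ξ y = η y) :
    extD ξ x = extD η x := by
  rw [extD_apply, extD_apply]
  refine Filter.EventuallyEq.extDerivWithin_eq_of_mem ?_ ⟨_, rfl⟩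
  have h1 : (extChartAt (𝓡∂ (2 * n)) x).symm ⁻¹' {y | ξ y = η y} ∈
      𝓝[Set.range (𝓡∂ (2 * n))] (extChartAt (𝓡∂ (2 * n)) x x) := by
    refine mem_nhdsWithin_of_mem_nhds ((continuousAt_extChartAt_symm x).preimage_mem_nhds ?_)
    rw [extChartAt_to_inv]
    exact h
  filter_upwards [h1] with z hz
  exact congrArg (pull (mfderivWithin 𝓘(ℝ, Model n) (𝓡∂ (2 * n)) (extChartAt (𝓡∂ (2 * n)) x).symm
      (Set.range (𝓡∂ (2 * n))) z) k) hz

theorem extDerivWithin_fun_smul_covWedge {n k : ℕ} {S : Set (Model n)} {p : Model n}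
    {r : Model n → ℝ} {h : Model n → Alt n k} (hS : UniqueDiffWithinAt ℝ S p)
    (hr : DifferentiableWithinAt ℝ r S p) (hh : DifferentiableWithinAt ℝ h S p) :
    extDerivWithin (fun z => r z • h z) S p =
      covWedge k (fderivWithin ℝ r S p) (h p) + r p • extDerivWithin h S p := by
  rw [extDerivWithin, fderivWithin_fun_smul hS hr hh,
    ContinuousAlternatingMap.alternatizeUncurryFin_add,
    ContinuousAlternatingMap.alternatizeUncurryFin_smul]
  exact add_comm _ _

/-- The Leibniz rule `d(f η) = df ∧ η + f dη`. -/
theorem extD_smul {k : ℕ} {η : Form n M k} {x : M} {f : M → ℝ}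
    (hf : MDifferentiableAt (𝓡∂ (2 * n)) 𝓘(ℝ, ℝ) f x) (hη : IsSmoothAt η x) :
    extD (fun y => f y • η y) x - f x • extD η x =
      covWedge k (mfderiv (𝓡∂ (2 * n)) 𝓘(ℝ, ℝ) f x) (η x) := by
  rw [extD_apply, extD_apply]
  have hmem : extChartAt (𝓡∂ (2 * n)) x x ∈ Set.range (𝓡∂ (2 * n)) := ⟨_, rfl⟩
  have hdf : DifferentiableWithinAt ℝ (f ∘ (extChartAt (𝓡∂ (2 * n)) x).symm)
      (Set.range (𝓡∂ (2 * n))) (extChartAt (𝓡∂ (2 * n)) x x) := by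
    simpa [writtenInExtChartAt, Function.comp_def] using!
      hf.differentiableWithinAt_writtenInExtChartAt
  have hdη := (hη.contDiffWithinAt_inChart (mem_chart_source _ x)).differentiableWithinAt
    (n := ∞) (by simp)
  have h1 : inChart x (fun y => f y • η y) =
      fun z => (f ∘ (extChartAt (𝓡∂ (2 * n)) x).symm) z • inChart x η z := rfl
  have h2 : mfderiv (𝓡∂ (2 * n)) 𝓘(ℝ, ℝ) f x =
      fderivWithin ℝ (f ∘ (extChartAt (𝓡∂ (2 * n)) x).symm) (Set.range (𝓡∂ (2 * n)))
        (extChartAt (𝓡∂ (2 * n)) x x) := by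
    rw [hf.mfderiv]
    rfl
  have h3 : inChart x η (extChartAt (𝓡∂ (2 * n)) x x) = η x :=
    (inChart_apply_extChartAt η (mem_chart_source _ x)).trans (coordRep_self η x)
  have h4 : (f ∘ (extChartAt (𝓡∂ (2 * n)) x).symm) (extChartAt (𝓡∂ (2 * n)) x x) = f x := by
    rw [Function.comp_apply, extChartAt_to_inv]
  have h5 := extDerivWithin_fun_smul_covWedge ((𝓡∂ (2 * n)).uniqueDiffOn _ hmem) hdf hdη
  rw [h4] at h5
  refine sub_eq_of_eq_add (h5.trans ?_)
  exact congrArg₂ (fun (a : Model n →L[ℝ] ℝ) (b : Alt n k) => covWedge k a b +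
    f x • extDerivWithin (inChart x η) (Set.range (𝓡∂ (2 * n))) (extChartAt (𝓡∂ (2 * n)) x x))
    h2.symm h3

/-- Smoothness on a neighbourhood is required, because `extD η` is computed in charts. -/
theorem IsSmoothAt.extD {k : ℕ} {η : Form n M k} {x : M} (hη : ∀ᶠ y in 𝓝 x, IsSmoothAt η y) :
    IsSmoothAt (extD η) x := by
  rw [isSmoothAt_iff_self, contMDiffAt_iff_source]
  have hmem : extChartAt (𝓡∂ (2 * n)) x x ∈ Set.range (𝓡∂ (2 * n)) := ⟨_, rfl⟩
  refine ContDiffWithinAt.contMDiffWithinAt ?_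
  have h1 : ContDiffWithinAt ℝ ∞ (extDerivWithin (inChart x η) (Set.range (𝓡∂ (2 * n))))
      (Set.range (𝓡∂ (2 * n))) (extChartAt (𝓡∂ (2 * n)) x x) := by
    have h2 := (hη.self_of_nhds.contDiffWithinAt_inChart (mem_chart_source _ x)).fderivWithin_right
      (m := ∞) (𝓡∂ (2 * n)).uniqueDiffOn (by simp) hmem
    exact (ContinuousAlternatingMap.alternatizeUncurryFinCLM ℝ (Model n) ℝ
      (n := k)).contDiff.contDiffAt.comp_contDiffWithinAt _ h2
  have h3 : (extChartAt (𝓡∂ (2 * n)) x).symm ⁻¹'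
      {y | IsSmoothAt η y ∧ y ∈ (chartAt (EuclideanHalfSpace (2 * n)) x).source} ∈
      𝓝[Set.range (𝓡∂ (2 * n))] (extChartAt (𝓡∂ (2 * n)) x x) := by
    refine mem_nhdsWithin_of_mem_nhds ((continuousAt_extChartAt_symm x).preimage_mem_nhds ?_)
    rw [extChartAt_to_inv]
    exact hη.and ((chartAt (EuclideanHalfSpace (2 * n)) x).open_source.mem_nhds
      (mem_chart_source _ x))
  refine h1.congr_of_eventuallyEq_of_mem ?_ hmem
  filter_upwards [h3, extChartAt_target_mem (mem_chart_source (EuclideanHalfSpace (2 * n)) x)]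
    with z hz hz'
  rw [Function.comp_apply, coordRep_extD hz.2 hz.1, (extChartAt (𝓡∂ (2 * n)) x).right_inv hz']

end ExteriorDerivative

/-! ### The boundary in local coordinates -/

section Boundary

variable {n : ℕ} [NeZero n] {M : Type*} [TopologicalSpace M]
  [ChartedSpace (EuclideanHalfSpace (2 * n)) M] [IsManifold (𝓡∂ (2 * n)) ∞ M]

theorem mem_interior_iff {x₀ x : M}
    (hx : x ∈ (chartAt (EuclideanHalfSpace (2 * n)) x₀).source) :
    x ∈ (𝓡∂ (2 * n)).interior M ↔ 0 < extChartAt (𝓡∂ (2 * n)) x₀ x 0 := by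
  have h := (𝓡∂ (2 * n)).isInteriorPoint_iff_of_mem_atlas (n := ∞) (by simp)
    (chart_mem_atlas (EuclideanHalfSpace (2 * n)) x₀) hx
  have h' : x ∈ (𝓡∂ (2 * n)).interior M ↔
      extChartAt (𝓡∂ (2 * n)) x₀ x ∈ _root_.interior (Set.range (𝓡∂ (2 * n))) :=
    h.trans ⟨fun hi => OpenPartialHomeomorph.interior_extend_target_subset_interior_range _ hi,
      fun hi => OpenPartialHomeomorph.mem_interior_extend_target _
        ((chartAt (EuclideanHalfSpace (2 * n)) x₀).map_source hx) hi⟩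
  rw [h', interior_range_modelWithCornersEuclideanHalfSpace]
  rfl

omit [IsManifold (𝓡∂ (2 * n)) ∞ M] in
theorem extChartAt_zero_nonneg (x₀ x : M) : 0 ≤ extChartAt (𝓡∂ (2 * n)) x₀ x 0 := by
  have h : extChartAt (𝓡∂ (2 * n)) x₀ x ∈ Set.range (𝓡∂ (2 * n)) := ⟨_, rfl⟩
  rw [range_modelWithCornersEuclideanHalfSpace] at h
  exact h

theorem mem_boundary_iff {x₀ x : M}
    (hx : x ∈ (chartAt (EuclideanHalfSpace (2 * n)) x₀).source) :
    x ∈ (𝓡∂ (2 * n)).boundary M ↔ extChartAt (𝓡∂ (2 * n)) x₀ x 0 = 0 := by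
  rw [← (𝓡∂ (2 * n)).compl_interior, Set.mem_compl_iff, mem_interior_iff hx, not_lt]
  exact ⟨fun h => le_antisymm h (extChartAt_zero_nonneg x₀ x), fun h => h.le⟩

end Boundary

section Boundary

variable {n : ℕ} [NeZero n] {M : Type*} [TopologicalSpace M]
  [ChartedSpace (EuclideanHalfSpace (2 * n)) M] [IsManifold (𝓡∂ (2 * n)) ∞ M]

/-- The differential of the first coordinate of a chart. -/
theorem hasMFDerivAt_extChartAt_zero {x₀ x : M}
    (hx : x ∈ (chartAt (EuclideanHalfSpace (2 * n)) x₀).source) :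
    HasMFDerivAt (𝓡∂ (2 * n)) 𝓘(ℝ, ℝ) (fun y => extChartAt (𝓡∂ (2 * n)) x₀ y 0) x
      ((basisCovec (n := n) 0).comp (coframeAt x₀ x)) := by
  have h := (mdifferentiableAt_extChartAt (I := 𝓡∂ (2 * n)) hx).hasMFDerivAt
  rw [← TangentBundle.continuousLinearMapAt_trivializationAt hx] at h
  exact (basisCovec (n := n) 0).hasMFDerivAt.comp x h

theorem isBoundaryDefiningAt_extChartAt_zero {x₀ x : M}
    (hx : x ∈ (chartAt (EuclideanHalfSpace (2 * n)) x₀).source) :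
    IsBoundaryDefiningAt (n := n) (fun y => extChartAt (𝓡∂ (2 * n)) x₀ y 0) x := by
  refine ⟨_, (chartAt (EuclideanHalfSpace (2 * n)) x₀).open_source.mem_nhds hx, ?_,
    fun y hy hi => (mem_interior_iff hy).1 hi, fun y hy hb => ⟨(mem_boundary_iff hy).1 hb, ?_⟩⟩
  · exact (basisCovec (n := n) 0).contMDiff.comp_contMDiffOn contMDiffOn_extChartAt
  · rw [(hasMFDerivAt_extChartAt_zero hy).mfderiv]
    intro h0
    have h1 := DFunLike.congr_fun h0 (frameAt x₀ y (basisVec 0))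
    have h2 : basisCovec (n := n) 0 (coframeAt x₀ y (frameAt x₀ y (basisVec 0))) = 0 := h1
    rw [coframeAt_frameAt hy] at h2
    simp [basisCovec, basisVec] at h2

/-- The differential of a boundary defining function is a nonzero multiple of `dx⁰`, in the
coordinates of the chart at the point. -/
theorem IsBoundaryDefiningAt.exists_mfderiv_eq {ρ : M → ℝ} {x : M}
    (hρ : IsBoundaryDefiningAt (n := n) ρ x) (hx : x ∈ (𝓡∂ (2 * n)).boundary M) :
    ∃ t : ℝ, t ≠ 0 ∧ mfderiv (𝓡∂ (2 * n)) 𝓘(ℝ, ℝ) ρ x = t • basisCovec (n := n) 0 := by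
  obtain ⟨U, hU, hsm, -, hbd⟩ := hρ
  have hd : MDifferentiableAt (𝓡∂ (2 * n)) 𝓘(ℝ, ℝ) ρ x :=
    (hsm.contMDiffAt hU).mdifferentiableAt (by simp)
  have hself := mem_chart_source (EuclideanHalfSpace (2 * n)) x
  set φ := extChartAt (𝓡∂ (2 * n)) x with hφ
  have hp : φ x 0 = 0 := (mem_boundary_iff hself).1 hx
  have hD : HasFDerivWithinAt (ρ ∘ φ.symm) (mfderiv (𝓡∂ (2 * n)) 𝓘(ℝ, ℝ) ρ x : Model n →L[ℝ] ℝ)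
      (Set.range (𝓡∂ (2 * n))) (φ x) := hd.hasMFDerivAt.2
  obtain ⟨A, hA⟩ : ∃ A : Model n →L[ℝ] ℝ, A = mfderiv (𝓡∂ (2 * n)) 𝓘(ℝ, ℝ) ρ x := ⟨_, rfl⟩
  have hA0 : A ≠ 0 := fun h0 => (hbd x (mem_of_mem_nhds hU) hx).2 (hA.symm.trans h0)
  rw [← hA] at hD
  -- `ρ` vanishes along curves in the boundary, so its differential kills tangential vectors.
  have htan : ∀ v : Model n, v 0 = 0 → A v = 0 := by
    intro v hv
    have hc : HasDerivAt (fun t : ℝ => φ x + t • v) v 0 := by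
      simpa using ((hasDerivAt_id (0 : ℝ)).smul_const v).const_add (φ x)
    have hc0 : φ x + (0 : ℝ) • v = φ x := by simp
    have hzero : ∀ t : ℝ, (φ x + t • v) 0 = 0 := fun t => by simp [hp, hv]
    have hrange : ∀ t : ℝ, φ x + t • v ∈ Set.range (𝓡∂ (2 * n)) := fun t => by
      rw [range_modelWithCornersEuclideanHalfSpace]
      exact (hzero t).ge
    have h1 := hD.comp_hasDerivAt_of_eq 0 hc (Filter.Eventually.of_forall hrange) hc0.symm
    have h2 : (ρ ∘ φ.symm) ∘ (fun t : ℝ => φ x + t • v) =ᶠ[𝓝 0] fun _ => 0 := by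
      have ht : Filter.Tendsto (fun t : ℝ => φ x + t • v) (𝓝 0)
          (𝓝[Set.range (𝓡∂ (2 * n))] (φ x)) := by
        refine tendsto_nhdsWithin_iff.2 ⟨?_, Filter.Eventually.of_forall hrange⟩
        have := hc.continuousAt.tendsto
        rwa [hc0] at this
      have hU' : φ.symm ⁻¹' U ∈ 𝓝[Set.range (𝓡∂ (2 * n))] (φ x) := by
        refine mem_nhdsWithin_of_mem_nhds ((continuousAt_extChartAt_symm x).preimage_mem_nhds ?_)
        rwa [extChartAt_to_inv]
      filter_upwards [ht hU', ht (extChartAt_target_mem hself)] with t htU htt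
      have hs : φ.symm (φ x + t • v) ∈ (chartAt (EuclideanHalfSpace (2 * n)) x).source := by
        have := φ.map_target htt
        rwa [hφ, extChartAt_source] at this
      refine (hbd _ htU ((mem_boundary_iff hs).2 ?_)).1
      rw [← hφ, φ.right_inv htt]
      exact hzero t
    exact h1.unique ((hasDerivAt_const _ _).congr_of_eventuallyEq h2)
  have heq : A = A (basisVec 0) • basisCovec (n := n) 0 := by
    ext v
    have h := htan (v - v 0 • basisVec 0) (by simp [basisVec])
    rw [map_sub, map_smul, sub_eq_zero] at h
    exact h.trans (mul_comm _ _)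
  refine ⟨A (basisVec 0), fun h0 => hA0 ?_, hA.symm.trans heq⟩
  rw [heq, h0, zero_smul]

/-- At boundary points the differentials of the first coordinates of two charts are
proportional. -/
theorem exists_basisCovec_comp_coframeAt {x₀ x : M}
    (hx : x ∈ (chartAt (EuclideanHalfSpace (2 * n)) x₀).source)
    (hb : x ∈ (𝓡∂ (2 * n)).boundary M) :
    ∃ t : ℝ, t ≠ 0 ∧ (basisCovec (n := n) 0).comp (coframeAt x₀ x) = t • basisCovec (n := n) 0 := by
  obtain ⟨t, ht, h⟩ := (isBoundaryDefiningAt_extChartAt_zero hx).exists_mfderiv_eq hb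
  exact ⟨t, ht, ((hasMFDerivAt_extChartAt_zero hx).mfderiv).symm.trans h⟩

end Boundary

/-! ### Principal symbols at the boundary -/

section Symbols

variable {n : ℕ} [NeZero n] {M : Type*} [TopologicalSpace M]
  [ChartedSpace (EuclideanHalfSpace (2 * n)) M] [IsManifold (𝓡∂ (2 * n)) ∞ M]

omit [IsManifold (𝓡∂ (2 * n)) ∞ M] in
theorem IsBoundaryDefiningAt.eventually_contMDiffAt {ρ : M → ℝ} {x : M}
    (hρ : IsBoundaryDefiningAt (n := n) ρ x) :
    ∀ᶠ y in 𝓝 x, ContMDiffAt (𝓡∂ (2 * n)) 𝓘(ℝ, ℝ) ∞ ρ y := by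
  obtain ⟨U, hU, hsm, -⟩ := hρ
  filter_upwards [eventually_mem_nhds_iff.2 hU] with y hy
  exact hsm.contMDiffAt hy

omit [IsManifold (𝓡∂ (2 * n)) ∞ M] in
theorem mfderiv_sub_const {ρ : M → ℝ} {x : M} (c : ℝ)
    (h : ContMDiffAt (𝓡∂ (2 * n)) 𝓘(ℝ, ℝ) ∞ ρ x) :
    mfderiv (𝓡∂ (2 * n)) 𝓘(ℝ, ℝ) (fun y => ρ y - c) x = mfderiv (𝓡∂ (2 * n)) 𝓘(ℝ, ℝ) ρ x := by
  have h1 := (h.mdifferentiableAt (by simp)).hasMFDerivAt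
  refine HasMFDerivAt.mfderiv ⟨h1.1.sub continuousAt_const, ?_⟩
  exact h1.2.sub_const c

/-- The principal symbol of the exterior derivative is exterior multiplication. -/
theorem symbol_extD {ρ : M → ℝ} {x : M} {k : ℕ} {η : Form n M k} (hη : IsSmoothAt η x)
    (hρ : ContMDiffAt (𝓡∂ (2 * n)) 𝓘(ℝ, ℝ) ∞ ρ x) :
    extD (fun y => (ρ y - ρ x) ^ 1 • η y) x =
      covWedge k (mfderiv (𝓡∂ (2 * n)) 𝓘(ℝ, ℝ) ρ x) (η x) := by
  have hd : ContMDiffAt (𝓡∂ (2 * n)) 𝓘(ℝ, ℝ) ∞ (fun y => ρ y - ρ x) x :=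
    hρ.sub contMDiffAt_const
  have h := extD_smul (hd.mdifferentiableAt (by simp)) hη
  simp only [sub_self, zero_smul, sub_zero] at h
  simp only [pow_one]
  exact h.trans (congrArg (fun a : Model n →L[ℝ] ℝ => covWedge k a (η x)) (mfderiv_sub_const _ hρ))

/-- The boundary condition of a first order operator `T ∘ d`. All boundary defining functions give
the same condition, since their differentials at a boundary point are proportional to `dx⁰`. -/
theorem symbolVanishes_one_iff {k l : ℕ} {P : Form n M k → Form n M l} {η : Form n M k}
    (T : (x : M) → Alt n (k + 1) →ₗ[ℝ] Alt n l) (hP : ∀ ξ x, P ξ x = T x (extD ξ x))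
    (hη : IsSmooth η) :
    SymbolVanishes 1 P η ↔
      ∀ x ∈ (𝓡∂ (2 * n)).boundary M, T x (covWedge k (basisCovec 0) (η x)) = 0 := by
  have key : ∀ x ∈ (𝓡∂ (2 * n)).boundary M, ∀ ρ : M → ℝ, IsBoundaryDefiningAt (n := n) ρ x →
      ∃ t : ℝ, t ≠ 0 ∧ symbol 1 P ρ η x = t • T x (covWedge k (basisCovec 0) (η x)) := by
    intro x hx ρ hρ
    obtain ⟨t, ht, h⟩ := hρ.exists_mfderiv_eq hx
    refine ⟨t, ht, ?_⟩
    have h1 : symbol 1 P ρ η x = P (fun y => (ρ y - ρ x) ^ 1 • η y) x := by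
      simp [symbol]
    rw [h1, hP, symbol_extD (hη x) hρ.eventually_contMDiffAt.self_of_nhds]
    have h2 : covWedge k (mfderiv (𝓡∂ (2 * n)) 𝓘(ℝ, ℝ) ρ x) (η x) =
        t • covWedge k (basisCovec 0) (η x) :=
      (congrArg (fun a : Model n →L[ℝ] ℝ => covWedge k a (η x)) h).trans (covWedge_smul_left _ _ _)
    exact (congrArg (T x) h2).trans (map_smul _ _ _)
  refine ⟨fun h x hx => ?_, fun h x hx ρ hρ => ?_⟩
  · have hρ := isBoundaryDefiningAt_extChartAt_zero
      (mem_chart_source (EuclideanHalfSpace (2 * n)) x)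
    obtain ⟨t, ht, h1⟩ := key x hx _ hρ
    exact (smul_eq_zero.1 (h1.symm.trans (h x hx _ hρ))).resolve_left ht
  · obtain ⟨t, -, h1⟩ := key x hx ρ hρ
    rw [h1, h x hx]
    exact smul_zero t

theorem bdryD_iff {k : ℕ} {η : Form n M k} (hη : IsSmooth η) :
    BdryD η ↔ ∀ x ∈ (𝓡∂ (2 * n)).boundary M, covWedge k (basisCovec 0) (η x) = 0 :=
  symbolVanishes_one_iff (P := extD) (fun _ => LinearMap.id) (fun _ _ => rfl) hη

theorem bdryDPlus_iff (om : Form n M 2) {k : ℕ} {η : Form n M k} (hη : IsSmooth η) :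
    BdryDPlus om η ↔ ∀ x ∈ (𝓡∂ (2 * n)).boundary M,
      ptProj (om x) (k + 1) (covWedge k (basisCovec 0) (η x)) = 0 :=
  symbolVanishes_one_iff (P := dPlus om) (fun x => ptProj (om x) (k + 1)) (fun _ _ => rfl) hη

theorem inv_sub_ne_zero {n k : ℕ} (hk : k + 1 ≤ n) : ((n : ℝ) - (k : ℝ))⁻¹ ≠ 0 := by
  have : (k : ℝ) + 1 ≤ n := mod_cast hk
  exact inv_ne_zero (by linarith)

theorem bdryDMinus_iff (om : Form n M 2) {k : ℕ} (hk : k + 1 ≤ n) {η : Form n M (k + 1)}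
    (hη : IsSmooth η) :
    BdryDMinus om η ↔ ∀ x ∈ (𝓡∂ (2 * n)).boundary M,
      ptLam (om x) k (covWedge (k + 1) (basisCovec 0) (η x)) = 0 := by
  refine (symbolVanishes_one_iff (P := dMinus om)
    (fun x => ((n : ℝ) - (k : ℝ))⁻¹ • ptLam (om x) k) (fun _ _ => rfl) hη).trans ?_
  simp only [LinearMap.smul_apply, smul_eq_zero, inv_sub_ne_zero hk, false_or]

variable {om : Form n M 2} (hom : IsSymplectic om)
include hom

/-- The principal symbol of `∂₊∂₋` is the product of the principal symbols. -/
theorem symbol_dPlus_dMinus {ρ : M → ℝ} {x : M} {k : ℕ} {η : Form n M (k + 1)}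
    (hη : IsSmooth η) (hρ : ∀ᶠ y in 𝓝 x, ContMDiffAt (𝓡∂ (2 * n)) 𝓘(ℝ, ℝ) ∞ ρ y) :
    dPlus om (dMinus om fun y => (ρ y - ρ x) ^ 2 • η y) x =
      (2 : ℝ) • ptProj (om x) (k + 1) (covWedge k (mfderiv (𝓡∂ (2 * n)) 𝓘(ℝ, ℝ) ρ x)
        (((n : ℝ) - (k : ℝ))⁻¹ • ptLam (om x) k
          (covWedge (k + 1) (mfderiv (𝓡∂ (2 * n)) 𝓘(ℝ, ℝ) ρ x) (η x)))) := by
  set f : M → ℝ := fun y => ρ y - ρ x with hf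
  have hfx : f x = 0 := sub_self _
  have hfs : ∀ᶠ y in 𝓝 x, ContMDiffAt (𝓡∂ (2 * n)) 𝓘(ℝ, ℝ) ∞ f y := by
    filter_upwards [hρ] with y hy
    exact hy.sub contMDiffAt_const
  have hfη : ∀ᶠ y in 𝓝 x, IsSmoothAt (fun z => f z • η z) y := by
    filter_upwards [hfs] with y hy
    exact IsSmoothAt.smul hy (hη y)
  -- `ζ` is `∂₋(f² η) / f`, by the Leibniz rule
  set ζ : Form n M k := ((n : ℝ) - (k : ℝ))⁻¹ • dualLef om k
    ((2 : ℝ) • extD (fun z => f z • η z) + (-1 : ℝ) • fun y => f y • extD η y) with hζ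
  have hdη : IsSmoothAt (extD η) x := IsSmoothAt.extD (Filter.Eventually.of_forall hη)
  have hζs : IsSmoothAt ζ x :=
    IsSmoothAt.const_smul _ (IsSmoothAt.dualLef hom (IsSmoothAt.add
      (IsSmoothAt.const_smul _ (IsSmoothAt.extD hfη))
      (IsSmoothAt.const_smul _ (hdη.smul hfs.self_of_nhds))))
  have h1 : ∀ᶠ y in 𝓝 x, dMinus om (fun y => f y ^ 2 • η y) y = f y • ζ y := by
    filter_upwards [hfs, hfη] with y hy hy'
    have h2 := extD_smul (hy.mdifferentiableAt (by simp)) hy'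
    have h3 := extD_smul (hy.mdifferentiableAt (by simp)) (hη y : IsSmoothAt η y)
    have h4 : extD (fun y => f y ^ 2 • η y) y = f y • ((2 : ℝ) • extD (fun z => f z • η z) y +
        (-1 : ℝ) • (f y • extD η y)) := by
      have h5 : (fun y => f y ^ 2 • η y : Form n M (k + 1)) = fun z => f z • (f z • η z) := by
        funext z
        rw [pow_two, mul_smul]
      have h6 : covWedge (k + 1) (mfderiv (𝓡∂ (2 * n)) 𝓘(ℝ, ℝ) f y) (f y • η y) =
        f y • covWedge (k + 1) (mfderiv (𝓡∂ (2 * n)) 𝓘(ℝ, ℝ) f y) (η y) := map_smul _ _ _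
      rw [h5]
      refine (eq_add_of_sub_eq h2).trans ((congrArg (· + f y • extD (fun z => f z • η z) y)
        (h6.trans (congrArg (f y • ·) h3.symm))).trans ?_)
      have h7 : ∀ (c : ℝ) (a b : Alt n (k + 2)),
          c • (a - c • b) + c • a = c • ((2 : ℝ) • a + (-1 : ℝ) • (c • b)) := by
        intro c a b
        module
      exact h7 _ _ _
    change ((n : ℝ) - (k : ℝ))⁻¹ • ptLam (om y) k (extD (fun y => f y ^ 2 • η y) y) =
      f y • (((n : ℝ) - (k : ℝ))⁻¹ • ptLam (om y) k ((2 : ℝ) • extD (fun z => f z • η z) y +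
        (-1 : ℝ) • (f y • extD η y)))
    rw [smul_comm (f y)]
    exact congrArg (((n : ℝ) - (k : ℝ))⁻¹ • ·) ((congrArg (ptLam (om y) k) h4).trans
      (map_smul _ _ _))
  have h2 := extD_congr h1
  have h3 := extD_smul (hfs.self_of_nhds.mdifferentiableAt (by simp)) hζs
  rw [hfx, zero_smul, sub_zero] at h3
  have h4 := extD_smul (hfs.self_of_nhds.mdifferentiableAt (by simp)) (hη x : IsSmoothAt η x)
  rw [hfx, zero_smul, sub_zero] at h4
  have hm : mfderiv (𝓡∂ (2 * n)) 𝓘(ℝ, ℝ) f x = mfderiv (𝓡∂ (2 * n)) 𝓘(ℝ, ℝ) ρ x :=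
    mfderiv_sub_const _ hρ.self_of_nhds
  have h5 : ζ x = (2 : ℝ) • (((n : ℝ) - (k : ℝ))⁻¹ • ptLam (om x) k
      (covWedge (k + 1) (mfderiv (𝓡∂ (2 * n)) 𝓘(ℝ, ℝ) ρ x) (η x))) := by
    change ((n : ℝ) - (k : ℝ))⁻¹ • ptLam (om x) k ((2 : ℝ) • extD (fun z => f z • η z) x +
        (-1 : ℝ) • (f x • extD η x)) = _
    rw [hfx, zero_smul, smul_zero, add_zero, smul_comm (2 : ℝ)]
    refine congrArg (((n : ℝ) - (k : ℝ))⁻¹ • ·) (((ptLam (om x) k).map_smul _ _).trans ?_)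
    refine congrArg ((2 : ℝ) • ptLam (om x) k ·) (h4.trans ?_)
    exact congrArg (fun a : Model n →L[ℝ] ℝ => covWedge (k + 1) a (η x)) hm
  change ptProj (om x) (k + 1) (extD (dMinus om fun y => f y ^ 2 • η y) x) = _
  have h6 : extD (dMinus om fun y => f y ^ 2 • η y) x =
      (2 : ℝ) • covWedge k (mfderiv (𝓡∂ (2 * n)) 𝓘(ℝ, ℝ) ρ x)
        (((n : ℝ) - (k : ℝ))⁻¹ • ptLam (om x) k
          (covWedge (k + 1) (mfderiv (𝓡∂ (2 * n)) 𝓘(ℝ, ℝ) ρ x) (η x))) :=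
    h2.trans (h3.trans ((congrArg₂ (fun (a : Model n →L[ℝ] ℝ) (b : Alt n k) => covWedge k a b)
      hm h5).trans (map_smul _ _ _)))
  exact (congrArg (ptProj (om x) (k + 1)) h6).trans (map_smul _ _ _)

theorem bdryDPlusMinus_iff {k : ℕ} {η : Form n M (k + 1)} (hη : IsSmooth η) :
    BdryDPlusMinus om η ↔ ∀ x ∈ (𝓡∂ (2 * n)).boundary M,
      ptProj (om x) (k + 1) (covWedge k (basisCovec 0) (((n : ℝ) - (k : ℝ))⁻¹ • ptLam (om x) k
          (covWedge (k + 1) (basisCovec 0) (η x)))) = 0 := by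
  have key : ∀ x ∈ (𝓡∂ (2 * n)).boundary M, ∀ ρ : M → ℝ, IsBoundaryDefiningAt (n := n) ρ x →
      ∃ t : ℝ, t ≠ 0 ∧ symbol 2 (fun ξ => dPlus om (dMinus om ξ)) ρ η x =
        t • ptProj (om x) (k + 1) (covWedge k (basisCovec 0) (((n : ℝ) - (k : ℝ))⁻¹ •
          ptLam (om x) k (covWedge (k + 1) (basisCovec 0) (η x)))) := by
    intro x hx ρ hρ
    obtain ⟨t, ht, h⟩ := hρ.exists_mfderiv_eq hx
    refine ⟨t * t, mul_ne_zero ht ht, ?_⟩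
    have h1 := symbol_dPlus_dMinus hom hη hρ.eventually_contMDiffAt
    change ((2 : ℕ).factorial : ℝ)⁻¹ • dPlus om (dMinus om fun y => (ρ y - ρ x) ^ 2 • η y) x = _
    rw [h1]
    have h2 : ∀ (α : Model n →L[ℝ] ℝ) (θ : Alt n (k + 1)), α = t • basisCovec (n := n) 0 →
        ptProj (om x) (k + 1) (covWedge k α (((n : ℝ) - (k : ℝ))⁻¹ •
          ptLam (om x) k (covWedge (k + 1) α θ))) =
        (t * t) • ptProj (om x) (k + 1) (covWedge k (basisCovec 0) (((n : ℝ) - (k : ℝ))⁻¹ •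
          ptLam (om x) k (covWedge (k + 1) (basisCovec 0) θ))) := by
      rintro α θ rfl
      simp only [covWedge_smul_left, map_smul]
      module
    have h3 := h2 _ (η x) h
    refine (congrArg (fun z => ((2 : ℕ).factorial : ℝ)⁻¹ • (2 : ℝ) • z) h3).trans ?_
    rw [Nat.factorial_two, Nat.cast_ofNat]
    exact inv_smul_smul₀ two_ne_zero _
  refine ⟨fun h x hx => ?_, fun h x hx ρ hρ => ?_⟩
  · have hρ := isBoundaryDefiningAt_extChartAt_zero
      (mem_chart_source (EuclideanHalfSpace (2 * n)) x)
    obtain ⟨t, ht, h1⟩ := key x hx _ hρ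
    exact (smul_eq_zero.1 (h1.symm.trans (h x hx _ hρ))).resolve_left ht
  · obtain ⟨t, -, h1⟩ := key x hx ρ hρ
    rw [h1, h x hx]
    exact smul_zero t

end Symbols

/-! ### Local constructions and gluing -/

section Gluing

variable {n : ℕ} [NeZero n] {M : Type*} [TopologicalSpace M]
  [ChartedSpace (EuclideanHalfSpace (2 * n)) M] [IsManifold (𝓡∂ (2 * n)) ∞ M]

theorem mem_smoothForms_univ {k : ℕ} {η : Form n M k} :
    η ∈ smoothForms Set.univ k ↔ IsSmooth η :=
  ⟨fun h x => h x trivial, fun h x _ => h x⟩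

/-- A smooth form satisfying convex pointwise conditions exists as soon as it exists in the domain
of each chart. -/
theorem exists_isSmooth_of_local [T2Space M] [SigmaCompactSpace M] {k : ℕ} (S : M → Set (Alt n k))
    (hS : ∀ x, Convex ℝ (S x))
    (hloc : ∀ x₀ : M, ∃ η ∈ smoothForms (n := n) (chartAt (EuclideanHalfSpace (2 * n)) x₀).source k,
      ∀ x ∈ (chartAt (EuclideanHalfSpace (2 * n)) x₀).source, η x ∈ S x) :
    ∃ η : Form n M k, IsSmooth η ∧ ∀ x, η x ∈ S x := by
  obtain ⟨s, hs⟩ := exists_contMDiffSection_forall_mem_convex_of_local (n := ⊤) (𝓡∂ (2 * n))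
    (F_fiber := Alt n k)
    (fun x : M => (TangentSpace (𝓡∂ (2 * n)) x) [⋀^Fin k]→L[ℝ] (Bundle.Trivial M ℝ x)) S hS
    (fun x₀ => by
      obtain ⟨η, hη, hηS⟩ := hloc x₀
      exact ⟨_, (chartAt (EuclideanHalfSpace (2 * n)) x₀).open_source.mem_nhds
        (mem_chart_source _ x₀), η, fun x hx => (hη x hx).contMDiffWithinAt, hηS⟩)
  exact ⟨s, s.contMDiff, hs⟩

/-- The differential at `x` of the first coordinate of the chart at `x₀`. -/
def bdryCovec (x₀ x : M) : Model n →L[ℝ] ℝ := (basisCovec (n := n) 0).comp (coframeAt x₀ x)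

/-- The first coordinate vector field of the chart at `x₀`, at the point `x`. -/
def bdryVec (x₀ x : M) : Model n := frameAt x₀ x (basisVec (n := n) 0)

theorem bdryCovec_bdryVec {x₀ x : M}
    (hx : x ∈ (chartAt (EuclideanHalfSpace (2 * n)) x₀).source) :
    bdryCovec (n := n) x₀ x (bdryVec x₀ x) = 1 := by
  change basisCovec (n := n) 0 (coframeAt x₀ x (frameAt x₀ x (basisVec 0))) = 1
  rw [coframeAt_frameAt hx, basisCovec_basisVec, if_pos rfl]

theorem wedge_bdryCovec_mem_smoothForms (x₀ : M) {k : ℕ} {η : Form n M k}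
    (hη : η ∈ smoothForms (n := n) (chartAt (EuclideanHalfSpace (2 * n)) x₀).source k) :
    pointwise (fun x => covWedge k (bdryCovec x₀ x)) η ∈
      smoothForms (chartAt (EuclideanHalfSpace (2 * n)) x₀).source (k + 1) := by
  intro x hx
  rw [isSmoothAt_iff hx]
  refine (ContMDiffAt.linearMap_comp (covWedge k (basisCovec 0))
    ((isSmoothAt_iff hx).1 (hη x hx))).congr_of_eventuallyEq ?_
  filter_upwards [(chartAt (EuclideanHalfSpace (2 * n)) x₀).open_source.mem_nhds hx] with y hy
  refine (pull_covWedge _ _ _).trans ?_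
  have h : (bdryCovec (n := n) x₀ y).comp (frameAt x₀ y) = basisCovec 0 := by
    ext v
    exact congrArg (basisCovec (n := n) 0) (coframeAt_frameAt hy v)
  rw [h]
  rfl

theorem interior_bdryVec_mem_smoothForms (x₀ : M) {k : ℕ} {η : Form n M (k + 1)}
    (hη : η ∈ smoothForms (n := n) (chartAt (EuclideanHalfSpace (2 * n)) x₀).source (k + 1)) :
    pointwise (fun x => interior k (bdryVec x₀ x)) η ∈
      smoothForms (chartAt (EuclideanHalfSpace (2 * n)) x₀).source k := by
  intro x hx
  rw [isSmoothAt_iff hx]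
  refine (ContMDiffAt.linearMap_comp (interior k (basisVec 0))
    ((isSmoothAt_iff hx).1 (hη x hx))).congr_of_eventuallyEq ?_
  exact Filter.Eventually.of_forall fun y => (interior_pull _ _ _).symm

omit [NeZero n] in
theorem convex_setOf_linear_eq {k l : ℕ} (T : Alt n k →ₗ[ℝ] Alt n l) (a : Alt n l) :
    Convex ℝ {η | T η = a} := by
  intro η hη ξ hξ s t _ _ hst
  change T _ = a
  rw [map_add, map_smul, map_smul, show T η = a from hη, show T ξ = a from hξ, ← add_smul, hst,
    one_smul]

omit [NeZero n] in
/-- The boundary condition on the correction term, for a covector `α` proportional to `e`. -/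
theorem covWedge_ptL_neg_interior {w : Alt n 2} {α e : Model n →L[ℝ] ℝ} {u : Model n} {t : ℝ}
    (hα : α = t • e) (ht : t ≠ 0) (hu : α u = 1) {j : ℕ} {β : Alt n (j + 2)} {c : ℝ}
    {μ : Alt n (j + 1)} (hμ : μ = c • ptLam w (j + 1) (covWedge (j + 2) e β))
    (h1 : covWedge (j + 2) e β = ptL w (j + 1) μ) (h2 : covWedge (j + 1) e μ = 0) :
    covWedge (j + 2) e (ptL w j
      (-interior j u (c • ptLam w (j + 1) (covWedge (j + 2) α β)))) = -covWedge (j + 2) e β := by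
  have h4 : c • ptLam w (j + 1) (covWedge (j + 2) α β) = t • μ := by
    rw [hα, covWedge_smul_left, map_smul, smul_comm, hμ]
  have h5 : covWedge (j + 2) α β = ptL w (j + 1) (t • μ) := by
    rw [hα, covWedge_smul_left, h1, map_smul]
  have h6 : covWedge (j + 1) α (t • μ) = 0 := by
    rw [hα, covWedge_smul_left, map_smul, h2, smul_zero, smul_zero]
  have h7 := covWedge_add_ptL_eq_zero hu h5 h6
  rw [hα, covWedge_smul_left, smul_eq_zero] at h7
  have h8 := h7.resolve_left ht
  rw [map_add, ← h4, hα] at h8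
  rw [hα]
  exact eq_neg_of_add_eq_zero_right h8

omit [NeZero n] in
theorem ptL_covWedge_add {w : Alt n 2} {α : Model n →L[ℝ] ℝ} {u : Model n} (hu : α u = 1) {i : ℕ}
    {θ : Alt n (i + 3)} {ξ₁ : Alt n i} {ξ₂ : Alt n (i + 1)}
    (h1 : ptL w i ξ₁ = interior (i + 2) u θ)
    (h2 : ptL w (i + 1) ξ₂ = interior (i + 3) u (covWedge (i + 3) α θ)) :
    ptL w (i + 1) (covWedge i α ξ₁ + ξ₂) = θ := by
  rw [map_add, ← covWedge_ptL, h1, h2, interior_covWedge, hu, one_smul]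
  exact add_sub_cancel _ _

variable {om : Form n M 2} (hom : IsSymplectic om)
include hom

/-- If, along the boundary, `dx⁰ ∧ β = ω ∧ μ` with `dx⁰ ∧ μ = 0`, where `μ` depends on `β` through
`Λ`, then `β` can be corrected by an element of the image of `L` to a form satisfying `D`. -/
theorem exists_covWedge_add_lef_eq_zero [T2Space M] [SigmaCompactSpace M] {j : ℕ}
    {β : Form n M (j + 2)} (hβ : IsSmooth β) (c : ℝ)
    (h : ∀ x ∈ (𝓡∂ (2 * n)).boundary M, ∀ μ : Alt n (j + 1),
      μ = c • ptLam (om x) (j + 1) (covWedge (j + 2) (basisCovec 0) (β x)) →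
      covWedge (j + 2) (basisCovec 0) (β x) = ptL (om x) (j + 1) μ ∧
        covWedge (j + 1) (basisCovec 0) μ = 0) :
    ∃ γ : Form n M j, IsSmooth γ ∧ ∀ x ∈ (𝓡∂ (2 * n)).boundary M,
      covWedge (j + 2) (basisCovec 0) ((β + lef om j γ) x) = 0 := by
  suffices hex : ∃ γ : Form n M j, IsSmooth γ ∧ ∀ x, γ x ∈ {γ : Alt n j |
      x ∈ (𝓡∂ (2 * n)).boundary M → (covWedge (j + 2) (basisCovec 0) ∘ₗ ptL (om x) j) γ =
        - covWedge (j + 2) (basisCovec 0) (β x)} by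
    obtain ⟨γ, hγ, hγ'⟩ := hex
    refine ⟨γ, hγ, fun x hx => (map_add _ _ _).trans ?_⟩
    exact (congrArg (covWedge (j + 2) (basisCovec 0) (β x) + ·) (hγ' x hx)).trans (add_neg_cancel _)
  refine exists_isSmooth_of_local _ ?_ ?_
  · intro x
    by_cases hx : x ∈ (𝓡∂ (2 * n)).boundary M
    · simp only [hx, true_imp_iff]
      exact convex_setOf_linear_eq _ _
    · simp only [hx, false_imp_iff]
      exact convex_univ
  · intro x₀
    have hs : β ∈ smoothForms (n := n) (chartAt (EuclideanHalfSpace (2 * n)) x₀).source (j + 2) :=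
      fun x _ => hβ x
    have h1 : (c • dualLef om (j + 1) (pointwise (fun x => covWedge (j + 2) (bdryCovec x₀ x)) β)) ∈
        smoothForms (n := n) (chartAt (EuclideanHalfSpace (2 * n)) x₀).source (j + 1) :=
      (smoothForms _ _).smul_mem c fun x hx =>
        (wedge_bdryCovec_mem_smoothForms x₀ hs x hx).dualLef hom
    refine ⟨_, (smoothForms _ _).neg_mem (interior_bdryVec_mem_smoothForms x₀ h1),
      fun x hx hb => ?_⟩
    obtain ⟨t, ht, hα⟩ := exists_basisCovec_comp_coframeAt hx hb
    obtain ⟨h2, h3⟩ := h x hb _ rfl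
    exact covWedge_ptL_neg_interior hα ht (bdryCovec_bdryVec hx) rfl h2 h3

/-- Above the middle degree `L` has a right inverse on smooth forms that preserves pointwise
vanishing. -/
theorem exists_lef_eq (U : Set M) {m : ℕ} (hm : n < m + 2) {θ : Form n M (m + 2)}
    (hθ : θ ∈ smoothForms (n := n) U (m + 2)) :
    ∃ ξ ∈ smoothForms (n := n) U m, lef om m ξ = θ ∧ ∀ x, θ x = 0 → ξ x = 0 := by
  obtain ⟨ψ, hψ⟩ := ((isLefschetzPair_smoothForms hom U).bijective_L_lam hm).2 ⟨θ, hθ⟩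
  have h1 : lef om m (dualLef om m ψ.1) = θ := congrArg Subtype.val hψ
  refine ⟨dualLef om m ψ.1, fun x hx => (ψ.2 x hx).dualLef hom, h1, fun x hx => ?_⟩
  have h2 : ptL (om x) m (ptLam (om x) m (ψ.1 x)) = 0 := (congrFun h1 x).trans hx
  have h3 : ψ.1 x = 0 :=
    ((isLefschetzPair_pt (hom.isUnit_det x)).bijective_L_lam hm).1 (h2.trans (map_zero _).symm)
  exact (congrArg (ptLam (om x) m) h3).trans (map_zero _)

/-- From the middle degree on, `L` maps the forms satisfying `D` onto those satisfying `D`. -/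
theorem exists_isSmooth_lef_eq [T2Space M] [SigmaCompactSpace M] {j : ℕ} (hj : n ≤ j)
    {θ : Form n M (j + 2)} (hθ : IsSmooth θ)
    (hb : ∀ x ∈ (𝓡∂ (2 * n)).boundary M, covWedge (j + 2) (basisCovec 0) (θ x) = 0) :
    ∃ η : Form n M j, IsSmooth η ∧ lef om j η = θ ∧
      ∀ x ∈ (𝓡∂ (2 * n)).boundary M, covWedge j (basisCovec 0) (η x) = 0 := by
  obtain ⟨i, rfl⟩ : ∃ i, j = i + 1 := ⟨j - 1, by have := NeZero.pos n; omega⟩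
  suffices hex : ∃ η : Form n M (i + 1), IsSmooth η ∧ ∀ x, η x ∈
      {η : Alt n (i + 1) | ptL (om x) (i + 1) η = θ x} ∩ {η | x ∈ (𝓡∂ (2 * n)).boundary M →
        covWedge (i + 1) (basisCovec 0) η = 0} by
    obtain ⟨η, hη, hη'⟩ := hex
    exact ⟨η, hη, funext fun x => (hη' x).1, fun x hx => (hη' x).2 hx⟩
  refine exists_isSmooth_of_local _ ?_ ?_
  · intro x
    refine (convex_setOf_linear_eq _ _).inter ?_
    by_cases hx : x ∈ (𝓡∂ (2 * n)).boundary M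
    · simp only [hx, true_imp_iff]
      exact convex_setOf_linear_eq _ _
    · simp only [hx, false_imp_iff]
      exact convex_univ
  · intro x₀
    have hs : θ ∈ smoothForms (n := n) (chartAt (EuclideanHalfSpace (2 * n)) x₀).source (i + 3) :=
      fun x _ => hθ x
    -- With `α(u) = 1`, `θ = α ∧ ι_u θ + ι_u (α ∧ θ)`; invert `L` on `ι_u θ` and on `ι_u (α ∧ θ)`.
    obtain ⟨ξ₁, hξ₁, e₁, -⟩ := exists_lef_eq hom _ (m := i) (by omega)
      (interior_bdryVec_mem_smoothForms x₀ hs)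
    obtain ⟨ξ₂, hξ₂, e₂, z₂⟩ := exists_lef_eq hom _ (m := i + 1) (by omega)
      (interior_bdryVec_mem_smoothForms x₀ (wedge_bdryCovec_mem_smoothForms x₀ hs))
    refine ⟨_, (smoothForms _ _).add_mem (wedge_bdryCovec_mem_smoothForms x₀ hξ₁) hξ₂,
      fun x hx => ⟨?_, fun hbx => ?_⟩⟩
    · exact ptL_covWedge_add (bdryCovec_bdryVec hx) (congrFun e₁ x) (congrFun e₂ x)
    · obtain ⟨t, ht, hα⟩ := exists_basisCovec_comp_coframeAt hx hbx
      have hα' : bdryCovec (n := n) x₀ x = t • basisCovec 0 := hα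
      have h1 : ∀ θ : Alt n (i + 3), covWedge (i + 3) (basisCovec 0) θ = 0 →
          interior (i + 3) (bdryVec x₀ x) (covWedge (i + 3) (bdryCovec x₀ x) θ) = 0 := by
        intro θ h
        rw [hα', covWedge_smul_left, h, smul_zero, map_zero]
      have h2 : ∀ (ζ₁ : Alt n i) (ζ₂ : Alt n (i + 1)), ζ₂ = 0 →
          covWedge (i + 1) (basisCovec 0) (covWedge i (bdryCovec x₀ x) ζ₁ + ζ₂) = 0 := by
        rintro ζ₁ _ rfl
        rw [add_zero, hα', covWedge_smul_left, map_smul, covWedge_covWedge_self, smul_zero]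
      exact h2 _ _ (z₂ x (h1 _ (hb x hbx)))

end Gluing

/-! ### The exact sequences -/

/-- A criterion for short exactness in terms of elements of the ambient spaces. -/
theorem IsShortExact.of_sets {V₁ V₂ V₃ : Type*} [AddCommGroup V₁] [Module ℝ V₁] [AddCommGroup V₂]
    [Module ℝ V₂] [AddCommGroup V₃] [Module ℝ V₃] {A : Set V₁} {f : V₁ →ₗ[ℝ] V₂} {B : Set V₂}
    {g : V₂ →ₗ[ℝ] V₃} {C : Set V₃} (hA : ∃ A' : Submodule ℝ V₁, (A' : Set V₁) = A)
    (hB : ∃ B' : Submodule ℝ V₂, (B' : Set V₂) = B) (hC : ∃ C' : Submodule ℝ V₃, (C' : Set V₃) = C)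
    (hf : ∀ a ∈ A, f a ∈ B) (hg : ∀ b ∈ B, g b ∈ C) (hinj : ∀ a ∈ A, f a = 0 → a = 0)
    (hzero : ∀ a ∈ A, g (f a) = 0) (hexact : ∀ b ∈ B, g b = 0 → ∃ a ∈ A, f a = b)
    (hsurj : ∀ c ∈ C, ∃ b ∈ B, g b = c) : IsShortExact A f B g C := by
  obtain ⟨A', rfl⟩ := hA
  obtain ⟨B', rfl⟩ := hB
  obtain ⟨C', rfl⟩ := hC
  refine ⟨A', B', C', rfl, rfl, rfl, hf, hg, ?_, ?_, ?_⟩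
  · refine (injective_iff_map_eq_zero _).2 fun a ha => Subtype.ext ?_
    exact hinj a a.2 (congrArg Subtype.val ha)
  · intro b
    constructor
    · intro hb
      obtain ⟨a, ha, hab⟩ := hexact b b.2 (congrArg Subtype.val hb)
      exact ⟨⟨a, ha⟩, Subtype.ext hab⟩
    · rintro ⟨a, rfl⟩
      exact Subtype.ext (hzero a a.2)
  · intro c
    obtain ⟨b, hb, hbc⟩ := hsurj c c.2
    exact ⟨⟨b, hb⟩, Subtype.ext hbc⟩

section Sequences

variable {n : ℕ} [NeZero n] {M : Type*} [TopologicalSpace M]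
  [ChartedSpace (EuclideanHalfSpace (2 * n)) M] [IsManifold (𝓡∂ (2 * n)) ∞ M]

/-- Smooth forms with values in given subspaces that satisfy a pointwise linear condition along the
boundary are a linear subspace. -/
theorem exists_submodule_coe_eq {k l : ℕ} {C : Set (Form n M k)}
    (S : M → Submodule ℝ (Alt n k)) (T : M → Alt n k →ₗ[ℝ] Alt n l)
    (hC : ∀ η, η ∈ C ↔ (IsSmooth η ∧ ∀ x, η x ∈ S x) ∧
      ∀ x ∈ (𝓡∂ (2 * n)).boundary M, T x (η x) = 0) :
    ∃ C' : Submodule ℝ (Form n M k), (C' : Set (Form n M k)) = C := by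
  have e : ∀ η, η ∈ C ↔ (η ∈ smoothForms Set.univ k ∧ ∀ x, η x ∈ S x) ∧
      ∀ x ∈ (𝓡∂ (2 * n)).boundary M, T x (η x) = 0 := fun η => by
    rw [hC, mem_smoothForms_univ]
  refine ⟨{ carrier := C, zero_mem' := ?_, add_mem' := ?_, smul_mem' := ?_ }, rfl⟩
  · intro η ξ hη hξ
    rw [e] at *
    exact ⟨⟨Submodule.add_mem _ hη.1.1 hξ.1.1, fun x => (S x).add_mem (hη.1.2 x) (hξ.1.2 x)⟩,
      fun x hx => ((T x).map_add _ _).trans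
        ((congrArg₂ (· + ·) (hη.2 x hx) (hξ.2 x hx)).trans (add_zero _))⟩
  · rw [e]
    exact ⟨⟨Submodule.zero_mem _, fun x => (S x).zero_mem⟩, fun x _ => (T x).map_zero⟩
  · intro c η hη
    rw [e] at *
    exact ⟨⟨Submodule.smul_mem _ _ hη.1.1, fun x => (S x).smul_mem c (hη.1.2 x)⟩,
      fun x hx => ((T x).map_smul _ _).trans ((congrArg (c • ·) (hη.2 x hx)).trans (smul_zero _))⟩

theorem mem_omegaD_iff {k : ℕ} {η : Form n M k} : η ∈ OmegaD n M k ↔ IsSmooth η ∧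
    ∀ x ∈ (𝓡∂ (2 * n)).boundary M, covWedge k (basisCovec 0) (η x) = 0 :=
  and_congr_right fun h => bdryD_iff h

variable (n M) in
theorem exists_submodule_omegaD (k : ℕ) :
    ∃ C' : Submodule ℝ (Form n M k), (C' : Set (Form n M k)) = OmegaD n M k :=
  exists_submodule_coe_eq (fun _ => ⊤) (fun _ => covWedge k (basisCovec 0))
    fun _ => mem_omegaD_iff.trans
      ⟨fun h => ⟨⟨h.1, fun _ => trivial⟩, h.2⟩, fun h => ⟨h.1.1, h.2⟩⟩

variable (n M) in
theorem zero_mem_omegaD (k : ℕ) : (0 : Form n M k) ∈ OmegaD n M k := by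
  obtain ⟨C, hC⟩ := exists_submodule_omegaD n M k
  rw [← hC]
  exact C.zero_mem

variable (n M) in
theorem exists_submodule_omegaDSubTwo : ∀ k : ℕ,
    ∃ C' : Submodule ℝ (FormSubTwo n M k), (C' : Set (FormSubTwo n M k)) = OmegaDSubTwo n M k
  | 0 => ⟨⊤, rfl⟩
  | 1 => ⟨⊤, rfl⟩
  | k + 2 => exists_submodule_omegaD n M k

theorem mem_primDPlus_iff {om : Form n M 2} {k : ℕ} {η : Form n M k} :
    η ∈ PrimDPlus om k ↔ (IsSmooth η ∧ ∀ x, η x ∈ ptPrim (om x) k) ∧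
      ∀ x ∈ (𝓡∂ (2 * n)).boundary M,
        ptProj (om x) (k + 1) (covWedge k (basisCovec 0) (η x)) = 0 :=
  and_congr_right fun h => bdryDPlus_iff om h.1

theorem mem_primDMinus_iff {om : Form n M 2} {k : ℕ} (hk : k + 1 ≤ n) {η : Form n M (k + 1)} :
    η ∈ PrimDMinus om (k + 1) ↔ (IsSmooth η ∧ ∀ x, η x ∈ ptPrim (om x) (k + 1)) ∧
      ∀ x ∈ (𝓡∂ (2 * n)).boundary M,
        ptLam (om x) k (covWedge (k + 1) (basisCovec 0) (η x)) = 0 :=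
  and_congr_right fun h => bdryDMinus_iff om hk h.1

theorem exists_submodule_primDPlus (om : Form n M 2) (k : ℕ) :
    ∃ C' : Submodule ℝ (Form n M k), (C' : Set (Form n M k)) = PrimDPlus om k :=
  exists_submodule_coe_eq (fun x => ptPrim (om x) k)
    (fun x => ptProj (om x) (k + 1) ∘ₗ covWedge k (basisCovec 0)) fun _ => mem_primDPlus_iff

theorem exists_submodule_primDMinus (om : Form n M 2) {k : ℕ} (hk : k ≤ n) :
    ∃ C' : Submodule ℝ (Form n M k), (C' : Set (Form n M k)) = PrimDMinus om k := by
  match k, hk with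
  | 0, _ =>
    exact exists_submodule_coe_eq (fun x => ptPrim (om x) 0) (fun x => (0 : Alt n 0 →ₗ[ℝ] Alt n 0))
      fun η => ⟨fun h => ⟨h.1, fun _ _ => rfl⟩, fun h => ⟨h.1, trivial⟩⟩
  | k + 1, hk =>
    exact exists_submodule_coe_eq (fun x => ptPrim (om x) (k + 1))
      (fun x => ptLam (om x) k ∘ₗ covWedge (k + 1) (basisCovec 0)) fun _ => mem_primDMinus_iff hk

variable {om : Form n M 2} (hom : IsSymplectic om)
include hom

theorem mem_primDPlusMinus_iff {k : ℕ} {η : Form n M (k + 1)} :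
    η ∈ PrimDPlusMinus om (k + 1) ↔ (IsSmooth η ∧ ∀ x, η x ∈ ptPrim (om x) (k + 1)) ∧
      ∀ x ∈ (𝓡∂ (2 * n)).boundary M,
        ptProj (om x) (k + 1) (covWedge k (basisCovec 0) (((n : ℝ) - (k : ℝ))⁻¹ •
          ptLam (om x) k (covWedge (k + 1) (basisCovec 0) (η x)))) = 0 :=
  and_congr_right fun h => bdryDPlusMinus_iff hom h.1

theorem exists_submodule_primDPlusMinus (k : ℕ) : ∃ C' : Submodule ℝ (Form n M (k + 1)),
    (C' : Set (Form n M (k + 1))) = PrimDPlusMinus om (k + 1) :=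
  exists_submodule_coe_eq (fun x => ptPrim (om x) (k + 1))
    (fun x => ptProj (om x) (k + 1) ∘ₗ covWedge k (basisCovec 0) ∘ₗ
      (((n : ℝ) - (k : ℝ))⁻¹ • ptLam (om x) k) ∘ₗ covWedge (k + 1) (basisCovec 0))
    fun _ => mem_primDPlusMinus_iff hom

theorem lef_mem_omegaD {k : ℕ} {η : Form n M k} (hη : η ∈ OmegaD n M k) :
    lef om k η ∈ OmegaD n M (k + 2) := by
  rw [mem_omegaD_iff] at hη ⊢
  refine ⟨fun x => IsSmoothAt.lef hom (hη.1 x), fun x hx => ?_⟩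
  refine (covWedge_ptL (w := om x) (basisCovec 0) (η x)).trans ?_
  exact (congrArg (ptL (om x) (k + 1)) (hη.2 x hx)).trans (map_zero _)

theorem eq_zero_of_lef_eq_zero {k : ℕ} (hk : k < n) {η : Form n M k} (h : lef om k η = 0) :
    η = 0 :=
  funext fun x => (isLefschetzPair_pt (hom.isUnit_det x)).injective_L hk
    ((congrFun h x).trans (map_zero (ptL (om x) k)).symm)

/-- `Π` preserves smoothness, by the Lefschetz decomposition of smooth forms. -/
theorem isSmooth_primProj {k : ℕ} (hk : k ≤ n) {η : Form n M k} (hη : IsSmooth η) :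
    IsSmooth (primProj om k η) := by
  match k, hk, η, hη with
  | 0, hk, η, hη =>
    have h : primProj om 0 η = η :=
      funext fun x => ptProj_of_mem_ptPrim (hom.isUnit_det x) hk (η := η x) trivial
    rwa [h]
  | 1, hk, η, hη =>
    have h : primProj om 1 η = η :=
      funext fun x => ptProj_of_mem_ptPrim (hom.isUnit_det x) hk (η := η x) trivial
    rwa [h]
  | k + 2, hk, η, hη =>
    have hc := (isLefschetzPair_smoothForms hom Set.univ).isCompl_prim_im hk
    obtain ⟨β, hβ, δ, ⟨γ, rfl⟩, h⟩ := Submodule.mem_sup.1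
      (hc.sup_eq_top.ge (Submodule.mem_top (x := ⟨η, mem_smoothForms_univ.2 hη⟩)))
    have h1 : primProj om (k + 2) η = β.1 := by
      have h2 : η = β.1 + lef om k γ.1 := (congrArg Subtype.val h).symm
      have h3 : ∀ x, β.1 x ∈ ptPrim (om x) (k + 2) := fun x =>
        congrFun (congrArg Subtype.val (show _ = _ from hβ)) x
      rw [h2]
      refine funext fun x => ((ptProj (om x) (k + 2)).map_add _ _).trans ?_
      exact (congrArg₂ (· + ·) (ptProj_of_mem_ptPrim (hom.isUnit_det x) hk (h3 x))
        (ptProj_ptL (hom.isUnit_det x) hk (γ.1 x))).trans (add_zero _)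
    rw [h1]
    exact mem_smoothForms_univ.1 β.2

theorem primProj_mem_prim {k : ℕ} (hk : k ≤ n) (η : Form n M k) (x : M) :
    primProj om k η x ∈ ptPrim (om x) k :=
  ptProj_mem (hom.isUnit_det x) hk (η x)

theorem primProj_of_mem_prim {k : ℕ} (hk : k ≤ n) {β : Form n M k}
    (hβ : ∀ x, β x ∈ ptPrim (om x) k) : primProj om k β = β :=
  funext fun x => ptProj_of_mem_ptPrim (hom.isUnit_det x) hk (hβ x)

/-- The kernel of `Π` in degree `k ≤ n` on smooth forms is the image of `L` on smooth forms. -/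
theorem exists_lef_eq_of_primProj_eq_zero {k : ℕ} (hk : k + 2 ≤ n) {η : Form n M (k + 2)}
    (hη : IsSmooth η) (h0 : primProj om (k + 2) η = 0) :
    ∃ γ : Form n M k, IsSmooth γ ∧ lef om k γ = η := by
  have hc := (isLefschetzPair_smoothForms hom Set.univ).isCompl_prim_im hk
  obtain ⟨β, hβ, δ, ⟨γ, rfl⟩, h⟩ := Submodule.mem_sup.1
    (hc.sup_eq_top.ge (Submodule.mem_top (x := ⟨η, mem_smoothForms_univ.2 hη⟩)))
  refine ⟨γ.1, mem_smoothForms_univ.1 γ.2, ?_⟩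
  have h2 : β.1 + lef om k γ.1 = η := congrArg Subtype.val h
  have h3 : ∀ x, β.1 x ∈ ptPrim (om x) (k + 2) := fun x =>
    congrFun (congrArg Subtype.val (show _ = _ from hβ)) x
  have h4 : primProj om (k + 2) (lef om k γ.1) = 0 :=
    funext fun x => ptProj_ptL (hom.isUnit_det x) hk (γ.1 x)
  rw [← h2, map_add, primProj_of_mem_prim hom hk h3, h4, add_zero] at h0
  rw [← h2, h0, zero_add]

theorem lefSubTwo_mem_omegaD : ∀ {k : ℕ}, ∀ a ∈ OmegaDSubTwo n M k, lefSubTwo om k a ∈ OmegaD n M k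
  | 0, _, _ => zero_mem_omegaD n M 0
  | 1, _, _ => zero_mem_omegaD n M 1
  | _ + 2, _, ha => lef_mem_omegaD hom ha

theorem eq_zero_of_lefSubTwo_eq_zero : ∀ {k : ℕ}, k ≤ n → ∀ {a : FormSubTwo n M k},
    lefSubTwo om k a = 0 → a = 0
  | 0, _, _, _ => rfl
  | 1, _, _, _ => rfl
  | _ + 2, hk, _, h => eq_zero_of_lef_eq_zero hom (by omega) h

theorem primProj_lefSubTwo : ∀ {k : ℕ}, k ≤ n → ∀ a : FormSubTwo n M k,
    primProj om k (lefSubTwo om k a) = 0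
  | 0, _, _ => map_zero (primProj om 0)
  | 1, _, _ => map_zero (primProj om 1)
  | _ + 2, hk, a => funext fun x => ptProj_ptL (hom.isUnit_det x) hk (a x)

/-- The sequences with `Π`, for a space `C` of primitive forms that is the image of `Ωᵏ_D`. -/
theorem isShortExact_primProj {k : ℕ} (hk : k ≤ n) {C : Set (Form n M k)}
    (hC : ∃ C' : Submodule ℝ (Form n M k), (C' : Set (Form n M k)) = C)
    (hmaps : ∀ η ∈ OmegaD n M k, primProj om k η ∈ C)
    (hsurj : ∀ β ∈ C, ∃ η ∈ OmegaD n M k, primProj om k η = β) :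
    IsShortExact (OmegaDSubTwo n M k) (lefSubTwo om k) (OmegaD n M k) (primProj om k) C := by
  refine IsShortExact.of_sets (exists_submodule_omegaDSubTwo n M k) (exists_submodule_omegaD n M k)
    hC ?_ hmaps ?_ ?_ ?_ hsurj
  · exact fun a ha => lefSubTwo_mem_omegaD hom a ha
  · exact fun a _ => eq_zero_of_lefSubTwo_eq_zero hom hk
  · exact fun a _ => primProj_lefSubTwo hom hk a
  · match k, hk with
    | 0, hk =>
      intro b _ h
      exact ⟨0, trivial, h.symm.trans (primProj_of_mem_prim hom hk fun _ => trivial)⟩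
    | 1, hk =>
      intro b _ h
      exact ⟨0, trivial, h.symm.trans (primProj_of_mem_prim hom hk fun _ => trivial)⟩
    | k + 2, hk =>
      intro b hb h
      rw [mem_omegaD_iff] at hb
      obtain ⟨γ, hγ, rfl⟩ := exists_lef_eq_of_primProj_eq_zero hom hk hb.1 h
      refine ⟨γ, mem_omegaD_iff.2 ⟨hγ, fun x hx => ?_⟩, rfl⟩
      apply (isLefschetzPair_pt (hom.isUnit_det x)).injective_L (k := k + 1) (by omega)
      exact (covWedge_ptL (w := om x) (basisCovec 0) (γ x)).symm.trans
        ((hb.2 x hx).trans (map_zero _).symm)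

variable [T2Space M] [SigmaCompactSpace M]

/-- A primitive form `β` for which `dx⁰ ∧ β = ω ∧ μ` with `dx⁰ ∧ μ = 0` along the boundary is the
primitive part of a form satisfying `D`. -/
theorem exists_omegaD_primProj_eq {k : ℕ} (hk : k + 1 ≤ n) {β : Form n M (k + 1)}
    (hβ : IsSmooth β) (hprim : ∀ x, β x ∈ ptPrim (om x) (k + 1))
    (h : ∀ x ∈ (𝓡∂ (2 * n)).boundary M, ∀ μ : Alt n k,
      μ = ((n : ℝ) - (k : ℝ))⁻¹ • ptLam (om x) k (covWedge (k + 1) (basisCovec 0) (β x)) →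
      covWedge (k + 1) (basisCovec 0) (β x) = ptL (om x) k μ ∧
        covWedge k (basisCovec 0) μ = 0) :
    ∃ η ∈ OmegaD n M (k + 1), primProj om (k + 1) η = β := by
  cases k with
  | zero =>
    refine ⟨β, mem_omegaD_iff.2 ⟨hβ, fun x hx => ?_⟩, primProj_of_mem_prim hom hk hprim⟩
    obtain ⟨h1, h2⟩ := h x hx _ rfl
    rw [eq_zero_of_covWedge_eq_zero _ h2] at h1
    exact h1.trans (map_zero _)
  | succ j =>
    obtain ⟨γ, hγ, hγ'⟩ := exists_covWedge_add_lef_eq_zero hom hβ _ h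
    refine ⟨β + lef om j γ, mem_omegaD_iff.2 ⟨fun x => IsSmoothAt.add (hβ x)
      (IsSmoothAt.lef hom (hγ x)), hγ'⟩, ?_⟩
    have h4 : primProj om (j + 2) (lef om j γ) = 0 :=
      funext fun x => ptProj_ptL (hom.isUnit_det x) hk (γ x)
    rw [map_add, primProj_of_mem_prim hom hk hprim]
    exact (congrArg (β + ·) h4).trans (add_zero _)

theorem isShortExact_primDPlus {k : ℕ} (hk : k < n) :
    IsShortExact (OmegaDSubTwo n M k) (lefSubTwo om k) (OmegaD n M k) (primProj om k)
      (PrimDPlus om k) := by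
  refine isShortExact_primProj hom hk.le (exists_submodule_primDPlus om k) (fun η hη => ?_)
    (fun β hβ => ?_)
  · rw [mem_omegaD_iff] at hη
    exact mem_primDPlus_iff.2 ⟨⟨isSmooth_primProj hom hk.le hη.1, primProj_mem_prim hom hk.le η⟩,
      fun x hx => ptProj_covWedge_ptProj (hom.isUnit_det x) hk _ (η x) (hη.2 x hx)⟩
  · rw [mem_primDPlus_iff] at hβ
    cases k with
    | zero =>
      refine ⟨β, mem_omegaD_iff.2 ⟨hβ.1.1, fun x hx => ?_⟩,
        primProj_of_mem_prim hom hk.le hβ.1.2⟩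
      rw [← hβ.2 x hx]
      exact (ptProj_of_mem_ptPrim (hom.isUnit_det x) (k := 1) (by omega) trivial).symm
    | succ j =>
      exact exists_omegaD_primProj_eq hom hk.le hβ.1.1 hβ.1.2 fun x hx μ hμ =>
        covWedge_eq_of_ptProj_eq_zero (hom.isUnit_det x) 0 hk (hβ.1.2 x) (hβ.2 x hx) hμ

theorem isShortExact_primDPlusMinus {k : ℕ} (hk : k = n) :
    IsShortExact (OmegaDSubTwo n M k) (lefSubTwo om k) (OmegaD n M k) (primProj om k)
      (PrimDPlusMinus om k) := by
  cases k with
  | zero => exact absurd hk.symm (NeZero.ne n)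
  | succ j =>
    refine isShortExact_primProj hom hk.le (exists_submodule_primDPlusMinus hom j) (fun η hη => ?_)
      (fun β hβ => ?_)
    · rw [mem_omegaD_iff] at hη
      refine (mem_primDPlusMinus_iff hom).2
        ⟨⟨isSmooth_primProj hom hk.le hη.1, primProj_mem_prim hom hk.le η⟩, fun x hx => ?_⟩
      exact (congrArg (ptProj (om x) (j + 1)) (covWedge_ptLam_covWedge_ptProj (hom.isUnit_det x) 0
        hk (η x) (hη.2 x hx))).trans (map_zero _)
    · rw [mem_primDPlusMinus_iff hom] at hβ
      refine exists_omegaD_primProj_eq hom hk.le hβ.1.1 hβ.1.2 fun x hx μ hμ => ?_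
      refine covWedge_eq_of_ptProj_covWedge_eq_zero (hom.isUnit_det x) 0 hk (hβ.1.2 x) hμ ?_
      rw [hμ]
      exact hβ.2 x hx

theorem surjOn_lef {j : ℕ} (hj : n ≤ j) :
    Set.SurjOn (lef om j) (OmegaD n M j) (OmegaD n M (j + 2)) := by
  intro θ hθ
  rw [mem_omegaD_iff] at hθ
  obtain ⟨η, hη, h1, h2⟩ := exists_isSmooth_lef_eq hom hj hθ.1 hθ.2
  exact ⟨η, mem_omegaD_iff.2 ⟨hη, h2⟩, h1⟩

omit hom [IsManifold (𝓡∂ (2 * n)) ∞ M] [T2Space M] [SigmaCompactSpace M] in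
theorem lefPow_apply (om : Form n M 2) (k r : ℕ) (β : Form n M k) (x : M) :
    lefPow om k r β x = iterL (ptL (om x)) k r (β x) := by
  induction r with
  | zero => rfl
  | succ r ih => exact congrArg (ptL (om x) (k + 2 * r)) ih

theorem isShortExact_primDMinus {k r : ℕ} (hkr : k + r = n) :
    IsShortExact (PrimDMinus om k) (lefPow om k r) (OmegaD n M (k + 2 * r))
      (lef om (k + 2 * r)) (OmegaD n M (k + 2 * r + 2)) := by
  have hP := isLefschetzPair_smoothForms hom Set.univ
  have hpow : ∀ (s : ℕ) (β : smoothForms (n := n) (M := M) Set.univ k),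
      (iterL (V := fun k => smoothForms (n := n) Set.univ k)
        (fun k => (lef om k).restrict (p := smoothForms Set.univ k)
          (q := smoothForms Set.univ (k + 2)) fun _ hη x hx => (hη x hx).lef hom) k s β).1 =
        lefPow om k s β.1 := by
    intro s β
    induction s with
    | zero => rfl
    | succ s ih => exact congrArg (lef om (k + 2 * s)) ih
  -- `D` for `Lʳ β` is `D₋` for `β`
  have hbdry : ∀ β : Form n M k, IsSmooth β → (∀ x, β x ∈ ptPrim (om x) k) →
      (lefPow om k r β ∈ OmegaD n M (k + 2 * r) ↔ β ∈ PrimDMinus om k) := by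
    intro β hβ hprim
    have hs : IsSmooth (lefPow om k r β) := by
      rw [← hpow r ⟨β, mem_smoothForms_univ.2 hβ⟩]
      exact mem_smoothForms_univ.1 (Subtype.prop _)
    rw [mem_omegaD_iff]
    cases k with
    | zero =>
      exact ⟨fun _ => ⟨⟨hβ, hprim⟩, trivial⟩,
        fun _ => ⟨hs, fun x _ => alt_eq_zero_of_lt (by omega) _⟩⟩
    | succ j =>
      rw [mem_primDMinus_iff (by omega)]
      refine (and_iff_right hs).trans (Iff.trans ?_ (and_iff_right ⟨hβ, hprim⟩).symm)
      refine forall₂_congr fun x _ => ?_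
      rw [lefPow_apply]
      exact covWedge_iterL_eq_zero_iff_ptLam (hom.isUnit_det x) 0 hkr (hprim x)
  refine IsShortExact.of_sets (exists_submodule_primDMinus om (by omega))
    (exists_submodule_omegaD n M _) (exists_submodule_omegaD n M _)
    (fun β hβ => (hbdry β hβ.1.1 hβ.1.2).2 hβ) (fun η hη => lef_mem_omegaD hom hη) ?_ ?_ ?_
    (fun θ hθ => surjOn_lef hom (by omega) hθ)
  · intro β hβ h0
    refine funext fun x => (isLefschetzPair_pt (hom.isUnit_det x)).iterL_eq_zero hkr.le
      ((gradedPrim_ptLam (om x) k).symm ▸ hβ.1.2 x) ?_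
    rw [← lefPow_apply]
    exact congrFun h0 x
  · intro β hβ
    refine funext fun x => (lefPow_apply om k (r + 1) β x).trans ?_
    exact (isLefschetzPair_pt (hom.isUnit_det x)).iterL_succ_eq_zero hkr
      ((gradedPrim_ptLam (om x) k).symm ▸ hβ.1.2 x)
  · intro η hη h0
    obtain ⟨β, hβ, h1⟩ := hP.exists_iterL_eq hkr
      (x := ⟨η, mem_smoothForms_univ.2 (mem_omegaD_iff.1 hη).1⟩) (Subtype.ext h0)
    have h2 : lefPow om k r β.1 = η := (hpow r β).symm.trans (congrArg Subtype.val h1)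
    have h3 : ∀ x, β.1 x ∈ ptPrim (om x) k := by
      intro x
      match k, β, hβ with
      | 0, _, _ => trivial
      | 1, _, _ => trivial
      | k + 2, β, hβ => exact congrFun (congrArg Subtype.val (show _ = _ from hβ)) x
    exact ⟨β.1, (hbdry β.1 (mem_smoothForms_univ.1 β.2) h3).1 (h2.symm ▸ hη), h2⟩

end Sequences

end SymplecticBoundary

end

open SymplecticBoundary in
theorem proposition5p6 (n : ℕ) [NeZero n] (M : Type*) [TopologicalSpace M] [T2Space M]
    [SigmaCompactSpace M] [ChartedSpace (EuclideanHalfSpace (2 * n)) M]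
    [IsManifold (𝓡∂ (2 * n)) ∞ M] (om : Form n M 2) (hom : IsSymplectic om) :
    (∀ k < n, IsShortExact (OmegaDSubTwo n M k) (lefSubTwo om k) (OmegaD n M k)
      (primProj om k) (PrimDPlus om k)) ∧
    IsShortExact (OmegaDSubTwo n M n) (lefSubTwo om n) (OmegaD n M n)
      (primProj om n) (PrimDPlusMinus om n) ∧
    (∀ k r : ℕ, k + r = n → IsShortExact (PrimDMinus om k) (lefPow om k r)
      (OmegaD n M (k + 2 * r)) (lef om (k + 2 * r)) (OmegaD n M (k + 2 * r + 2))) ∧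
    (∀ j : ℕ, j + 1 ≤ n →
      Set.MapsTo (lef om j) (OmegaD n M j) (OmegaD n M (j + 2)) ∧
      Set.InjOn (lef om j) (OmegaD n M j)) ∧
    (∀ j : ℕ, n ≤ j → j + 2 ≤ 2 * n →
      Set.MapsTo (lef om j) (OmegaD n M j) (OmegaD n M (j + 2)) ∧
      Set.SurjOn (lef om j) (OmegaD n M j) (OmegaD n M (j + 2))) := by
  refine ⟨fun k hk => isShortExact_primDPlus hom hk, isShortExact_primDPlusMinus hom rfl,
    fun k r hkr => isShortExact_primDMinus hom hkr,
    fun j hj => ⟨fun η hη => lef_mem_omegaD hom hη, fun η _ ξ _ h => ?_⟩,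
    fun j hj _ => ⟨fun η hη => lef_mem_omegaD hom hη, surjOn_lef hom hj⟩⟩
  rw [← sub_eq_zero, ← map_sub] at h
  exact sub_eq_zero.1 (eq_zero_of_lef_eq_zero hom hj h)
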